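/- **Setting.** Let $H_1$ be a separable and $H_2$ an arbitrary real Hilbert space, $K\colon H_1\to H_2$ a continuous linear operator, and $Z=(Z_h)_{h\in H_2}$ the iso-Gaussian process on $H_2$ (zero-mean Gaussian process with $\operatorname{cov}(Z_h,Z_{h'})=\langle h,h'\rangle_2$). For $n\ge1$ one observes $Y=K\mu+n^{-1/2}Z$, i.e. the process $Y_h=\langle K\mu,h\rangle_2+n^{-1/2}Z_h$; under $\Pr_{\mu_0}$ this holds with $\mu=\mu_0$. The prior on $\mu$ is $N(0,\Lambda_n)$. Let $(e_i)_{i\ge1}$ be an orthonormal basis of $H_1$ with $K^TKe_i=\kappa_i^2e_i$ and $\Lambda_n e_i=\lambda_ie_i$, where $$\lambda_i=\tau_n^2i^{-1-2\alpha},\qquad C^{-1}i^{-p}\le\kappa_i\le Ci^{-p},$$ for some $\alpha>0$, $p\ge0$, $C\ge1$, and $\tau_n>0$ with $n\tau_n^2\to\infty$. For $\beta>0$ put $\|\mu\|_\beta=(\sum_i\langle\mu,e_i\rangle_1^2i^{2\beta})^{1/2}\in[0,\infty]$ and $S^\beta=\{\mu\in H_1:\|\mu\|_\beta<\infty\}$.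 Set $$A=\Lambda_nK^T(n^{-1}I+K\Lambda_nK^T)^{-1},\qquad S_n=\Lambda_n-A(n^{-1}I+K\Lambda_nK^T)A^T.$$ The process $(AY)_h=Y_{A^Th}$, $h\in H_1$, is realized as the random element $AY=\sum_iY_{A^Te_i}e_i$ of $H_1$ (the sum converges almost surely), and $\Pi_n(\cdot\mid Y)=N(AY,S_n)$. Fix $\gamma\in(0,1)$. The credible ball is $\{\mu\in H_1:\|\mu-AY\|_1<r_{n,\gamma}\}$, with $r_{n,\gamma}$ determined by $\Pi_n(\mu:\|\mu-AY\|_1<r_{n,\gamma}\mid Y)=1-\gamma$ (this radius does not depend on $Y$). Its coverage at $\mu_0$ is $\Pr_{\mu_0}(\|\mu_0-AY\|_1<r_{n,\gamma})$. Let $\tilde r_{n,\gamma}=\tilde r_{n,\gamma}(\mu_0)$ be the radius with $\Pr_{\mu_0}(\|\mu_0-AY\|_1<\tilde r_{n,\gamma})=1-\gamma$. Here $a_n\ll b_n$ (equivalently $b_n\gg a_n$) means $a_n/b_n\to0$, and $a_n\asymp b_n$ means that $|a_n/b_n|$ is bounded away from $0$ and $\infty$ as $n\to\infty$. **Theorem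 4.2 (Credibility).** For every $n\ge1$, $\Pi_n(\cdot\mid Y)=N(AY,S_n)$ is a version of the posterior distribution, i.e. of the conditional distribution of $\mu$ given $Y$ when $\mu\sim N(0,\Lambda_n)$ is independent of $Z$. Let $\tilde\beta=\beta\wedge(1+2\alpha+2p)$. As $n\to\infty$, the coverage of the credible ball behaves as follows. 1. (i) If $\tau_n\gg n^{(\alpha-\tilde\beta)/(1+2\tilde\beta+2p)}$, the coverage tends to $1$ uniformly in $\mu_0$ with $\|\mu_0\|_\beta\le1$; in this case $\tilde r_{n,\gamma}(\mu_0)\asymp r_{n,\gamma}$, uniformly in $\mu_0$ with $\|\mu_0\|_\beta\le R$, for every $R$ (in particular for every fixed $\mu_0\in S^\beta$). 2. (ii) If $\tau_n\asymp n^{(\alpha-\tilde\beta)/(1+2\tilde\beta+2p)}$ and $\beta<1+2\alpha+2p$, the coverage tends to $1$ for every fixed $\mu_0\in S^\beta$. If $\tau_n\asymp n^{(\alpha-\tilde\beta)/(1+2\tilde\beta+2p)}$ (for any $\beta>0$), then for every $c\in[0,1)$ there is a sequence $(\mu_0^n)$ with $\sup_n\|\mu_0^n\|_\beta<\infty$ along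 which the coverage tends to $c$. 3. (iii) If $\tau_n\ll n^{(\alpha-\tilde\beta)/(1+2\tilde\beta+2p)}$, there is a sequence $(\mu_0^n)$ with $\sup_n\|\mu_0^n\|_\beta<\infty$ along which the coverage tends to $0$. If $\tau_n\equiv1$, then the condition of case (i) holds if $\alpha<\beta$, both conditions of case (ii) (including $\beta<1+2\alpha+2p$) hold if $\alpha=\beta$, and the condition of case (iii) holds if $\alpha>\beta$; in the last case the sequence $\mu_0^n$ can be chosen fixed: there is a $\mu_0\in S^\beta$ at which the coverage tends to $0$. -/

import Mathlib

open Filter Topology Asymptotics MeasureTheory ProbabilityTheory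
open scoped ENNReal NNReal RealInnerProductSpace

noncomputable section GaussianInverseProblem

/-! ### Gaussian distributions on a Hilbert space and iso-Gaussian noise -/

section GaussianLaws

variable {H : Type*} [NormedAddCommGroup H] [InnerProductSpace ℝ H] [MeasurableSpace H]

/-- `ν` is the Gaussian distribution `N(m, S)`: it is Gaussian, and the process
`(⟪G, h⟫ : h ∈ H)`, `G ∼ ν`, has mean function `⟪m, h⟫` and covariance function `⟪h, S h'⟫`. -/
structure IsGaussianLaw (ν : Measure H) (m : H) (S : H →L[ℝ] H) : Prop where
  isGaussian : IsGaussian ν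
  mean : ∀ h : H, ∫ x, ⟪x, h⟫ ∂ν = ⟪m, h⟫
  cov : ∀ h h' : H, cov[fun x => ⟪x, h⟫, fun x => ⟪x, h'⟫; ν] = ⟪h, S h'⟫

open Classical in
/-- The Gaussian distribution `N(m, S)` on `H`. It is the zero measure if there is no Gaussian
distribution with mean `m` and covariance operator `S`. -/
def gaussianMeasure (m : H) (S : H →L[ℝ] H) : Measure H :=
  if h : ∃ ν : Measure H, IsGaussianLaw ν m S then h.choose else 0

instance gaussianMeasure_isFinite (m : H) (S : H →L[ℝ] H) :
    IsFiniteMeasure (gaussianMeasure m S) := by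
  unfold gaussianMeasure
  split_ifs with h
  · have := h.choose_spec.isGaussian
    infer_instance
  · infer_instance

/-- The iso-Gaussian process (white noise) on `H`: a zero-mean Gaussian process
`(Z h : h ∈ H)` with covariance function `⟪h, h'⟫`. -/
structure IsIsoGaussian {Ω : Type*} [MeasurableSpace Ω] (Z : H → Ω → ℝ) (P : Measure Ω) :
    Prop where
  measurable : ∀ h, Measurable (Z h)
  gaussian : IsGaussianProcess Z P
  mean : ∀ h, ∫ ω, Z h ω ∂P = 0
  cov : ∀ h h', cov[Z h, Z h'; P] = ⟪h, h'⟫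

end GaussianLaws

/-! ### Sobolev spaces -/

section Sobolev

variable {H : Type*} [NormedAddCommGroup H] [InnerProductSpace ℝ H]

/-- The Sobolev norm `‖μ‖_β = (∑_{i ≥ 1} μ_i² i^{2β})^{1/2} ∈ [0, ∞]` relative to the basis `e`.
The natural number `i` stands for the index `i + 1 ∈ {1, 2, …}`. The Sobolev space `S^β` consists
of the `μ` whose norm is finite. -/
def sobolevNorm (e : HilbertBasis ℕ ℝ H) (β : ℝ) (μ : H) : ℝ≥0∞ :=
  (∑' i : ℕ, ENNReal.ofReal (⟪e i, μ⟫ ^ 2 * ((i : ℝ) + 1) ^ (2 * β))) ^ (1 / 2 : ℝ)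

end Sobolev

/-! ### The model `Y = K μ + n^{-1/2} Z`, the prior and the posterior -/

section Model

variable {H₁ H₂ Ω : Type*} [NormedAddCommGroup H₁] [InnerProductSpace ℝ H₁] [CompleteSpace H₁]
  [MeasurableSpace H₁]
  [NormedAddCommGroup H₂] [InnerProductSpace ℝ H₂] [CompleteSpace H₂] [MeasurableSpace Ω]

/-- The observation `Y = K μ + n^{-1/2} Z`, as the process `Y_h = ⟪K μ, h⟫ + n^{-1/2} Z_h`,
`h ∈ H₂`. -/
def observation (K : H₁ →L[ℝ] H₂) (Z : H₂ → Ω → ℝ) (n : ℕ) (μ : H₁) (ω : Ω) : H₂ → ℝ :=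
  fun h => ⟪K μ, h⟫ + (√(n : ℝ))⁻¹ * Z h ω

/-- The statistical model as a Markov kernel: `μ` is mapped to the law of
`Y = K μ + n^{-1/2} Z`. -/
def likelihood (K : H₁ →L[ℝ] H₂) (Z : H₂ → Ω → ℝ) (P : Measure Ω) (n : ℕ) :
    Kernel H₁ (H₂ → ℝ) :=
  (Kernel.id ×ₖ Kernel.const H₁ P).map fun q => observation K Z n q.1 q.2

instance likelihood_isFinite (K : H₁ →L[ℝ] H₂) (Z : H₂ → Ω → ℝ) (P : Measure Ω)
    [IsFiniteMeasure P] (n : ℕ) : IsFiniteKernel (likelihood K Z P n) := by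
  unfold likelihood; infer_instance

/-- The operator `n⁻¹ I + K Λ Kᵀ` on `H₂`. -/
def dataCov (K : H₁ →L[ℝ] H₂) (Λ : H₁ →L[ℝ] H₁) (n : ℕ) : H₂ →L[ℝ] H₂ :=
  (n : ℝ)⁻¹ • (1 : H₂ →L[ℝ] H₂) + K ∘L Λ ∘L K.adjoint

/-- The operator `A = Λ Kᵀ (n⁻¹ I + K Λ Kᵀ)⁻¹`. The inverse is that of the ring of continuous
linear operators on `H₂`. -/
def postMap (K : H₁ →L[ℝ] H₂) (Λ : H₁ →L[ℝ] H₁) (n : ℕ) : H₂ →L[ℝ] H₁ :=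
  Λ ∘L K.adjoint ∘L Ring.inverse (dataCov K Λ n)

/-- The posterior covariance operator `S_n = Λ - A (n⁻¹ I + K Λ Kᵀ) Aᵀ`. -/
def postCov (K : H₁ →L[ℝ] H₂) (Λ : H₁ →L[ℝ] H₁) (n : ℕ) : H₁ →L[ℝ] H₁ :=
  Λ - postMap K Λ n ∘L dataCov K Λ n ∘L (postMap K Λ n).adjoint

/-- The posterior mean `A y ∈ H₁`. For a process `y = (y_h : h ∈ H₂)` the transformed process is
`(A y)_h = y_{Aᵀ h}`, `h ∈ H₁`, and the element of `H₁` that realizes it is `∑ᵢ (A y)_{eᵢ} eᵢ`. -/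
def postMean (e : HilbertBasis ℕ ℝ H₁) (K : H₁ →L[ℝ] H₂) (Λ : H₁ →L[ℝ] H₁) (n : ℕ)
    (y : H₂ → ℝ) : H₁ :=
  ∑' i : ℕ, y ((postMap K Λ n).adjoint (e i)) • e i

/-- The posterior distribution `Π_n(· | Y = y) = N(A y, S_n)`. -/
def postLaw (e : HilbertBasis ℕ ℝ H₁) (K : H₁ →L[ℝ] H₂) (Λ : H₁ →L[ℝ] H₁) (n : ℕ)
    (y : H₂ → ℝ) : Measure H₁ :=
  gaussianMeasure (postMean e K Λ n y) (postCov K Λ n)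

/-! ### Credible balls and their coverage -/

/-- The radius `r_{n,γ}` of the credible ball given the data `y`: the `(1 - γ)`-quantile of the
distance to the posterior mean under the posterior distribution, so that
`Π_n(A y + B(r_{n,γ}) | y) = 1 - γ`. -/
def credibleRadius (e : HilbertBasis ℕ ℝ H₁) (K : H₁ →L[ℝ] H₂) (Λ : H₁ →L[ℝ] H₁) (γ : ℝ) (n : ℕ)
    (y : H₂ → ℝ) : ℝ :=
  sInf {r : ℝ | 0 ≤ r ∧ 1 - γ ≤ (postLaw e K Λ n y).real (Metric.ball (postMean e K Λ n y) r)}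

/-- The credible ball `A y + B(r_{n,γ})` (an open ball). -/
def credibleBall (e : HilbertBasis ℕ ℝ H₁) (K : H₁ →L[ℝ] H₂) (Λ : H₁ →L[ℝ] H₁) (γ : ℝ) (n : ℕ)
    (y : H₂ → ℝ) : Set H₁ :=
  Metric.ball (postMean e K Λ n y) (credibleRadius e K Λ γ n y)

/-- The frequentist coverage of the credible ball, `Pr_{μ₀}(μ₀ ∈ A Y + B(r_{n,γ}))`, where
`Y = K μ₀ + n^{-1/2} Z`. -/
def coverage (e : HilbertBasis ℕ ℝ H₁) (K : H₁ →L[ℝ] H₂) (Z : H₂ → Ω → ℝ) (P : Measure Ω)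
    (Λ : H₁ →L[ℝ] H₁) (γ : ℝ) (n : ℕ) (μ₀ : H₁) : ℝ :=
  P.real {ω | μ₀ ∈ credibleBall e K Λ γ n (observation K Z n μ₀ ω)}

/-- The radius `r̃_{n,γ}` of the frequentist confidence ball centered at the posterior mean: the
`(1 - γ)`-quantile of `‖μ₀ - A Y‖` under `μ₀`, so that `Pr_{μ₀}(μ₀ ∈ A Y + B(r̃_{n,γ})) = 1 - γ`. -/
def confidenceRadius (e : HilbertBasis ℕ ℝ H₁) (K : H₁ →L[ℝ] H₂) (Z : H₂ → Ω → ℝ) (P : Measure Ω)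
    (Λ : H₁ →L[ℝ] H₁) (γ : ℝ) (n : ℕ) (μ₀ : H₁) : ℝ :=
  sInf {r : ℝ | 0 ≤ r ∧
    1 - γ ≤ P.real {ω | μ₀ ∈ Metric.ball (postMean e K Λ n (observation K Z n μ₀ ω)) r}}

end Model

end GaussianInverseProblem

/-!
In the singular value decomposition of `K` the problem is diagonal. The prior, the posterior and the
noise decouple into the coordinates along `eᵢ`, and with `qᵢ = n λᵢ κᵢ²` the posterior variance is
`postVar i = λᵢ / (1 + qᵢ)`, the sampling variance of the posterior mean is
`meanVar i = λᵢ qᵢ / (1 + qᵢ)²`, and the bias of the posterior mean is `μ₀ᵢ / (1 + qᵢ)`.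

That `N(AY, S_n)` is the posterior (`postLaw_ae_eq_posterior`) follows because under the joint law
the residual `μ - AY` is independent of the observed process and has law `N(0, S_n)`: the two are
jointly Gaussian and uncorrelated. White noise enters through the isometry of `H₂` into `L²`
(`IsIsoGaussian.toL2`), which makes the random series `∑ᵢ Y_{Aᵀ eᵢ} eᵢ` converge almost surely and
identifies its linear functionals.

The squared distance to the posterior mean is, under the posterior, a weighted sum of squares of
independent standard normal variables with weights `postVar`; the squared norm of the noise part of
the posterior mean is one with weights `meanVar`. By Chebyshev's inequality
(`IsIsoGaussian.measure_abs_tsum_sub_le`) such a sum concentrates at its mean as soon as the largest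
weight is negligible relative to the sum of the weights. For polynomial eigenvalues, with
`N^{1+2α+2p} = n τ²` the index at which `qᵢ ≍ 1`, the largest weight is `O(V / N)`, where
`V = τ² N^{-2α}`, while the two sums `T` of `postVar` and `U` of `meanVar` and their difference
`T - U` are all of the order `V` (`IsPolynomialModel.exists_variance_bounds`). The squared radius of
the credible ball is therefore close to `T`, the squared noise is close to `U`, and the gap between
the two decides the coverage: it tends to `1` if the squared bias is at most a small multiple of `V`
(`exists_one_sub_le_coverage`), and to `0` if the squared bias is at least a large multiple of `V`
(`exists_coverage_le`).

The worst squared bias over a Sobolev ball of smoothness `β` is of the order `N^{-2β'}`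
(`norm_sq_postBias_le`, `exists_le_norm_sq_postBias`), and its comparison with `V` is the comparison
of `τ` with the critical rate, by the identity `V N^{2β'} = (τ / a)^{2(1+2β'+2p)/(1+2α+2p)}`
(`spread_mul_eq`). For a fixed truth of smoothness `β < 1 + 2α + 2p` the squared bias is of smaller
order than `N^{-2β}` by dominated convergence. Intermediate limits of the coverage are obtained from
the continuity of the coverage along a line of truths (`continuous_coverage_smul`) and the
intermediate value theorem.
-/

/-! ### White noise as a linear isometry into `L²` -/

section WhiteNoise

variable {H Ω : Type*} [NormedAddCommGroup H] [InnerProductSpace ℝ H] [MeasurableSpace Ω]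
  {P : Measure Ω} {Z : H → Ω → ℝ}

theorem IsIsoGaussian.memLp (hZ : IsIsoGaussian Z P) (h : H) : MemLp (Z h) 2 P :=
  (hZ.gaussian.hasGaussianLaw_eval h).memLp_two

theorem IsIsoGaussian.integral_mul [IsProbabilityMeasure P] (hZ : IsIsoGaussian Z P) (h h' : H) :
    ∫ ω, Z h ω * Z h' ω ∂P = ⟪h, h'⟫ := by
  have := covariance_eq_sub (hZ.memLp h) (hZ.memLp h')
  rw [hZ.cov, hZ.mean, hZ.mean] at this
  simpa using this.symm

theorem IsIsoGaussian.hasLaw [IsProbabilityMeasure P] (hZ : IsIsoGaussian Z P) (h : H) :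
    HasLaw (Z h) (gaussianReal 0 (‖h‖ ^ 2).toNNReal) P where
  aemeasurable := (hZ.measurable h).aemeasurable
  map_eq := by
    rw [(hZ.gaussian.hasGaussianLaw_eval h).map_eq_gaussianReal, hZ.mean,
      ← covariance_self (hZ.measurable h).aemeasurable, hZ.cov, real_inner_self_eq_norm_sq]

/-- A map between inner product spaces that preserves inner products is a linear isometry. -/
noncomputable def LinearIsometry.ofInner {E F : Type*} [NormedAddCommGroup E]
    [InnerProductSpace ℝ E] [NormedAddCommGroup F] [InnerProductSpace ℝ F] (f : E → F)
    (hf : ∀ x y, ⟪f x, f y⟫ = ⟪x, y⟫) : E →ₗᵢ[ℝ] F where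
  toFun := f
  map_add' x y := by
    rw [← sub_eq_zero, ← inner_self_eq_zero (𝕜 := ℝ)]
    simp only [inner_sub_left, inner_sub_right, inner_add_left, inner_add_right, hf]
    ring
  map_smul' c x := by
    rw [← sub_eq_zero, ← inner_self_eq_zero (𝕜 := ℝ)]
    simp only [inner_sub_left, inner_sub_right, real_inner_smul_left, real_inner_smul_right, hf,
      RingHom.id_apply]
    ring
  norm_map' x := by
    change ‖f x‖ = ‖x‖
    rw [norm_eq_sqrt_real_inner, hf, ← norm_eq_sqrt_real_inner]

/-- White noise as a linear isometry `H → L²(P)`. In particular `Z_h` is almost surely linear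
in `h`. -/
noncomputable def IsIsoGaussian.toL2 [IsProbabilityMeasure P] (hZ : IsIsoGaussian Z P) :
    H →ₗᵢ[ℝ] Lp ℝ 2 P :=
  LinearIsometry.ofInner (fun h => (hZ.memLp h).toLp) fun h h' => by
    rw [L2.inner_def, ← hZ.integral_mul h h']
    refine integral_congr_ae ?_
    filter_upwards [(hZ.memLp h).coeFn_toLp, (hZ.memLp h').coeFn_toLp] with ω h1 h2
    rw [h1, h2]
    simp [mul_comm]

theorem IsIsoGaussian.toL2_coeFn [IsProbabilityMeasure P] (hZ : IsIsoGaussian Z P) (h : H) :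
    hZ.toL2 h =ᵐ[P] Z h := (hZ.memLp h).coeFn_toLp

theorem IsIsoGaussian.ae_smul [IsProbabilityMeasure P] (hZ : IsIsoGaussian Z P) (c : ℝ) (h : H) :
    Z (c • h) =ᵐ[P] fun ω => c * Z h ω := by
  have := Lp.coeFn_smul c (hZ.toL2 h)
  rw [← map_smul] at this
  filter_upwards [this, hZ.toL2_coeFn h, hZ.toL2_coeFn (c • h)] with ω h1 h2 h4
  rw [← h4, h1, Pi.smul_apply, h2, smul_eq_mul]

/-- If `h = ∑ᵢ cᵢ gᵢ` and `∑ᵢ cᵢ Z_{gᵢ}` converges almost surely, then the sum is `Z_h`. -/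
theorem IsIsoGaussian.ae_eq_of_hasSum [IsProbabilityMeasure P] (hZ : IsIsoGaussian Z P)
    {c : ℕ → ℝ} {g : ℕ → H} {h : H} (hh : HasSum (fun i => c i • g i) h) {X : Ω → ℝ}
    (hX : ∀ᵐ ω ∂P, HasSum (fun i => c i * Z (g i) ω) (X ω)) : X =ᵐ[P] Z h := by
  have h1 : Tendsto (fun k => hZ.toL2 (∑ i ∈ Finset.range k, c i • g i)) atTop
      (𝓝 (hZ.toL2 h)) :=
    (hZ.toL2.continuous.tendsto h).comp hh.tendsto_sum_nat
  obtain ⟨ns, hns, hlim⟩ :=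
    (tendstoInMeasure_of_tendsto_Lp h1).exists_seq_tendsto_ae
  have h2 : ∀ᵐ ω ∂P, ∀ k : ℕ, hZ.toL2 (∑ i ∈ Finset.range k, c i • g i) ω =
      ∑ i ∈ Finset.range k, c i * Z (g i) ω := by
    rw [ae_all_iff]
    intro k
    induction k with
    | zero =>
      simp only [Finset.range_zero, Finset.sum_empty, map_zero]
      exact Lp.coeFn_zero ℝ 2 P
    | succ k ih =>
      have h3 := Lp.coeFn_add (hZ.toL2 (∑ i ∈ Finset.range k, c i • g i)) (hZ.toL2 (c k • g k))
      rw [← map_add] at h3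
      filter_upwards [ih, h3, hZ.toL2_coeFn (c k • g k), hZ.ae_smul (c k) (g k)]
        with ω h4 h5 h6 h7
      rw [Finset.sum_range_succ, Finset.sum_range_succ, h5, Pi.add_apply, h4, h6, h7]
  filter_upwards [hX, hlim, h2, hZ.toL2_coeFn h] with ω h3 h4 h5 h6
  simp only [h5] at h4
  rw [← h6]
  exact tendsto_nhds_unique (h3.tendsto_sum_nat.comp hns.tendsto_atTop) h4

theorem IsIsoGaussian.iIndepFun [IsProbabilityMeasure P] (hZ : IsIsoGaussian Z P) {f : ℕ → H}
    (hf : Orthonormal ℝ f) : ProbabilityTheory.iIndepFun (fun i => Z (f i)) P := by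
  have h := IsGaussianProcess.iIndepFun_of_covariance_eq_zero (T := ℕ) (S := fun _ => Unit)
    (X := fun i _ => Z (f i)) (P := P) (hZ.gaussian.comp_right fun p : (_ : ℕ) × Unit => f p.1)
    (fun i _ => (hZ.measurable _).aemeasurable) fun i j hij _ _ => by rw [hZ.cov]; exact hf.2 hij
  exact h.comp (fun _ (x : Unit → ℝ) => x ()) fun _ => measurable_pi_apply ()

end WhiteNoise

/-! ### Random series along a Hilbert basis -/

section Series

variable {H₁ : Type*} [NormedAddCommGroup H₁] [InnerProductSpace ℝ H₁]

theorem HilbertBasis.hasSum_sq (e : HilbertBasis ℕ ℝ H₁) (x : H₁) :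
    HasSum (fun i => ⟪e i, x⟫ ^ 2) (‖x‖ ^ 2) := by
  have := e.hasSum_inner_mul_inner x x
  rw [real_inner_self_eq_norm_sq] at this
  refine this.congr_fun fun i => ?_
  rw [real_inner_comm x, sq]

theorem HilbertBasis.hasSum_inner_smul (e : HilbertBasis ℕ ℝ H₁) (x : H₁) :
    HasSum (fun i => ⟪e i, x⟫ • e i) x := by
  simpa only [e.repr_apply_apply] using e.hasSum_repr x

theorem HilbertBasis.inner_eq_of_hasSum (e : HilbertBasis ℕ ℝ H₁) {c : ℕ → ℝ} {x : H₁}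
    (h : HasSum (fun i => c i • e i) x) (j : ℕ) : ⟪e j, x⟫ = c j := by
  have h1 := h.mapL (innerSL ℝ (e j))
  refine h1.unique ((hasSum_ite_eq j (c j)).congr_fun fun i => ?_)
  rw [innerSL_apply_apply, real_inner_smul_right, orthonormal_iff_ite.1 e.orthonormal j i]
  by_cases hij : i = j
  · subst hij; simp
  · rw [if_neg hij, if_neg (Ne.symm hij), mul_zero]

theorem HilbertBasis.summable_smul_iff (e : HilbertBasis ℕ ℝ H₁) {c : ℕ → ℝ} :
    Summable (fun i => c i • e i) ↔ Summable (fun i => c i ^ 2) := by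
  constructor
  · rintro ⟨x, hx⟩
    simpa only [e.inner_eq_of_hasSum hx] using (e.hasSum_sq x).summable
  · intro h
    have hc : Memℓp c 2 := by
      refine memℓp_gen ?_
      simpa using h
    exact (e.hasSum_repr_symm ⟨c, hc⟩).summable

theorem HilbertBasis.inner_tsum_smul (e : HilbertBasis ℕ ℝ H₁) {c : ℕ → ℝ}
    (h : Summable fun i => c i ^ 2) (j : ℕ) : ⟪e j, ∑' i, c i • e i⟫ = c j :=
  e.inner_eq_of_hasSum (e.summable_smul_iff.2 h).hasSum j

theorem HilbertBasis.norm_sq_tsum_smul (e : HilbertBasis ℕ ℝ H₁) {c : ℕ → ℝ}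
    (h : Summable fun i => c i ^ 2) : ‖∑' i, c i • e i‖ ^ 2 = ∑' i, c i ^ 2 := by
  rw [← (e.hasSum_sq _).tsum_eq]
  simp only [e.inner_tsum_smul h]

theorem HilbertBasis.ext_inner (e : HilbertBasis ℕ ℝ H₁) {x y : H₁}
    (h : ∀ i, ⟪e i, x⟫ = ⟪e i, y⟫) : x = y := by
  refine (e.hasSum_inner_smul x).unique ?_
  simpa only [h] using e.hasSum_inner_smul y

variable [MeasurableSpace H₁] [BorelSpace H₁] [SecondCountableTopology H₁]

/-- The synthesis map `c ↦ ∑ᵢ cᵢ eᵢ` is measurable on all of `ℝ^ℕ`, although it takes the junk value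
`0` outside of `ℓ²`. -/
theorem HilbertBasis.measurable_tsum_smul (e : HilbertBasis ℕ ℝ H₁) :
    Measurable fun c : ℕ → ℝ => ∑' i, c i • e i := by
  have hS : MeasurableSet {c : ℕ → ℝ | Summable fun i => c i ^ 2} := by
    have : {c : ℕ → ℝ | Summable fun i => c i ^ 2} =
        {c | ∑' i, ENNReal.ofReal (c i ^ 2) < ∞} := by
      ext c
      simp only [Set.mem_ofPred_eq, lt_top_iff_ne_top]
      refine ⟨fun h => h.tsum_ofReal_ne_top, fun h => ?_⟩
      have := ENNReal.summable_toReal h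
      simpa only [ENNReal.toReal_ofReal (sq_nonneg _)] using this
    rw [this]
    refine measurableSet_lt (Measurable.tsum fun i => ?_) measurable_const
    fun_prop
  refine measurable_of_tendsto_metrizable
    (f := fun k c => {c : ℕ → ℝ | Summable fun i => c i ^ 2}.indicator
      (fun c => ∑ i ∈ Finset.range k, c i • e i) c) (fun k => ?_) ?_
  · refine Measurable.indicator ?_ hS
    exact Finset.measurable_fun_sum _ fun i _ => (measurable_pi_apply i).smul_const _
  · rw [tendsto_pi_nhds]
    intro c
    by_cases hc : Summable fun i => c i ^ 2
    · simp only [Set.indicator, Set.mem_ofPred_eq, hc, if_true]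
      exact (e.summable_smul_iff.2 hc).hasSum.tendsto_sum_nat
    · rw [tsum_eq_zero_of_not_summable (fun h => hc (e.summable_smul_iff.1 h))]
      simp [Set.indicator, hc]

variable {H₂ Ω : Type*} [NormedAddCommGroup H₂] [InnerProductSpace ℝ H₂] [CompleteSpace H₂]
  [MeasurableSpace Ω] {P : Measure Ω} [IsProbabilityMeasure P] {Z : H₂ → Ω → ℝ}

omit [CompleteSpace H₂] in
theorem IsIsoGaussian.ae_summable_sq (hZ : IsIsoGaussian Z P) {g : ℕ → H₂}
    (hg : Summable fun i => ‖g i‖ ^ 2) : ∀ᵐ ω ∂P, Summable fun i => Z (g i) ω ^ 2 := by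
  have h1 : ∫⁻ ω, ∑' i, ENNReal.ofReal (Z (g i) ω ^ 2) ∂P ≠ ∞ := by
    rw [lintegral_tsum fun i => ((hZ.measurable (g i)).pow_const 2).ennreal_ofReal.aemeasurable]
    have h2 : ∀ i, ∫⁻ ω, ENNReal.ofReal (Z (g i) ω ^ 2) ∂P = ENNReal.ofReal (‖g i‖ ^ 2) := by
      intro i
      rw [← ofReal_integral_eq_lintegral_ofReal (hZ.memLp (g i)).integrable_sq
        (ae_of_all _ fun ω => sq_nonneg _), ← real_inner_self_eq_norm_sq, ← hZ.integral_mul]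
      simp only [sq]
    simp only [h2]
    exact hg.tsum_ofReal_ne_top
  filter_upwards [ae_lt_top' (AEMeasurable.tsum fun i =>
    ((hZ.measurable (g i)).pow_const 2).ennreal_ofReal.aemeasurable) h1] with ω hω
  have := ENNReal.summable_toReal hω.ne
  simpa only [ENNReal.toReal_ofReal (sq_nonneg _)] using this

omit [MeasurableSpace H₁] [BorelSpace H₁] [SecondCountableTopology H₁] in
theorem HilbertBasis.summable_inner_smul (e : HilbertBasis ℕ ℝ H₁) {g : ℕ → H₂}
    (hg : Summable fun i => ‖g i‖ ^ 2) (h : H₁) : Summable fun i => ⟪e i, h⟫ • g i := by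
  refine Summable.of_norm_bounded (g := fun i => ⟪e i, h⟫ ^ 2 + ‖g i‖ ^ 2)
    ((e.hasSum_sq h).summable.add hg) fun i => ?_
  rw [norm_smul, Real.norm_eq_abs]
  nlinarith [sq_nonneg (|⟪e i, h⟫| - ‖g i‖), sq_abs ⟪e i, h⟫, abs_nonneg ⟪e i, h⟫,
    norm_nonneg (g i)]

omit [MeasurableSpace H₁] [BorelSpace H₁] [SecondCountableTopology H₁] in
/-- The linear functionals of the random series `∑ᵢ Z_{gᵢ} eᵢ` are again values of the white
noise. -/
theorem IsIsoGaussian.inner_tsum_smul_ae_eq (hZ : IsIsoGaussian Z P) (e : HilbertBasis ℕ ℝ H₁)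
    {g : ℕ → H₂} (hg : Summable fun i => ‖g i‖ ^ 2) (h : H₁) :
    (fun ω => ⟪∑' i, Z (g i) ω • e i, h⟫) =ᵐ[P] Z (∑' i, ⟪e i, h⟫ • g i) := by
  refine hZ.ae_eq_of_hasSum (c := fun i => ⟪e i, h⟫) (e.summable_inner_smul hg h).hasSum ?_
  filter_upwards [hZ.ae_summable_sq hg] with ω hω
  have := ((e.summable_smul_iff.2 hω).hasSum).mapL (innerSL ℝ h)
  simp only [innerSL_apply_apply, real_inner_smul_right] at this
  rw [real_inner_comm]
  refine this.congr_fun fun i => ?_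
  rw [real_inner_comm h, mul_comm]

end Series

/-! ### Gaussian laws with a given mean and covariance operator -/

section GaussianLaw

theorem covariance_congr_ae {Ω : Type*} [MeasurableSpace Ω] {P : Measure Ω} {X X' Y Y' : Ω → ℝ}
    (hX : X =ᵐ[P] X') (hY : Y =ᵐ[P] Y') : cov[X, Y; P] = cov[X', Y'; P] := by
  unfold covariance
  rw [integral_congr_ae hX, integral_congr_ae hY]
  refine integral_congr_ae ?_
  filter_upwards [hX, hY] with ω h1 h2
  rw [h1, h2]

variable {H₁ : Type*} [NormedAddCommGroup H₁] [InnerProductSpace ℝ H₁] [CompleteSpace H₁]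
  [SecondCountableTopology H₁] [MeasurableSpace H₁] [BorelSpace H₁]

theorem IsGaussianLaw.unique {ν ν' : Measure H₁} {m : H₁} {S : H₁ →L[ℝ] H₁}
    (h : IsGaussianLaw ν m S) (h' : IsGaussianLaw ν' m S) : ν = ν' := by
  have := h.isGaussian
  have := h'.isGaussian
  refine Measure.ext_of_charFun ?_
  ext t
  rw [IsGaussian.charFun_eq, IsGaussian.charFun_eq, integral_complex_ofReal,
    integral_complex_ofReal]
  simp only [real_inner_comm _ t]
  have h1 : ∀ ν : Measure H₁, Var[fun x => ⟪x, t⟫; ν] = cov[fun x => ⟪x, t⟫, fun x => ⟪x, t⟫; ν] :=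
    fun ν => (covariance_self (by fun_prop)).symm
  rw [h1, h1, h.cov, h'.cov, h.mean, h'.mean]

theorem IsGaussianLaw.gaussianMeasure_eq {ν : Measure H₁} {m : H₁} {S : H₁ →L[ℝ] H₁}
    (h : IsGaussianLaw ν m S) : gaussianMeasure m S = ν := by
  have hex : ∃ ν : Measure H₁, IsGaussianLaw ν m S := ⟨ν, h⟩
  unfold gaussianMeasure
  rw [dif_pos hex]
  exact hex.choose_spec.unique h

/-- A random element of `H₁` has a Gaussian law as soon as all its linear functionals do. -/
theorem IsGaussianLaw.of_forall_inner {Ω : Type*} [MeasurableSpace Ω] {P : Measure Ω}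
    {X : Ω → H₁} (hX : Measurable X) {m : H₁} {S : H₁ →L[ℝ] H₁}
    (hgauss : ∀ h, HasGaussianLaw (fun ω => ⟪X ω, h⟫) P)
    (hmean : ∀ h, ∫ ω, ⟪X ω, h⟫ ∂P = ⟪m, h⟫)
    (hcov : ∀ h h', cov[fun ω => ⟪X ω, h⟫, fun ω => ⟪X ω, h'⟫; P] = ⟪h, S h'⟫) :
    IsGaussianLaw (P.map X) m S where
  isGaussian := by
    refine isGaussian_of_isGaussian_map fun L => ?_
    rw [Measure.map_map (by fun_prop) hX]
    have : ⇑L ∘ X = fun ω => ⟪X ω, (InnerProductSpace.toDual ℝ H₁).symm L⟫ := by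
      ext ω
      rw [real_inner_comm, InnerProductSpace.toDual_symm_apply]; rfl
    rw [this]
    exact (hgauss _).isGaussian_map
  mean h := by
    rw [integral_map hX.aemeasurable (by fun_prop), hmean]
  cov h h' := by
    rw [covariance_map (by fun_prop) (by fun_prop) hX.aemeasurable, ← hcov]
    rfl

theorem IsGaussianLaw.const_add {ν : Measure H₁} {S : H₁ →L[ℝ] H₁} (h : IsGaussianLaw ν 0 S)
    (m : H₁) : IsGaussianLaw (ν.map fun x => m + x) m S := by
  have := h.isGaussian
  have hint : ∀ t : H₁, Integrable (fun x => ⟪x, t⟫) ν := fun t =>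
    IsGaussian.integrable_id.inner_const t
  refine ⟨inferInstance, fun t => ?_, fun t t' => ?_⟩
  · rw [integral_map (by fun_prop) (by fun_prop)]
    simp only [inner_add_left]
    rw [integral_add (integrable_const _) (hint t), h.mean]
    simp
  · rw [covariance_map (by fun_prop) (by fun_prop) (by fun_prop), ← h.cov]
    simp only [Function.comp_def, inner_add_left]
    rw [covariance_const_add_left (hint t), covariance_const_add_right (hint t')]

variable {H₂ Ω : Type*} [NormedAddCommGroup H₂] [InnerProductSpace ℝ H₂] [CompleteSpace H₂]
  [MeasurableSpace Ω] {P : Measure Ω} [IsProbabilityMeasure P] {Z : H₂ → Ω → ℝ}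

/-- The random series `∑ᵢ √sᵢ Z_{fᵢ} eᵢ` has the distribution `N(0, S)`, where `S eᵢ = sᵢ eᵢ`. -/
theorem IsIsoGaussian.isGaussianLaw_tsum (hZ : IsIsoGaussian Z P) (e : HilbertBasis ℕ ℝ H₁)
    {f : ℕ → H₂} (hf : Orthonormal ℝ f) {s : ℕ → ℝ} (hs : ∀ i, 0 ≤ s i) (hsum : Summable s)
    {S : H₁ →L[ℝ] H₁} (hS : ∀ i, S (e i) = s i • e i) :
    IsGaussianLaw (P.map fun ω => ∑' i, Z (√(s i) • f i) ω • e i) 0 S := by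
  have hg : Summable fun i => ‖√(s i) • f i‖ ^ 2 := by
    refine hsum.congr fun i => ?_
    rw [norm_smul, hf.1 i, mul_one, Real.norm_eq_abs, sq_abs, Real.sq_sqrt (hs i)]
  have hX : Measurable fun ω => ∑' i, Z (√(s i) • f i) ω • e i :=
    e.measurable_tsum_smul.comp (measurable_pi_lambda _ fun i => hZ.measurable _)
  have hae := hZ.inner_tsum_smul_ae_eq e hg
  refine IsGaussianLaw.of_forall_inner hX (fun h => ?_) (fun h => ?_) (fun h h' => ?_)
  · exact (hZ.gaussian.hasGaussianLaw_eval _).congr (hae h).symm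
  · rw [integral_congr_ae (hae h), hZ.mean, inner_zero_left]
  · rw [covariance_congr_ae (hae h) (hae h'), hZ.cov]
    have h1 := ((e.summable_inner_smul hg h).hasSum).mapL
      (innerSL ℝ (∑' i, ⟪e i, h'⟫ • √(s i) • f i))
    rw [innerSL_apply_apply, real_inner_comm] at h1
    refine h1.unique ?_
    have h2 := ((e.hasSum_inner_smul h').mapL S).mapL (innerSL ℝ h)
    rw [innerSL_apply_apply] at h2
    refine h2.congr_fun fun i => ?_
    rw [innerSL_apply_apply, innerSL_apply_apply, map_smul, hS, real_inner_comm]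
    have h3 := ((e.summable_inner_smul hg h').hasSum).mapL
      (innerSL ℝ (⟪e i, h⟫ • √(s i) • f i))
    rw [innerSL_apply_apply] at h3
    refine h3.unique ?_
    have h4 : ⟪h, ⟪e i, h'⟫ • s i • e i⟫ = ⟪e i, h'⟫ * (s i * ⟪e i, h⟫) := by
        rw [real_inner_smul_right, real_inner_smul_right, real_inner_comm (e i) h]
    rw [h4]
    refine (hasSum_ite_eq i _).congr_fun fun j => ?_
    simp only [innerSL_apply_apply, real_inner_smul_right, real_inner_smul_left,
      orthonormal_iff_ite.1 hf]
    by_cases hij : j = i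
    · subst hij
      rw [if_pos rfl, if_pos rfl]
      linear_combination (⟪e j, h'⟫ * ⟪e j, h⟫) * Real.mul_self_sqrt (hs j)
    · rw [if_neg hij, if_neg (Ne.symm hij)]
      ring

end GaussianLaw

/-! ### The posterior operators in the singular value decomposition -/

section Operators

variable {H₁ H₂ : Type*} [NormedAddCommGroup H₁] [InnerProductSpace ℝ H₁] [CompleteSpace H₁]
  [NormedAddCommGroup H₂] [InnerProductSpace ℝ H₂] [CompleteSpace H₂]
  {e : HilbertBasis ℕ ℝ H₁} {K : H₁ →L[ℝ] H₂} {κ : ℕ → ℝ} {Λ : H₁ →L[ℝ] H₁} {l : ℕ → ℝ} {n : ℕ}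

omit [CompleteSpace H₁] in
theorem HilbertBasis.inner_diagonal_apply (hΛ : ∀ i, Λ (e i) = l i • e i) (x : H₁) (i : ℕ) :
    ⟪e i, Λ x⟫ = l i * ⟪e i, x⟫ := by
  refine e.inner_eq_of_hasSum (c := fun i => l i * ⟪e i, x⟫) ?_ i
  refine ((e.hasSum_inner_smul x).mapL Λ).congr_fun fun j => ?_
  rw [map_smul, hΛ, smul_smul, mul_comm]

omit [CompleteSpace H₁] in
theorem HilbertBasis.inner_diagonal_comm (hΛ : ∀ i, Λ (e i) = l i • e i) (x y : H₁) :
    ⟪Λ x, y⟫ = ⟪x, Λ y⟫ := by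
  refine (e.hasSum_inner_mul_inner (Λ x) y).unique ?_
  refine (e.hasSum_inner_mul_inner x (Λ y)).congr_fun fun i => ?_
  rw [real_inner_comm, HilbertBasis.inner_diagonal_apply hΛ,
    HilbertBasis.inner_diagonal_apply hΛ, real_inner_comm]
  ring

omit [CompleteSpace H₁] in
theorem HilbertBasis.inner_diagonal_nonneg (hΛ : ∀ i, Λ (e i) = l i • e i) (hl : ∀ i, 0 ≤ l i)
    (x : H₁) : 0 ≤ ⟪x, Λ x⟫ := by
  refine (e.hasSum_inner_mul_inner x (Λ x)).nonneg fun i => ?_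
  rw [HilbertBasis.inner_diagonal_apply hΛ, real_inner_comm]
  nlinarith [mul_nonneg (hl i) (sq_nonneg ⟪e i, x⟫)]

theorem dataCov_apply (x : H₂) :
    dataCov K Λ n x = (n : ℝ)⁻¹ • x + K (Λ (K.adjoint x)) := rfl

theorem adjoint_dataCov (hΛ : ∀ i, Λ (e i) = l i • e i) :
    (dataCov K Λ n).adjoint = dataCov K Λ n := by
  refine (ContinuousLinearMap.eq_adjoint_iff _ _).2 (fun x y => ?_) |>.symm
  rw [dataCov_apply, dataCov_apply, inner_add_left, inner_add_right, real_inner_smul_left,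
    real_inner_smul_right, ← ContinuousLinearMap.adjoint_inner_right,
    HilbertBasis.inner_diagonal_comm hΛ, ContinuousLinearMap.adjoint_inner_left]

theorem isUnit_dataCov (hΛ : ∀ i, Λ (e i) = l i • e i) (hl : ∀ i, 0 ≤ l i) (hn : 0 < n) :
    IsUnit (dataCov K Λ n) := by
  have hn' : (0 : ℝ) < (n : ℝ)⁻¹ := by positivity
  have hself : ∀ x y, ⟪dataCov K Λ n x, y⟫ = ⟪x, dataCov K Λ n y⟫ := fun x y => by
    rw [← ContinuousLinearMap.adjoint_inner_right, adjoint_dataCov hΛ]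
  -- the bilinear form of `dataCov` is coercive, so that the Lax–Milgram theorem applies
  have hco : IsCoercive ((innerSL ℝ).comp (dataCov K Λ n)) := by
    refine ⟨(n : ℝ)⁻¹, hn', fun u => ?_⟩
    rw [ContinuousLinearMap.comp_apply, innerSL_apply_apply, hself, dataCov_apply,
      inner_add_right, real_inner_smul_right, real_inner_self_eq_norm_mul_norm,
      ← ContinuousLinearMap.adjoint_inner_left]
    have := HilbertBasis.inner_diagonal_nonneg hΛ hl (K.adjoint u)
    linarith
  have heq : dataCov K Λ n = (hco.continuousLinearEquivOfBilin : H₂ →L[ℝ] H₂) := by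
    ext v
    refine ext_inner_right ℝ fun w => ?_
    rw [ContinuousLinearEquiv.coe_coe, hco.continuousLinearEquivOfBilin_apply]
    rfl
  rw [heq]
  exact ⟨ContinuousLinearEquiv.toUnit hco.continuousLinearEquivOfBilin, rfl⟩

theorem postMap_comp_dataCov (h : IsUnit (dataCov K Λ n)) (x : H₂) :
    postMap K Λ n (dataCov K Λ n x) = Λ (K.adjoint x) := by
  have := congrArg (fun T : H₂ →L[ℝ] H₂ => T x) (Ring.inverse_mul_cancel _ h)
  simp only [mul_apply_eq_comp, one_apply_eq_self] at this
  simp only [postMap, ContinuousLinearMap.comp_apply, this]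

theorem dataCov_adjoint_postMap (hΛ : ∀ i, Λ (e i) = l i • e i) (h : IsUnit (dataCov K Λ n))
    (x : H₁) : dataCov K Λ n ((postMap K Λ n).adjoint x) = K (Λ x) := by
  refine ext_inner_right ℝ fun w => ?_
  rw [← ContinuousLinearMap.adjoint_inner_right, adjoint_dataCov hΛ,
    ContinuousLinearMap.adjoint_inner_left, postMap_comp_dataCov h,
    ← HilbertBasis.inner_diagonal_comm hΛ, ContinuousLinearMap.adjoint_inner_right]

/-- The left singular vectors `fᵢ = κᵢ⁻¹ K eᵢ` of `K`. -/
noncomputable def leftSingular (e : HilbertBasis ℕ ℝ H₁) (K : H₁ →L[ℝ] H₂) (κ : ℕ → ℝ) (i : ℕ) :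
    H₂ := (κ i)⁻¹ • K (e i)

omit [CompleteSpace H₁] [CompleteSpace H₂] in
theorem map_eq_smul_leftSingular (hκ : ∀ i, 0 < κ i) (i : ℕ) :
    K (e i) = κ i • leftSingular e K κ i := by
  rw [leftSingular, smul_smul, mul_inv_cancel₀ (hκ i).ne', one_smul]

theorem adjoint_leftSingular (hK : ∀ i, K.adjoint (K (e i)) = (κ i ^ 2) • e i)
    (hκ : ∀ i, 0 < κ i) (i : ℕ) : K.adjoint (leftSingular e K κ i) = κ i • e i := by
  rw [leftSingular, map_smul, hK, smul_smul]
  congr 1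
  have := (hκ i).ne'
  field_simp

theorem orthonormal_leftSingular (hK : ∀ i, K.adjoint (K (e i)) = (κ i ^ 2) • e i)
    (hκ : ∀ i, 0 < κ i) : Orthonormal ℝ (leftSingular e K κ) := by
  rw [orthonormal_iff_ite]
  intro i j
  conv_lhs => rw [leftSingular]
  rw [real_inner_smul_left, ← ContinuousLinearMap.adjoint_inner_right,
    adjoint_leftSingular hK hκ, real_inner_smul_right, orthonormal_iff_ite.1 e.orthonormal i j]
  by_cases hij : i = j
  · subst hij
    rw [if_pos rfl, mul_one, inv_mul_cancel₀ (hκ i).ne']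
  · rw [if_neg hij, mul_zero, mul_zero]

theorem adjoint_postMap_apply (hK : ∀ i, K.adjoint (K (e i)) = (κ i ^ 2) • e i)
    (hκ : ∀ i, 0 < κ i) (hΛ : ∀ i, Λ (e i) = l i • e i) (hl : ∀ i, 0 ≤ l i) (hn : 0 < n)
    (i : ℕ) : (postMap K Λ n).adjoint (e i) =
      (n * l i * κ i / (1 + n * l i * κ i ^ 2)) • leftSingular e K κ i := by
  have hu := isUnit_dataCov (K := K) hΛ hl hn
  have hn' : (n : ℝ) ≠ 0 := by positivity
  have hpos : (0 : ℝ) < 1 + n * l i * κ i ^ 2 := by have := hl i; positivity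
  have h1 := dataCov_adjoint_postMap hΛ hu (e i)
  have h2 : dataCov K Λ n ((n * l i * κ i / (1 + n * l i * κ i ^ 2)) • leftSingular e K κ i) =
      K (Λ (e i)) := by
    rw [map_smul, dataCov_apply, adjoint_leftSingular hK hκ, map_smul, map_smul, hΛ, map_smul,
      map_eq_smul_leftSingular hκ, smul_smul, smul_smul, ← add_smul, smul_smul, smul_smul]
    congr 1
    field_simp
  have hinj : Function.Injective (dataCov K Λ n) := by
    intro x y hxy
    have := Ring.inverse_mul_cancel _ hu
    have h3 := congrArg (fun T : H₂ →L[ℝ] H₂ => T x) this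
    have h4 := congrArg (fun T : H₂ →L[ℝ] H₂ => T y) this
    simp only [mul_apply_eq_comp, one_apply_eq_self] at h3 h4
    rw [← h3, ← h4, hxy]
  exact hinj (h1.trans h2.symm)

theorem postMap_map_apply (hK : ∀ i, K.adjoint (K (e i)) = (κ i ^ 2) • e i)
    (hκ : ∀ i, 0 < κ i) (hΛ : ∀ i, Λ (e i) = l i • e i) (hl : ∀ i, 0 ≤ l i) (hn : 0 < n)
    (x : H₁) (i : ℕ) : ⟪K x, (postMap K Λ n).adjoint (e i)⟫ =
      n * l i * κ i ^ 2 / (1 + n * l i * κ i ^ 2) * ⟪e i, x⟫ := by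
  rw [adjoint_postMap_apply hK hκ hΛ hl hn, real_inner_smul_right,
    ← ContinuousLinearMap.adjoint_inner_right, adjoint_leftSingular hK hκ, real_inner_smul_right,
    real_inner_comm]
  ring

theorem postCov_apply (hK : ∀ i, K.adjoint (K (e i)) = (κ i ^ 2) • e i)
    (hκ : ∀ i, 0 < κ i) (hΛ : ∀ i, Λ (e i) = l i • e i) (hl : ∀ i, 0 ≤ l i) (hn : 0 < n)
    (i : ℕ) : postCov K Λ n (e i) = (l i / (1 + n * l i * κ i ^ 2)) • e i := by
  have hu := isUnit_dataCov (K := K) hΛ hl hn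
  have hpos : (0 : ℝ) < 1 + n * l i * κ i ^ 2 := by have := hl i; positivity
  rw [postCov, sub_apply, ContinuousLinearMap.comp_apply,
    ContinuousLinearMap.comp_apply, postMap_comp_dataCov hu, adjoint_postMap_apply hK hκ hΛ hl hn,
    map_smul, adjoint_leftSingular hK hκ, map_smul, map_smul, hΛ, smul_smul, smul_smul, ← sub_smul]
  congr 1
  obtain ⟨w, hw⟩ : ∃ w, w = 1 + n * l i * κ i ^ 2 := ⟨_, rfl⟩
  rw [← hw] at hpos ⊢
  field_simp
  linear_combination l i * hw

end Operators

/-! ### The posterior distribution -/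

section Posterior

theorem compProd_map_id_prod_const {α β γ : Type*} [MeasurableSpace α] [MeasurableSpace β]
    [MeasurableSpace γ] (μ : Measure α) [IsFiniteMeasure μ] (ν : Measure β) [IsFiniteMeasure ν]
    {g : α × β → γ} (hg : Measurable g) :
    μ ⊗ₘ ((Kernel.id ×ₖ Kernel.const α ν).map g) = (μ.prod ν).map fun q => (q.1, g q) := by
  ext s hs
  have hm : Measurable fun q : α × β => (q.1, g q) := by fun_prop
  rw [Measure.compProd_apply hs, Measure.map_apply hm hs, Measure.prod_apply (hm hs)]
  refine lintegral_congr fun a => ?_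
  have h1 : MeasurableSet (Prod.mk a ⁻¹' s) := measurable_prodMk_left hs
  rw [Kernel.map_apply' _ hg _ h1, Kernel.prod_apply, Kernel.id_apply, Kernel.const_apply,
    Measure.dirac_prod, Measure.map_apply measurable_prodMk_left (hg h1)]
  rfl

variable {H₁ H₂ Ω : Type*} [NormedAddCommGroup H₁] [InnerProductSpace ℝ H₁] [CompleteSpace H₁]
  [SecondCountableTopology H₁] [MeasurableSpace H₁] [BorelSpace H₁]
  [NormedAddCommGroup H₂] [InnerProductSpace ℝ H₂] [CompleteSpace H₂]
  [MeasurableSpace Ω] {P : Measure Ω} [IsProbabilityMeasure P] {Z : H₂ → Ω → ℝ}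
  {π : Measure H₁} {Λ : H₁ →L[ℝ] H₁}

omit [CompleteSpace H₂] in
/-- Linear functionals of a Gaussian element and of an independent white noise are jointly
Gaussian. -/
theorem isGaussianProcess_inner_add (hZ : IsIsoGaussian Z P) [IsGaussian π] {T : Type*}
    (a : T → H₁) (c : T → ℝ) (g : T → H₂) :
    IsGaussianProcess (fun t (q : H₁ × Ω) => ⟪q.1, a t⟫ + c t * Z (g t) q.2) (π.prod P) where
  hasGaussianLaw I := by
    have h1 : HasGaussianLaw (Prod.fst : H₁ × Ω → H₁) (π.prod P) := ⟨by
      rw [Measure.map_fst_prod, measure_univ, one_smul]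
      infer_instance⟩
    have h2 : HasGaussianLaw (fun q : H₁ × Ω => I.restrict (fun t => Z (g t) q.2)) (π.prod P) := by
      have hm : Measurable fun ω => I.restrict (fun t => Z (g t) ω) :=
        measurable_pi_lambda _ fun t => hZ.measurable _
      have h3 := (hZ.gaussian.comp_right g).hasGaussianLaw I
      refine ⟨?_⟩
      have h4 : (π.prod P).map (fun q : H₁ × Ω => I.restrict (fun t => Z (g t) q.2)) =
          ((π.prod P).map Prod.snd).map (fun ω => I.restrict (fun t => Z (g t) ω)) := by
        rw [Measure.map_map hm measurable_snd]
        rfl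
      rw [h4, Measure.map_snd_prod, measure_univ, one_smul]
      exact h3.isGaussian_map
    have h3 : IndepFun (Prod.fst : H₁ × Ω → H₁)
        (fun q : H₁ × Ω => I.restrict (fun t => Z (g t) q.2)) (π.prod P) :=
      indepFun_prod measurable_id (measurable_pi_lambda _ fun t => hZ.measurable _)
    let L : H₁ × (I → ℝ) →L[ℝ] (I → ℝ) :=
      ContinuousLinearMap.pi fun t =>
        (innerSL ℝ (a t)).comp (ContinuousLinearMap.fst ℝ H₁ (I → ℝ)) +
        c t • ((ContinuousLinearMap.proj t).comp (ContinuousLinearMap.snd ℝ H₁ (I → ℝ)))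
    convert! (IndepFun.hasGaussianLaw h1 h2 h3).map L using 1
    ext q t
    simp [L, real_inner_comm]

omit [CompleteSpace H₂] in
theorem integral_inner_add (hZ : IsIsoGaussian Z P) (hπ : IsGaussianLaw π 0 Λ)
    (a : H₁) (c : ℝ) (g : H₂) :
    ∫ q : H₁ × Ω, ⟪q.1, a⟫ + c * Z g q.2 ∂(π.prod P) = 0 := by
  have := hπ.isGaussian
  have h1 : Integrable (fun x : H₁ => ⟪x, a⟫) π := IsGaussian.integrable_id.inner_const a
  have h2 : Integrable (fun ω => c * Z g ω) P :=
    ((hZ.memLp g).integrable (by norm_num)).const_mul c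
  rw [integral_add (h1.comp_fst P) (h2.comp_snd π), integral_fun_fst (fun x : H₁ => ⟪x, a⟫),
    integral_fun_snd (fun ω => c * Z g ω), hπ.mean, integral_const_mul, hZ.mean]
  simp

omit [CompleteSpace H₂] in
theorem covariance_inner_add (hZ : IsIsoGaussian Z P) (hπ : IsGaussianLaw π 0 Λ)
    (a a' : H₁) (c c' : ℝ) (g g' : H₂) :
    cov[fun q : H₁ × Ω => ⟪q.1, a⟫ + c * Z g q.2, fun q => ⟪q.1, a'⟫ + c' * Z g' q.2; π.prod P] =
      ⟪a, Λ a'⟫ + c * c' * ⟪g, g'⟫ := by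
  have := hπ.isGaussian
  have h1 : ∀ a, MemLp (fun x : H₁ => ⟪x, a⟫) 2 π := fun a =>
    IsGaussian.memLp_two_id.inner_const a
  have h2 : ∀ (c : ℝ) (g : H₂), MemLp (fun ω => c * Z g ω) 2 P := fun c g =>
    (hZ.memLp g).const_mul c
  have h3 : ∀ a, MemLp (fun q : H₁ × Ω => ⟪q.1, a⟫) 2 (π.prod P) := fun a => (h1 a).comp_fst P
  have h4 : ∀ (c : ℝ) (g : H₂), MemLp (fun q : H₁ × Ω => c * Z g q.2) 2 (π.prod P) :=
    fun c g => (h2 c g).comp_snd π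
  have e1 : ∀ (a : H₁) (c : ℝ) (g : H₂), (fun q : H₁ × Ω => ⟪q.1, a⟫ + c * Z g q.2) =
    (fun q : H₁ × Ω => ⟪q.1, a⟫) + (fun q : H₁ × Ω => c * Z g q.2) := fun _ _ _ => rfl
  rw [e1, e1, covariance_add_left (h3 _) (h4 _ _) ((h3 _).add (h4 _ _)),
    covariance_add_right (h3 _) (h3 _) (h4 _ _), covariance_add_right (h4 _ _) (h3 _) (h4 _ _),
    covariance_fst_snd_prod (h1 a) (h2 c' g'), covariance_comm (fun q : H₁ × Ω => c * Z g q.2),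
    covariance_fst_snd_prod (h1 a') (h2 c g)]
  have e2 : cov[fun q : H₁ × Ω => ⟪q.1, a⟫, fun q => ⟪q.1, a'⟫; π.prod P] = ⟪a, Λ a'⟫ := by
    have : cov[fun x => ⟪x, a⟫, fun x => ⟪x, a'⟫; (π.prod P).map Prod.fst] =
        cov[fun q : H₁ × Ω => ⟪q.1, a⟫, fun q => ⟪q.1, a'⟫; π.prod P] :=
      covariance_map_fun (by fun_prop) (by fun_prop) (by fun_prop)
    rw [← this, Measure.map_fst_prod, measure_univ, one_smul, hπ.cov]
  have e3 : cov[fun q : H₁ × Ω => c * Z g q.2, fun q => c' * Z g' q.2; π.prod P] =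
      c * c' * ⟪g, g'⟫ := by
    rw [covariance_const_mul_left, covariance_const_mul_right, ← hZ.cov]
    have : cov[Z g, Z g'; (π.prod P).map Prod.snd] =
        cov[fun q : H₁ × Ω => Z g q.2, fun q => Z g' q.2; π.prod P] :=
      covariance_map_fun (hZ.measurable g).aestronglyMeasurable
        (hZ.measurable g').aestronglyMeasurable (by fun_prop)
    rw [← this, Measure.map_snd_prod, measure_univ, one_smul, mul_assoc]
  rw [e2, e3]
  ring

variable {e : HilbertBasis ℕ ℝ H₁} {K : H₁ →L[ℝ] H₂} {n : ℕ}

omit [SecondCountableTopology H₁] [BorelSpace H₁] [MeasurableSpace H₁] in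
theorem HilbertBasis.postMean_observation (hZ : IsIsoGaussian Z P)
    (hA : Summable fun i => ‖(postMap K Λ n).adjoint (e i)‖ ^ 2) :
    ∀ᵐ ω ∂P, ∀ μ : H₁, postMean e K Λ n (observation K Z n μ ω) =
      postMap K Λ n (K μ) +
        (√(n : ℝ))⁻¹ • ∑' i, Z ((postMap K Λ n).adjoint (e i)) ω • e i := by
  filter_upwards [hZ.ae_summable_sq hA] with ω hω μ
  refine HasSum.tsum_eq ?_
  have h1 := ((e.summable_smul_iff.2 hω).hasSum.const_smul (√(n : ℝ))⁻¹)
  refine ((e.hasSum_inner_smul (postMap K Λ n (K μ))).add h1).congr_fun fun i => ?_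
  rw [observation, add_smul, smul_smul, ContinuousLinearMap.adjoint_inner_right,
    real_inner_comm (e i)]

theorem measurable_postMean : Measurable (postMean e K Λ n) :=
  e.measurable_tsum_smul.comp (measurable_pi_lambda _ fun _ => measurable_pi_apply _)

omit [SecondCountableTopology H₁] [CompleteSpace H₁] [CompleteSpace H₂]
  [IsProbabilityMeasure P] in
theorem measurable_observation (hZ : IsIsoGaussian Z P) :
    Measurable fun q : H₁ × Ω => observation K Z n q.1 q.2 := by
  refine measurable_pi_lambda _ fun h => ?_
  have := hZ.measurable h
  have h2 : Measurable fun x : H₁ => ⟪K x, h⟫ := by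
    have : Continuous fun x : H₁ => ⟪K x, h⟫ := by fun_prop
    exact this.measurable
  exact (h2.comp measurable_fst).add ((this.comp measurable_snd).const_mul _)

omit [SecondCountableTopology H₁] [MeasurableSpace H₁] [BorelSpace H₁] in
theorem HilbertBasis.tsum_inner_smul_adjoint (e : HilbertBasis ℕ ℝ H₁) (A : H₂ →L[ℝ] H₁)
    (h : H₁) : ∑' i, ⟪e i, h⟫ • A.adjoint (e i) = A.adjoint h := by
  refine HasSum.tsum_eq ?_
  simpa only [map_smul] using (e.hasSum_inner_smul h).mapL A.adjoint

omit [SecondCountableTopology H₁] [BorelSpace H₁] in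
/-- The functionals of the residual `μ - A Y` are `⟪μ, h⟫ - Y_{Aᵀ h}`. -/
theorem inner_residual_ae_eq (hZ : IsIsoGaussian Z P) (hπ : IsGaussianLaw π 0 Λ)
    (hA : Summable fun i => ‖(postMap K Λ n).adjoint (e i)‖ ^ 2) (h : H₁) :
    (fun q : H₁ × Ω => ⟪q.1 - postMean e K Λ n (observation K Z n q.1 q.2), h⟫)
      =ᵐ[π.prod P] fun q => ⟪q.1, h - K.adjoint ((postMap K Λ n).adjoint h)⟫ +
        (-(√(n : ℝ))⁻¹) * Z ((postMap K Λ n).adjoint h) q.2 := by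
  have := hπ.isGaussian
  have h1 := hZ.inner_tsum_smul_ae_eq e hA h
  rw [e.tsum_inner_smul_adjoint] at h1
  have h2 := h1.and (HilbertBasis.postMean_observation hZ hA)
  have h3 : ∀ᵐ q ∂(π.prod P), _ := Measure.quasiMeasurePreserving_snd.ae h2
  filter_upwards [h3] with q ⟨h4, h5⟩
  rw [h5, inner_sub_left, inner_add_left, real_inner_smul_left, h4, inner_sub_right,
    ContinuousLinearMap.adjoint_inner_right, ContinuousLinearMap.adjoint_inner_right]
  ring

/-- The residual `μ - A Y` has the distribution `N(0, S)`. -/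
theorem isGaussianLaw_residual (hZ : IsIsoGaussian Z P) (hπ : IsGaussianLaw π 0 Λ) {l : ℕ → ℝ}
    (hΛ : ∀ i, Λ (e i) = l i • e i) (hl : ∀ i, 0 ≤ l i) (hn : 0 < n)
    (hA : Summable fun i => ‖(postMap K Λ n).adjoint (e i)‖ ^ 2) :
    IsGaussianLaw ((π.prod P).map fun q =>
      q.1 - postMean e K Λ n (observation K Z n q.1 q.2)) 0 (postCov K Λ n) := by
  have := hπ.isGaussian
  have hu := isUnit_dataCov (K := K) hΛ hl hn
  have hae := fun h => inner_residual_ae_eq hZ hπ hA h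
  have hm : Measurable fun q : H₁ × Ω => q.1 - postMean e K Λ n (observation K Z n q.1 q.2) :=
    measurable_fst.sub (measurable_postMean.comp (measurable_observation hZ))
  refine IsGaussianLaw.of_forall_inner hm (fun h => ?_) (fun h => ?_) (fun h h' => ?_)
  · have := (isGaussianProcess_inner_add hZ (π := π) (T := Unit)
      (fun _ => h - K.adjoint ((postMap K Λ n).adjoint h)) (fun _ => -(√(n : ℝ))⁻¹)
      (fun _ => (postMap K Λ n).adjoint h)).hasGaussianLaw_eval ()
    exact this.congr (hae h).symm
  · rw [integral_congr_ae (hae h), integral_inner_add hZ hπ, inner_zero_left]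
  · rw [covariance_congr_ae (hae h) (hae h'), covariance_inner_add hZ hπ]
    have h1 : (-(√(n : ℝ))⁻¹) * (-(√(n : ℝ))⁻¹) = (n : ℝ)⁻¹ := by
      rw [neg_mul_neg, ← mul_inv, Real.mul_self_sqrt (Nat.cast_nonneg n)]
    have h2 := dataCov_adjoint_postMap (K := K) hΛ hu h'
    have h3 : postCov K Λ n h' = Λ h' - Λ (K.adjoint ((postMap K Λ n).adjoint h')) := by
      rw [← postMap_comp_dataCov hu]
      rfl
    have h4 := congrArg (fun x => ⟪(postMap K Λ n).adjoint h, x⟫) h2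
    simp only [dataCov_apply, inner_add_right, real_inner_smul_right] at h4
    rw [h1, h3, map_sub, inner_sub_left, inner_sub_right, inner_sub_right,
      ContinuousLinearMap.adjoint_inner_left K (Λ h'),
      ContinuousLinearMap.adjoint_inner_left K (Λ _)]
    linarith

/-- The residual `μ - A Y` is independent of the observation `Y`: both are functionals of a common
Gaussian process, and they are uncorrelated. -/
theorem indepFun_observation_residual (hZ : IsIsoGaussian Z P) (hπ : IsGaussianLaw π 0 Λ)
    {l : ℕ → ℝ} (hΛ : ∀ i, Λ (e i) = l i • e i) (hl : ∀ i, 0 ≤ l i) (hn : 0 < n)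
    (hA : Summable fun i => ‖(postMap K Λ n).adjoint (e i)‖ ^ 2) :
    IndepFun (fun q : H₁ × Ω => observation K Z n q.1 q.2)
      (fun q => q.1 - postMean e K Λ n (observation K Z n q.1 q.2)) (π.prod P) := by
  have := hπ.isGaussian
  have hu := isUnit_dataCov (K := K) hΛ hl hn
  let R : ℕ → H₁ × Ω → ℝ := fun i q =>
    ⟪q.1, e i - K.adjoint ((postMap K Λ n).adjoint (e i))⟫ +
      (-(√(n : ℝ))⁻¹) * Z ((postMap K Λ n).adjoint (e i)) q.2
  let Y : H₂ → H₁ × Ω → ℝ := fun h q => ⟪q.1, K.adjoint h⟫ + (√(n : ℝ))⁻¹ * Z h q.2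
  have hY : (fun q : H₁ × Ω => observation K Z n q.1 q.2) = fun q h => Y h q := by
    ext q h
    simp only [Y, observation, ContinuousLinearMap.adjoint_inner_right]
  have hmeas : ∀ (a : H₁) (c : ℝ) (g : H₂),
      AEMeasurable (fun q : H₁ × Ω => ⟪q.1, a⟫ + c * Z g q.2) (π.prod P) := fun a c g => by
    have := hZ.measurable g
    fun_prop
  have hind : IndepFun (fun q h => Y h q) (fun q i => R i q) (π.prod P) := by
    refine IsGaussianProcess.indepFun_of_covariance_eq_zero ?_ (fun h => hmeas _ _ _)
      (fun i => hmeas _ _ _) (fun h i => ?_)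
    · convert isGaussianProcess_inner_add hZ (π := π) (T := H₂ ⊕ ℕ)
        (Sum.elim (fun h => K.adjoint h)
          fun i => e i - K.adjoint ((postMap K Λ n).adjoint (e i)))
        (Sum.elim (fun _ => (√(n : ℝ))⁻¹) fun _ => -(√(n : ℝ))⁻¹)
        (Sum.elim (fun h => h) fun i => (postMap K Λ n).adjoint (e i)) using 1
      ext t q
      cases t <;> rfl
    · rw [covariance_inner_add hZ hπ]
      have h1 : (√(n : ℝ))⁻¹ * (-(√(n : ℝ))⁻¹) = -(n : ℝ)⁻¹ := by
        rw [mul_neg, ← mul_inv, Real.mul_self_sqrt (Nat.cast_nonneg n)]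
      have h4 := congrArg (fun x => ⟪h, x⟫) (dataCov_adjoint_postMap (K := K) hΛ hu (e i))
      simp only [dataCov_apply, inner_add_right, real_inner_smul_right] at h4
      rw [h1, map_sub, inner_sub_right, ContinuousLinearMap.adjoint_inner_left,
        ContinuousLinearMap.adjoint_inner_left]
      linarith
  rw [hY]
  refine (hind.comp measurable_id e.measurable_tsum_smul).congr ae_eq_rfl ?_
  have hae : ∀ᵐ q ∂(π.prod P), ∀ i, _ := ae_all_iff.2 fun i => inner_residual_ae_eq hZ hπ hA (e i)
  filter_upwards [hae] with q hq
  simp only [Function.comp_apply]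
  refine HasSum.tsum_eq ?_
  refine (e.hasSum_inner_smul _).congr_fun fun i => ?_
  rw [real_inner_comm, hq i]

/-- `N(A Y, S)` is the posterior distribution. -/
theorem postLaw_ae_eq_posterior (hZ : IsIsoGaussian Z P) (hπ : IsGaussianLaw π 0 Λ) {l : ℕ → ℝ}
    (hΛ : ∀ i, Λ (e i) = l i • e i) (hl : ∀ i, 0 ≤ l i) (hn : 0 < n)
    (hA : Summable fun i => ‖(postMap K Λ n).adjoint (e i)‖ ^ 2) [IsFiniteMeasure π] :
    postLaw e K Λ n =ᵐ[likelihood K Z P n ∘ₘ π] posterior (likelihood K Z P n) π := by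
  have := hπ.isGaussian
  have hY := measurable_observation (K := K) (n := n) hZ
  have hjoint : π ⊗ₘ likelihood K Z P n =
      (π.prod P).map fun q => (q.1, observation K Z n q.1 q.2) :=
    compProd_map_id_prod_const π P hY
  have hmarg : likelihood K Z P n ∘ₘ π = (π.prod P).map fun q => observation K Z n q.1 q.2 := by
    rw [← Measure.snd_compProd, hjoint, Measure.snd, Measure.map_map measurable_snd (by fun_prop)]
    rfl
  have hres := isGaussianLaw_residual hZ hπ hΛ hl hn hA
  set ν := (π.prod P).map fun q => q.1 - postMean e K Λ n (observation K Z n q.1 q.2) with hν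
  have := hres.isGaussian
  have hg : Measurable fun p : (H₂ → ℝ) × H₁ => postMean e K Λ n p.1 + p.2 :=
    (measurable_postMean.comp measurable_fst).add measurable_snd
  have hη : postLaw e K Λ n = ⇑((Kernel.id ×ₖ Kernel.const (H₂ → ℝ) ν).map
      fun p : (H₂ → ℝ) × H₁ => postMean e K Λ n p.1 + p.2) := by
    funext y
    rw [postLaw, (hres.const_add _).gaussianMeasure_eq, Kernel.map_apply _ hg, Kernel.prod_apply,
      Kernel.id_apply, Kernel.const_apply, Measure.dirac_prod,
      Measure.map_map hg measurable_prodMk_left]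
    rfl
  rw [hη]
  refine ae_eq_posterior_of_compProd_eq ?_
  have hm1 : Measurable fun q : H₁ × Ω => q.1 - postMean e K Λ n (observation K Z n q.1 q.2) :=
    measurable_fst.sub (measurable_postMean.comp hY)
  have hind := (indepFun_iff_map_prod_eq_prod_map_map hY.aemeasurable hm1.aemeasurable).1
    (indepFun_observation_residual hZ hπ hΛ hl hn hA)
  have : IsFiniteMeasure ((π.prod P).map fun q => observation K Z n q.1 q.2) := inferInstance
  rw [hmarg, compProd_map_id_prod_const _ _ hg, hjoint, Measure.map_map measurable_swap
    (by fun_prop), hν, ← hind, Measure.map_map (by fun_prop) (by fun_prop)]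
  congr 1
  funext q
  simp [Prod.swap]

end Posterior

/-! ### Concentration of weighted sums of squares -/

section Concentration

variable {H Ω : Type*} [NormedAddCommGroup H] [InnerProductSpace ℝ H] [MeasurableSpace Ω]
  {P : Measure Ω} [IsProbabilityMeasure P] {Z : H → Ω → ℝ}

/-- The variance of the square of a standard normal variable (its value `2` is irrelevant here). -/
noncomputable def varSqNormal : ℝ := Var[fun x => x ^ 2; gaussianReal 0 1]

theorem varSqNormal_nonneg : 0 ≤ varSqNormal := variance_nonneg _ _

theorem memLp_sq_gaussianReal : MemLp (fun x : ℝ => x ^ 2) 2 (gaussianReal 0 1) := by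
  rw [memLp_two_iff_integrable_sq (by fun_prop)]
  have := (memLp_id_gaussianReal (μ := 0) (v := 1) 4).integrable_norm_pow (p := 4) (by norm_num)
  refine this.congr (ae_of_all _ fun x => ?_)
  simp only [id, Real.norm_eq_abs]
  rw [← pow_mul, Even.pow_abs (by decide)]

theorem IsIsoGaussian.ae_sq_smul (hZ : IsIsoGaussian Z P) (f : ℕ → H) {t : ℕ → ℝ}
    (ht : ∀ i, 0 ≤ t i) :
    ∀ᵐ ω ∂P, ∀ i, Z (√(t i) • f i) ω ^ 2 = t i * Z (f i) ω ^ 2 := by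
  rw [ae_all_iff]
  intro i
  filter_upwards [hZ.ae_smul (√(t i)) (f i)] with ω hω
  rw [hω, mul_pow, Real.sq_sqrt (ht i)]

theorem IsIsoGaussian.ae_summable_mul_sq (hZ : IsIsoGaussian Z P) {f : ℕ → H}
    (hf : Orthonormal ℝ f) {t : ℕ → ℝ} (ht : ∀ i, 0 ≤ t i) (hsum : Summable t) :
    ∀ᵐ ω ∂P, Summable fun i => t i * Z (f i) ω ^ 2 := by
  have hg : Summable fun i => ‖√(t i) • f i‖ ^ 2 := by
    refine hsum.congr fun i => ?_
    rw [norm_smul, hf.1 i, mul_one, Real.norm_eq_abs, sq_abs, Real.sq_sqrt (ht i)]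
  filter_upwards [hZ.ae_summable_sq hg, hZ.ae_sq_smul f ht] with ω h1 h2
  simpa only [h2] using h1

theorem IsIsoGaussian.lintegral_sq_sub_le (hZ : IsIsoGaussian Z P) {f : ℕ → H}
    (hf : Orthonormal ℝ f) {t : ℕ → ℝ} (ht : ∀ i, 0 ≤ t i) (hsum : Summable t) {M : ℝ}
    (hM : ∀ i, t i ≤ M) (k : ℕ) :
    ∫⁻ ω, ENNReal.ofReal ((∑ i ∈ Finset.range k, t i * Z (f i) ω ^ 2 -
      ∑ i ∈ Finset.range k, t i) ^ 2) ∂P ≤ ENNReal.ofReal (varSqNormal * (M * ∑' i, t i)) := by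
  have hlaw : ∀ i, P.map (Z (f i)) = gaussianReal 0 1 := fun i => by
    have := (hZ.hasLaw (f i)).map_eq
    rwa [hf.1 i, one_pow, Real.toNNReal_one] at this
  have hmem : ∀ i, MemLp (fun ω => Z (f i) ω ^ 2) 2 P := fun i => by
    have h1 := memLp_sq_gaussianReal
    rw [← hlaw i] at h1
    exact h1.comp_of_map (hZ.measurable _).aemeasurable
  have hvar : ∀ i, Var[fun ω => Z (f i) ω ^ 2; P] = varSqNormal := fun i => by
    rw [varSqNormal, ← hlaw i, variance_map (by fun_prop) (hZ.measurable _).aemeasurable]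
    rfl
  have hmean : ∀ i, ∫ ω, Z (f i) ω ^ 2 ∂P = 1 := fun i => by
    simp only [sq]
    rw [hZ.integral_mul, real_inner_self_eq_norm_sq, hf.1 i, one_pow]
  have hmem' : ∀ i, MemLp (fun ω => t i * Z (f i) ω ^ 2) 2 P := fun i => (hmem i).const_mul _
  have hX : MemLp (fun ω => ∑ i ∈ Finset.range k, t i * Z (f i) ω ^ 2) 2 P :=
    memLp_finsetSum _ fun i _ => hmem' i
  have hEX : ∫ ω, ∑ i ∈ Finset.range k, t i * Z (f i) ω ^ 2 ∂P = ∑ i ∈ Finset.range k, t i := by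
    rw [integral_finsetSum _ fun i _ => (hmem' i).integrable (by norm_num)]
    refine Finset.sum_congr rfl fun i _ => ?_
    rw [integral_const_mul, hmean, mul_one]
  have hV : Var[fun ω => ∑ i ∈ Finset.range k, t i * Z (f i) ω ^ 2; P] =
      ∑ i ∈ Finset.range k, t i ^ 2 * varSqNormal := by
    have h1 := IndepFun.variance_sum (μ := P) (s := Finset.range k)
      (X := fun i ω => t i * Z (f i) ω ^ 2) (fun i _ => hmem' i) fun i _ j _ hij =>
      ((hZ.iIndepFun hf).indepFun hij).comp (φ := fun x => t i * x ^ 2)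
        (ψ := fun x => t j * x ^ 2) (by fun_prop) (by fun_prop)
    have h2 : (∑ i ∈ Finset.range k, fun ω => t i * Z (f i) ω ^ 2) =
        fun ω => ∑ i ∈ Finset.range k, t i * Z (f i) ω ^ 2 := by
      ext ω
      simp
    rw [h2] at h1
    rw [h1]
    refine Finset.sum_congr rfl fun i _ => ?_
    rw [variance_const_mul, hvar]
  have hint : Integrable (fun ω => (∑ i ∈ Finset.range k, t i * Z (f i) ω ^ 2 -
      ∑ i ∈ Finset.range k, t i) ^ 2) P := (hX.sub (memLp_const _)).integrable_sq
  rw [← ofReal_integral_eq_lintegral_ofReal hint (ae_of_all _ fun _ => sq_nonneg _)]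
  refine ENNReal.ofReal_le_ofReal ?_
  rw [variance_eq_integral hX.1.aemeasurable, hEX] at hV
  refine hV.le.trans ?_
  rw [← Finset.sum_mul, mul_comm]
  refine mul_le_mul_of_nonneg_left ?_ varSqNormal_nonneg
  have hM0 : 0 ≤ M := (ht 0).trans (hM 0)
  calc ∑ i ∈ Finset.range k, t i ^ 2 ≤ ∑ i ∈ Finset.range k, M * t i :=
        Finset.sum_le_sum fun i _ => by rw [sq]; exact mul_le_mul_of_nonneg_right (hM i) (ht i)
    _ = M * ∑ i ∈ Finset.range k, t i := by rw [Finset.mul_sum]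
    _ ≤ M * ∑' i, t i := mul_le_mul_of_nonneg_left (hsum.sum_le_tsum _ fun i _ => ht i) hM0

/-- Chebyshev's inequality for `∑ᵢ tᵢ ξᵢ²` with independent standard normal variables `ξᵢ`. -/
theorem IsIsoGaussian.measure_abs_tsum_sub_le (hZ : IsIsoGaussian Z P) {f : ℕ → H}
    (hf : Orthonormal ℝ f) {t : ℕ → ℝ} (ht : ∀ i, 0 ≤ t i) (hsum : Summable t) {M : ℝ}
    (hM : ∀ i, t i ≤ M) {δ : ℝ} (hδ : 0 < δ) :
    P.real {ω | δ ≤ |∑' i, t i * Z (f i) ω ^ 2 - ∑' i, t i|} ≤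
      varSqNormal * (M * ∑' i, t i) / δ ^ 2 := by
  have hmeas : ∀ i, Measurable fun ω => Z (f i) ω := fun i => hZ.measurable _
  have hB : 0 ≤ varSqNormal * (M * ∑' i, t i) :=
    mul_nonneg varSqNormal_nonneg (mul_nonneg ((ht 0).trans (hM 0)) (tsum_nonneg ht))
  have h1 : ∫⁻ ω, ENNReal.ofReal ((∑' i, t i * Z (f i) ω ^ 2 - ∑' i, t i) ^ 2) ∂P ≤
      ENNReal.ofReal (varSqNormal * (M * ∑' i, t i)) := by
    calc ∫⁻ ω, ENNReal.ofReal ((∑' i, t i * Z (f i) ω ^ 2 - ∑' i, t i) ^ 2) ∂P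
        = ∫⁻ ω, liminf (fun k => ENNReal.ofReal ((∑ i ∈ Finset.range k, t i * Z (f i) ω ^ 2 -
          ∑ i ∈ Finset.range k, t i) ^ 2)) atTop ∂P := by
          refine lintegral_congr_ae ?_
          filter_upwards [hZ.ae_summable_mul_sq hf ht hsum] with ω hω
          refine (Tendsto.liminf_eq ?_).symm
          exact ENNReal.tendsto_ofReal
            ((hω.hasSum.tendsto_sum_nat.sub hsum.hasSum.tendsto_sum_nat).pow 2)
      _ ≤ liminf (fun k => ∫⁻ ω, ENNReal.ofReal ((∑ i ∈ Finset.range k, t i * Z (f i) ω ^ 2 -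
          ∑ i ∈ Finset.range k, t i) ^ 2) ∂P) atTop :=
          lintegral_liminf_le fun k => by fun_prop
      _ ≤ ENNReal.ofReal (varSqNormal * (M * ∑' i, t i)) := by
          refine liminf_le_of_frequently_le' ?_
          exact Frequently.of_forall fun k => hZ.lintegral_sq_sub_le hf ht hsum hM k
  have h2 := mul_meas_ge_le_lintegral₀ (μ := P)
    (f := fun ω => ENNReal.ofReal ((∑' i, t i * Z (f i) ω ^ 2 - ∑' i, t i) ^ 2))
    (by have := fun i => (hmeas i); fun_prop) (ENNReal.ofReal (δ ^ 2))
  have h3 : {ω | ENNReal.ofReal (δ ^ 2) ≤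
      ENNReal.ofReal ((∑' i, t i * Z (f i) ω ^ 2 - ∑' i, t i) ^ 2)} =
      {ω | δ ≤ |∑' i, t i * Z (f i) ω ^ 2 - ∑' i, t i|} := by
    ext ω
    rw [Set.mem_ofPred_eq, Set.mem_ofPred_eq, ENNReal.ofReal_le_ofReal_iff (sq_nonneg _),
      ← sq_abs (_ - _)]
    exact pow_le_pow_iff_left₀ hδ.le (abs_nonneg _) two_ne_zero
  rw [h3] at h2
  have h4 := ENNReal.toReal_mono ENNReal.ofReal_ne_top (h2.trans h1)
  rw [ENNReal.toReal_mul, ENNReal.toReal_ofReal (sq_nonneg _), ENNReal.toReal_ofReal hB] at h4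
  rw [le_div_iff₀ (by positivity), mul_comm]
  exact h4

end Concentration

/-! ### Credible balls and their coverage at a fixed sample size -/

section FixedSampleSize

/-- The eigenvalue `sᵢ = λᵢ / (1 + n λᵢ κᵢ²)` of the posterior covariance operator. -/
noncomputable def postVar (κ l : ℕ → ℝ) (n : ℕ) (i : ℕ) : ℝ := l i / (1 + n * l i * κ i ^ 2)

/-- The variance `tᵢ = n λᵢ² κᵢ² / (1 + n λᵢ κᵢ²)²` of the `i`th coordinate of the posterior mean
under a fixed truth. -/
noncomputable def meanVar (κ l : ℕ → ℝ) (n : ℕ) (i : ℕ) : ℝ :=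
  n * l i ^ 2 * κ i ^ 2 / (1 + n * l i * κ i ^ 2) ^ 2

section Sequences

variable {κ l : ℕ → ℝ} {n : ℕ}

theorem one_add_pos (hl : ∀ i, 0 ≤ l i) (i : ℕ) : 0 < 1 + n * l i * κ i ^ 2 := by
  have := hl i
  positivity

theorem postVar_nonneg (hl : ∀ i, 0 ≤ l i) (i : ℕ) : 0 ≤ postVar κ l n i :=
  div_nonneg (hl i) (one_add_pos hl i).le

theorem postVar_le (hl : ∀ i, 0 ≤ l i) (i : ℕ) : postVar κ l n i ≤ l i := by
  refine div_le_self (hl i) ?_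
  have := hl i
  have : 0 ≤ n * l i * κ i ^ 2 := by positivity
  linarith

theorem meanVar_nonneg (i : ℕ) : 0 ≤ meanVar κ l n i := by
  unfold meanVar
  positivity

/-- `sᵢ - tᵢ = sᵢ / (1 + n λᵢ κᵢ²)`: the posterior is more spread out than the posterior mean. -/
theorem postVar_sub_meanVar (hl : ∀ i, 0 ≤ l i) (i : ℕ) :
    postVar κ l n i - meanVar κ l n i = postVar κ l n i / (1 + n * l i * κ i ^ 2) := by
  have := (one_add_pos (κ := κ) (n := n) hl i).ne'
  unfold postVar meanVar
  obtain ⟨w, hw⟩ : ∃ w, w = 1 + n * l i * κ i ^ 2 := ⟨_, rfl⟩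
  rw [← hw] at this ⊢
  field_simp
  linear_combination l i * hw

theorem meanVar_le_postVar (hl : ∀ i, 0 ≤ l i) (i : ℕ) : meanVar κ l n i ≤ postVar κ l n i := by
  have h1 := postVar_sub_meanVar (κ := κ) (n := n) hl i
  have h2 : 0 ≤ postVar κ l n i / (1 + n * l i * κ i ^ 2) :=
    div_nonneg (postVar_nonneg hl i) (one_add_pos hl i).le
  linarith

theorem summable_postVar (hl : ∀ i, 0 ≤ l i) (hsum : Summable l) : Summable (postVar κ l n) :=
  hsum.of_nonneg_of_le (postVar_nonneg hl) (postVar_le hl)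

theorem summable_meanVar (hl : ∀ i, 0 ≤ l i) (hsum : Summable l) : Summable (meanVar κ l n) :=
  (summable_postVar (κ := κ) (n := n) hl hsum).of_nonneg_of_le meanVar_nonneg
    (meanVar_le_postVar hl)

end Sequences

section Bias

variable {H₁ H₂ Ω : Type*} [NormedAddCommGroup H₁] [InnerProductSpace ℝ H₁] [CompleteSpace H₁]
  [NormedAddCommGroup H₂] [InnerProductSpace ℝ H₂] [CompleteSpace H₂]
  {e : HilbertBasis ℕ ℝ H₁} {K : H₁ →L[ℝ] H₂} {κ : ℕ → ℝ} {Λ : H₁ →L[ℝ] H₁} {l : ℕ → ℝ} {n : ℕ}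

/-- The bias `μ₀ - A K μ₀` of the posterior mean. -/
noncomputable def postBias (K : H₁ →L[ℝ] H₂) (Λ : H₁ →L[ℝ] H₁) (n : ℕ) (μ₀ : H₁) : H₁ :=
  μ₀ - postMap K Λ n (K μ₀)

theorem postBias_smul (c : ℝ) (μ₀ : H₁) : postBias K Λ n (c • μ₀) = c • postBias K Λ n μ₀ := by
  simp only [postBias, map_smul, smul_sub]

theorem inner_postBias (hK : ∀ i, K.adjoint (K (e i)) = (κ i ^ 2) • e i)
    (hκ : ∀ i, 0 < κ i) (hΛ : ∀ i, Λ (e i) = l i • e i) (hl : ∀ i, 0 ≤ l i) (hn : 0 < n)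
    (μ₀ : H₁) (i : ℕ) :
    ⟪e i, postBias K Λ n μ₀⟫ = ⟪e i, μ₀⟫ / (1 + n * l i * κ i ^ 2) := by
  have h := one_add_pos (κ := κ) (n := n) hl i
  rw [postBias, inner_sub_right, ← ContinuousLinearMap.adjoint_inner_left, real_inner_comm (K μ₀),
    postMap_map_apply hK hκ hΛ hl hn]
  field_simp
  ring

theorem postBias_basis (hK : ∀ i, K.adjoint (K (e i)) = (κ i ^ 2) • e i)
    (hκ : ∀ i, 0 < κ i) (hΛ : ∀ i, Λ (e i) = l i • e i) (hl : ∀ i, 0 ≤ l i) (hn : 0 < n) (j : ℕ) :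
    postBias K Λ n (e j) = (1 + n * l j * κ j ^ 2)⁻¹ • e j := by
  refine e.ext_inner fun i => ?_
  rw [inner_postBias hK hκ hΛ hl hn, real_inner_smul_right,
    orthonormal_iff_ite.1 e.orthonormal i j]
  by_cases hij : i = j
  · subst hij; simp
  · simp [hij]

theorem hasSum_postBias (hK : ∀ i, K.adjoint (K (e i)) = (κ i ^ 2) • e i)
    (hκ : ∀ i, 0 < κ i) (hΛ : ∀ i, Λ (e i) = l i • e i) (hl : ∀ i, 0 ≤ l i) (hn : 0 < n)
    (μ₀ : H₁) :
    HasSum (fun i => ⟪e i, μ₀⟫ ^ 2 / (1 + n * l i * κ i ^ 2) ^ 2) (‖postBias K Λ n μ₀‖ ^ 2) := by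
  refine (e.hasSum_sq _).congr_fun fun i => ?_
  rw [inner_postBias hK hκ hΛ hl hn, div_pow]

theorem norm_sq_adjoint_postMap (hK : ∀ i, K.adjoint (K (e i)) = (κ i ^ 2) • e i)
    (hκ : ∀ i, 0 < κ i) (hΛ : ∀ i, Λ (e i) = l i • e i) (hl : ∀ i, 0 ≤ l i) (hn : 0 < n) (i : ℕ) :
    ‖(postMap K Λ n).adjoint (e i)‖ ^ 2 = n * meanVar κ l n i := by
  rw [adjoint_postMap_apply hK hκ hΛ hl hn, norm_smul, (orthonormal_leftSingular hK hκ).1 i,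
    mul_one, Real.norm_eq_abs, sq_abs, meanVar, div_pow]
  ring

theorem summable_adjoint_postMap (hK : ∀ i, K.adjoint (K (e i)) = (κ i ^ 2) • e i)
    (hκ : ∀ i, 0 < κ i) (hΛ : ∀ i, Λ (e i) = l i • e i) (hl : ∀ i, 0 ≤ l i) (hsum : Summable l)
    (hn : 0 < n) : Summable fun i => ‖(postMap K Λ n).adjoint (e i)‖ ^ 2 := by
  simp only [norm_sq_adjoint_postMap hK hκ hΛ hl hn]
  exact (summable_meanVar hl hsum).mul_left _

/-- The noise `n^{-1/2} A Z` of the posterior mean. -/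
noncomputable def postNoise (e : HilbertBasis ℕ ℝ H₁) (K : H₁ →L[ℝ] H₂) (Z : H₂ → Ω → ℝ)
    (Λ : H₁ →L[ℝ] H₁) (n : ℕ) (ω : Ω) : H₁ :=
  (√(n : ℝ))⁻¹ • ∑' i, Z ((postMap K Λ n).adjoint (e i)) ω • e i

variable [MeasurableSpace Ω] {P : Measure Ω} [IsProbabilityMeasure P] {Z : H₂ → Ω → ℝ}

theorem ae_sub_postMean (hZ : IsIsoGaussian Z P)
    (hK : ∀ i, K.adjoint (K (e i)) = (κ i ^ 2) • e i)
    (hκ : ∀ i, 0 < κ i) (hΛ : ∀ i, Λ (e i) = l i • e i) (hl : ∀ i, 0 ≤ l i) (hsum : Summable l)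
    (hn : 0 < n) : ∀ᵐ ω ∂P, ∀ μ₀ : H₁, μ₀ - postMean e K Λ n (observation K Z n μ₀ ω) =
      postBias K Λ n μ₀ - postNoise e K Z Λ n ω := by
  filter_upwards [HilbertBasis.postMean_observation hZ
    (summable_adjoint_postMap hK hκ hΛ hl hsum hn)] with ω hω μ₀
  rw [hω, postBias, postNoise, sub_sub]

theorem ae_inner_postNoise (hZ : IsIsoGaussian Z P)
    (hK : ∀ i, K.adjoint (K (e i)) = (κ i ^ 2) • e i)
    (hκ : ∀ i, 0 < κ i) (hΛ : ∀ i, Λ (e i) = l i • e i) (hl : ∀ i, 0 ≤ l i) (hsum : Summable l)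
    (hn : 0 < n) : ∀ᵐ ω ∂P, ∀ i, ⟪e i, postNoise e K Z Λ n ω⟫ =
      √(meanVar κ l n i) * Z (leftSingular e K κ i) ω := by
  have h1 : ∀ᵐ ω ∂P, ∀ i, Z ((postMap K Λ n).adjoint (e i)) ω =
      (n * l i * κ i / (1 + n * l i * κ i ^ 2)) * Z (leftSingular e K κ i) ω := by
    rw [ae_all_iff]
    intro i
    rw [adjoint_postMap_apply hK hκ hΛ hl hn]
    exact hZ.ae_smul _ _
  filter_upwards [hZ.ae_summable_sq (summable_adjoint_postMap hK hκ hΛ hl hsum hn), h1]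
    with ω h2 h3 i
  rw [postNoise, real_inner_smul_right, e.inner_tsum_smul h2, h3, ← mul_assoc]
  congr 1
  have h4 := one_add_pos (κ := κ) (n := n) hl i
  have h5 : meanVar κ l n i = n * (l i * κ i / (1 + n * l i * κ i ^ 2)) ^ 2 := by
    rw [meanVar, div_pow]
    ring
  have h6 : 0 ≤ l i * κ i / (1 + n * l i * κ i ^ 2) :=
    div_nonneg (mul_nonneg (hl i) (hκ i).le) h4.le
  have h7 : (√(n : ℝ))⁻¹ * n = √(n : ℝ) := by
    rw [inv_mul_eq_div, Real.div_sqrt]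
  rw [h5, Real.sqrt_mul (Nat.cast_nonneg n), Real.sqrt_sq h6]
  conv_rhs => rw [← h7]
  ring

theorem ae_norm_sq_postNoise (hZ : IsIsoGaussian Z P)
    (hK : ∀ i, K.adjoint (K (e i)) = (κ i ^ 2) • e i)
    (hκ : ∀ i, 0 < κ i) (hΛ : ∀ i, Λ (e i) = l i • e i) (hl : ∀ i, 0 ≤ l i) (hsum : Summable l)
    (hn : 0 < n) : ∀ᵐ ω ∂P, ‖postNoise e K Z Λ n ω‖ ^ 2 =
      ∑' i, meanVar κ l n i * Z (leftSingular e K κ i) ω ^ 2 := by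
  filter_upwards [ae_inner_postNoise hZ hK hκ hΛ hl hsum hn] with ω hω
  rw [← (e.hasSum_sq _).tsum_eq]
  refine tsum_congr fun i => ?_
  rw [hω, mul_pow, Real.sq_sqrt (meanVar_nonneg i)]

variable [SecondCountableTopology H₁] [MeasurableSpace H₁] [BorelSpace H₁]

omit [IsProbabilityMeasure P] in
theorem measurable_postNoise (hZ : IsIsoGaussian Z P) : Measurable (postNoise e K Z Λ n) :=
  (e.measurable_tsum_smul.comp (measurable_pi_lambda _ fun _ => hZ.measurable _)).const_smul _

/-- The posterior probability of a ball around the posterior mean does not depend on the data. -/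
theorem postLaw_real_ball (hZ : IsIsoGaussian Z P)
    (hK : ∀ i, K.adjoint (K (e i)) = (κ i ^ 2) • e i)
    (hκ : ∀ i, 0 < κ i) (hΛ : ∀ i, Λ (e i) = l i • e i) (hl : ∀ i, 0 ≤ l i) (hsum : Summable l)
    (hn : 0 < n) (y : H₂ → ℝ) {r : ℝ} (hr : 0 ≤ r) :
    (postLaw e K Λ n y).real (Metric.ball (postMean e K Λ n y) r) =
      P.real {ω | ∑' i, postVar κ l n i * Z (leftSingular e K κ i) ω ^ 2 < r ^ 2} := by
  have hS := postCov_apply hK hκ hΛ hl hn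
  have hs := postVar_nonneg (κ := κ) (n := n) hl
  have hsum' := summable_postVar (κ := κ) (n := n) hl hsum
  have hf := orthonormal_leftSingular hK hκ
  have h1 := hZ.isGaussianLaw_tsum e hf hs hsum' hS
  rw [postLaw, (h1.const_add _).gaussianMeasure_eq, map_measureReal_apply (by fun_prop)
    measurableSet_ball]
  have hX : Measurable fun ω => ∑' i, Z (√(postVar κ l n i) • leftSingular e K κ i) ω • e i :=
    e.measurable_tsum_smul.comp (measurable_pi_lambda _ fun i => hZ.measurable _)
  rw [map_measureReal_apply hX (measurableSet_ball.preimage (by fun_prop))]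
  have hg : Summable fun i => ‖√(postVar κ l n i) • leftSingular e K κ i‖ ^ 2 := by
    refine hsum'.congr fun i => ?_
    rw [norm_smul, hf.1 i, mul_one, Real.norm_eq_abs, sq_abs, Real.sq_sqrt (hs i)]
  refine measureReal_congr ?_
  filter_upwards [hZ.ae_summable_sq hg, hZ.ae_sq_smul (leftSingular e K κ) hs] with ω h2 h3
  refine propext ?_
  change (postMean e K Λ n y + _) ∈ Metric.ball (postMean e K Λ n y) r ↔
    ∑' i, postVar κ l n i * Z (leftSingular e K κ i) ω ^ 2 < r ^ 2
  rw [mem_ball_iff_norm, add_sub_cancel_left, ← pow_lt_pow_iff_left₀ (norm_nonneg _) hr two_ne_zero,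
    e.norm_sq_tsum_smul h2]
  simp only [h3]

end Bias

end FixedSampleSize

/-! ### Bounds for the radii and the coverage at a fixed sample size -/

section Quantile

theorem sInf_quantile_le {F : ℝ → ℝ} {c r : ℝ} (hr : 0 ≤ r) (h : c ≤ F r) :
    sInf {r : ℝ | 0 ≤ r ∧ c ≤ F r} ≤ r :=
  csInf_le ⟨0, fun _ hx => hx.1⟩ ⟨hr, h⟩

theorem le_sInf_quantile {F : ℝ → ℝ} (hF : Monotone F) {c r r' : ℝ} (h : F r < c) (hr' : 0 ≤ r')
    (h' : c ≤ F r') : r ≤ sInf {r : ℝ | 0 ≤ r ∧ c ≤ F r} := by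
  refine le_csInf ⟨r', hr', h'⟩ fun x hx => ?_
  by_contra! hlt
  exact absurd (hF hlt.le) (not_le.2 (h.trans_le hx.2))

theorem one_sub_le_measureReal {Ω : Type*} [MeasurableSpace Ω] {P : Measure Ω}
    [IsProbabilityMeasure P] {s : Set Ω} {δ : ℝ} (h : P.real sᶜ ≤ δ) : 1 - δ ≤ P.real s := by
  have h1 := measureReal_union_le (μ := P) s sᶜ
  rw [Set.union_compl_self, probReal_univ] at h1
  linarith

theorem measureReal_mono_ae {Ω : Type*} [MeasurableSpace Ω] {P : Measure Ω}
    [IsFiniteMeasure P] {s t : Set Ω} (h : s ≤ᵐ[P] t) : P.real s ≤ P.real t :=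
  ENNReal.toReal_mono (measure_ne_top _ _) (measure_mono_ae h)

end Quantile

section Bounds

variable {H₁ H₂ Ω : Type*} [NormedAddCommGroup H₁] [InnerProductSpace ℝ H₁] [CompleteSpace H₁]
  [SecondCountableTopology H₁] [MeasurableSpace H₁] [BorelSpace H₁]
  [NormedAddCommGroup H₂] [InnerProductSpace ℝ H₂] [CompleteSpace H₂]
  {e : HilbertBasis ℕ ℝ H₁} {K : H₁ →L[ℝ] H₂} {κ : ℕ → ℝ} {Λ : H₁ →L[ℝ] H₁} {l : ℕ → ℝ} {n : ℕ}
  [MeasurableSpace Ω] {P : Measure Ω} [IsProbabilityMeasure P] {Z : H₂ → Ω → ℝ}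
  {M γ δ ε : ℝ}

/-- The operators `KᵀK` and `Λ` are simultaneously diagonalized by the basis `e`, with eigenvalues
`κᵢ² > 0` and `lᵢ ≥ 0`, where `Λ` is of trace class; the sample size `n` is positive. -/
structure IsDiagonalModel (e : HilbertBasis ℕ ℝ H₁) (K : H₁ →L[ℝ] H₂) (κ : ℕ → ℝ)
    (Λ : H₁ →L[ℝ] H₁) (l : ℕ → ℝ) (n : ℕ) : Prop where
  adjoint_map : ∀ i, K.adjoint (K (e i)) = (κ i ^ 2) • e i
  singular_pos : ∀ i, 0 < κ i
  prior : ∀ i, Λ (e i) = l i • e i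
  prior_nonneg : ∀ i, 0 ≤ l i
  summable : Summable l
  size_pos : 0 < n

omit [CompleteSpace H₂] in
/-- Concentration of `∑ᵢ tᵢ ξᵢ²` within the factors `1 ± ε` of its mean, if the largest weight is
small relative to the sum of the weights. -/
theorem IsIsoGaussian.measure_tail_le (hZ : IsIsoGaussian Z P) {f : ℕ → H₂}
    (hf : Orthonormal ℝ f) {t : ℕ → ℝ} (ht : ∀ i, 0 ≤ t i) (hsum : Summable t)
    (hM : ∀ i, t i ≤ M) (hε : 0 < ε) (hpos : 0 < ∑' i, t i)
    (hδ : varSqNormal * M ≤ δ * (ε ^ 2 * ∑' i, t i)) :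
    P.real {ω | ε * ∑' i, t i ≤ |∑' i, t i * Z (f i) ω ^ 2 - ∑' i, t i|} ≤ δ := by
  refine (hZ.measure_abs_tsum_sub_le hf ht hsum hM (mul_pos hε hpos)).trans ?_
  rw [div_le_iff₀ (by positivity)]
  calc varSqNormal * (M * ∑' i, t i) = (varSqNormal * M) * ∑' i, t i := by ring
    _ ≤ δ * (ε ^ 2 * ∑' i, t i) * ∑' i, t i := mul_le_mul_of_nonneg_right hδ hpos.le
    _ = δ * (ε * ∑' i, t i) ^ 2 := by ring

/-- The credible radius is a quantile of `(∑ᵢ sᵢ ξᵢ²)^{1/2}`; in particular it does not depend on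
the data. Writing `r * |r|` for `r²` makes the distribution function monotone on the whole line. -/
theorem credibleRadius_eq (hD : IsDiagonalModel e K κ Λ l n) (hZ : IsIsoGaussian Z P)
    (y : H₂ → ℝ) : credibleRadius e K Λ γ n y = sInf {r : ℝ | 0 ≤ r ∧ 1 - γ ≤
      P.real {ω | ∑' i, postVar κ l n i * Z (leftSingular e K κ i) ω ^ 2 < r * |r|}} := by
  unfold credibleRadius
  congr 1
  ext r
  refine and_congr_right fun hr => ?_
  rw [postLaw_real_ball hZ hD.1 hD.2 hD.3 hD.4 hD.5 hD.6 y hr, abs_of_nonneg hr, sq]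

omit [SecondCountableTopology H₁] [BorelSpace H₁] in
theorem credibleRadius_nonneg (y : H₂ → ℝ) : 0 ≤ credibleRadius e K Λ γ n y :=
  Real.sInf_nonneg fun _ hx => hx.1

/-- The squared radius of the credible ball is close to `∑ᵢ sᵢ`. -/
theorem credibleRadius_bounds (hD : IsDiagonalModel e K κ Λ l n) (hZ : IsIsoGaussian Z P)
    (hM : ∀ i, postVar κ l n i ≤ M) (hε : 0 < ε) (hε' : ε < 1)
    (hpos : 0 < ∑' i, postVar κ l n i)
    (hδ : varSqNormal * M ≤ δ * (ε ^ 2 * ∑' i, postVar κ l n i)) (hδγ : δ ≤ γ)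
    (hδγ' : δ < 1 - γ) (y : H₂ → ℝ) :
    √((1 - ε) * ∑' i, postVar κ l n i) ≤ credibleRadius e K Λ γ n y ∧
      credibleRadius e K Λ γ n y ≤ √((1 + ε) * ∑' i, postVar κ l n i) := by
  have hf := orthonormal_leftSingular hD.1 hD.2
  have htail := hZ.measure_tail_le hf (postVar_nonneg hD.4) (summable_postVar hD.4 hD.5) hM hε
    hpos hδ
  set T := ∑' i, postVar κ l n i with hT
  rw [credibleRadius_eq hD hZ]
  set F : ℝ → ℝ := fun r => P.real
    {ω | ∑' i, postVar κ l n i * Z (leftSingular e K κ i) ω ^ 2 < r * |r|} with hF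
  have hmono : Monotone F := by
    intro r r' hrr'
    refine measureReal_mono fun ω hω => ?_
    rw [Set.mem_ofPred_eq] at hω ⊢
    refine hω.trans_le ?_
    rcases le_or_gt 0 r with h | h
    · rw [abs_of_nonneg h, abs_of_nonneg (h.trans hrr')]
      exact mul_self_le_mul_self h hrr'
    · rcases le_or_gt 0 r' with h' | h'
      · exact (mul_nonpos_of_nonpos_of_nonneg h.le (abs_nonneg _)).trans
          (mul_nonneg h' (abs_nonneg _))
      · rw [abs_of_neg h, abs_of_neg h']
        nlinarith
  have h1 : 1 - γ ≤ F (√((1 + ε) * T)) := by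
    have : 1 - δ ≤ F (√((1 + ε) * T)) := by
      refine one_sub_le_measureReal (le_trans (measureReal_mono fun ω hω => ?_) htail)
      simp only [Set.mem_compl_iff, Set.mem_ofPred_eq, not_lt, abs_of_nonneg (Real.sqrt_nonneg _),
        Real.mul_self_sqrt (show 0 ≤ (1 + ε) * T by positivity)] at hω ⊢
      refine le_trans ?_ (le_abs_self _)
      linarith
    linarith
  have h2 : F (√((1 - ε) * T)) < 1 - γ := by
    refine lt_of_le_of_lt (le_trans (measureReal_mono fun ω hω => ?_) htail) hδγ'
    have : 0 ≤ (1 - ε) * T := mul_nonneg (by linarith) hpos.le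
    simp only [Set.mem_ofPred_eq, abs_of_nonneg (Real.sqrt_nonneg _), Real.mul_self_sqrt this]
      at hω ⊢
    refine le_trans ?_ (neg_le_abs _)
    linarith
  exact ⟨le_sInf_quantile hmono h2 (Real.sqrt_nonneg _) h1,
    sInf_quantile_le (Real.sqrt_nonneg _) h1⟩

omit [SecondCountableTopology H₁] [MeasurableSpace H₁] [BorelSpace H₁] in
theorem measure_postNoise_ge_le (hD : IsDiagonalModel e K κ Λ l n) (hZ : IsIsoGaussian Z P)
    (hM : ∀ i, meanVar κ l n i ≤ M) (hε : 0 < ε) (hpos : 0 < ∑' i, meanVar κ l n i)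
    (hδ : varSqNormal * M ≤ δ * (ε ^ 2 * ∑' i, meanVar κ l n i)) :
    P.real {ω | √((1 + ε) * ∑' i, meanVar κ l n i) ≤ ‖postNoise e K Z Λ n ω‖} ≤ δ := by
  have hf := orthonormal_leftSingular hD.1 hD.2
  refine le_trans (measureReal_mono_ae ?_) (hZ.measure_tail_le hf meanVar_nonneg
    (summable_meanVar hD.4 hD.5) hM hε hpos hδ)
  filter_upwards [ae_norm_sq_postNoise hZ hD.1 hD.2 hD.3 hD.4 hD.5 hD.6] with ω hω h1
  have h1' : √((1 + ε) * ∑' i, meanVar κ l n i) ≤ ‖postNoise e K Z Λ n ω‖ := h1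
  change _ ≤ |_|
  rw [Real.sqrt_le_left (norm_nonneg _), hω] at h1'
  refine le_trans ?_ (le_abs_self _)
  linarith

omit [SecondCountableTopology H₁] [MeasurableSpace H₁] [BorelSpace H₁] in
theorem measure_postNoise_lt_le (hD : IsDiagonalModel e K κ Λ l n) (hZ : IsIsoGaussian Z P)
    (hM : ∀ i, meanVar κ l n i ≤ M) (hε : 0 < ε) (hpos : 0 < ∑' i, meanVar κ l n i)
    (hδ : varSqNormal * M ≤ δ * (ε ^ 2 * ∑' i, meanVar κ l n i)) :
    P.real {ω | ‖postNoise e K Z Λ n ω‖ < √((1 - ε) * ∑' i, meanVar κ l n i)} ≤ δ := by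
  have hf := orthonormal_leftSingular hD.1 hD.2
  refine le_trans (measureReal_mono_ae ?_) (hZ.measure_tail_le hf meanVar_nonneg
    (summable_meanVar hD.4 hD.5) hM hε hpos hδ)
  filter_upwards [ae_norm_sq_postNoise hZ hD.1 hD.2 hD.3 hD.4 hD.5 hD.6] with ω hω h1
  have h1' : ‖postNoise e K Z Λ n ω‖ < √((1 - ε) * ∑' i, meanVar κ l n i) := h1
  change _ ≤ |_|
  rw [Real.lt_sqrt (norm_nonneg _), hω] at h1'
  refine le_trans ?_ (neg_le_abs _)
  linarith

omit [SecondCountableTopology H₁] [BorelSpace H₁] in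
/-- If the bias and the typical size of the noise add up to less than the credible radius, then
the coverage is high. -/
theorem one_sub_le_coverage (hD : IsDiagonalModel e K κ Λ l n) (hZ : IsIsoGaussian Z P)
    (hM : ∀ i, meanVar κ l n i ≤ M) (hε : 0 < ε) (hpos : 0 < ∑' i, meanVar κ l n i)
    (hδ : varSqNormal * M ≤ δ * (ε ^ 2 * ∑' i, meanVar κ l n i)) {μ₀ : H₁}
    (hr : ∀ y, ‖postBias K Λ n μ₀‖ + √((1 + ε) * ∑' i, meanVar κ l n i) ≤
      credibleRadius e K Λ γ n y) : 1 - δ ≤ coverage e K Z P Λ γ n μ₀ := by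
  refine one_sub_le_measureReal (le_trans (measureReal_mono_ae ?_)
    (measure_postNoise_ge_le hD hZ hM hε hpos hδ))
  filter_upwards [ae_sub_postMean hZ hD.1 hD.2 hD.3 hD.4 hD.5 hD.6] with ω hω h1
  by_contra h2
  refine h1 ?_
  have h2' : ‖postNoise e K Z Λ n ω‖ < √((1 + ε) * ∑' i, meanVar κ l n i) := not_le.1 h2
  change μ₀ ∈ Metric.ball _ _
  rw [mem_ball_iff_norm, hω]
  exact (norm_sub_le _ _).trans_lt ((add_lt_add_right h2' _).trans_le (hr _))

omit [SecondCountableTopology H₁] [BorelSpace H₁] in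
/-- If the bias exceeds the credible radius by more than the typical size of the noise, then the
coverage is low. -/
theorem coverage_le (hD : IsDiagonalModel e K κ Λ l n) (hZ : IsIsoGaussian Z P)
    (hM : ∀ i, meanVar κ l n i ≤ M) (hε : 0 < ε) (hpos : 0 < ∑' i, meanVar κ l n i)
    (hδ : varSqNormal * M ≤ δ * (ε ^ 2 * ∑' i, meanVar κ l n i)) {μ₀ : H₁}
    (hr : ∀ y, credibleRadius e K Λ γ n y + √((1 + ε) * ∑' i, meanVar κ l n i) ≤
      ‖postBias K Λ n μ₀‖) : coverage e K Z P Λ γ n μ₀ ≤ δ := by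
  refine le_trans (measureReal_mono_ae ?_) (measure_postNoise_ge_le hD hZ hM hε hpos hδ)
  filter_upwards [ae_sub_postMean hZ hD.1 hD.2 hD.3 hD.4 hD.5 hD.6] with ω hω h1
  have h1' : μ₀ ∈ Metric.ball _ _ := h1
  rw [mem_ball_iff_norm, hω] at h1'
  change _ ≤ _
  have h2 := hr (observation K Z n μ₀ ω)
  have h3 := norm_sub_norm_le (postBias K Λ n μ₀) (postNoise e K Z Λ n ω)
  linarith

omit [SecondCountableTopology H₁] [MeasurableSpace H₁] [BorelSpace H₁] in
/-- The radius of the confidence ball is close to `(∑ᵢ tᵢ)^{1/2}`, up to the bias. -/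
theorem confidenceRadius_bounds (hD : IsDiagonalModel e K κ Λ l n) (hZ : IsIsoGaussian Z P)
    (hM : ∀ i, meanVar κ l n i ≤ M) (hε : 0 < ε) (hpos : 0 < ∑' i, meanVar κ l n i)
    (hδ : varSqNormal * M ≤ δ * (ε ^ 2 * ∑' i, meanVar κ l n i)) (hδγ : δ ≤ γ)
    (hδγ' : δ < 1 - γ) (μ₀ : H₁) :
    √((1 - ε) * ∑' i, meanVar κ l n i) - ‖postBias K Λ n μ₀‖ ≤
        confidenceRadius e K Z P Λ γ n μ₀ ∧
      confidenceRadius e K Z P Λ γ n μ₀ ≤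
        ‖postBias K Λ n μ₀‖ + √((1 + ε) * ∑' i, meanVar κ l n i) := by
  unfold confidenceRadius
  have hae := ae_sub_postMean hZ hD.1 hD.2 hD.3 hD.4 hD.5 hD.6
  set F : ℝ → ℝ := fun r => P.real
    {ω | μ₀ ∈ Metric.ball (postMean e K Λ n (observation K Z n μ₀ ω)) r} with hF
  have hmono : Monotone F := fun r r' hrr' =>
    measureReal_mono fun ω hω => Metric.ball_subset_ball hrr' hω
  have h1 : 1 - γ ≤ F (‖postBias K Λ n μ₀‖ + √((1 + ε) * ∑' i, meanVar κ l n i)) := by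
    refine le_trans (by linarith) (one_sub_le_measureReal (le_trans (measureReal_mono_ae ?_)
      (measure_postNoise_ge_le hD hZ hM hε hpos hδ)))
    filter_upwards [hae] with ω hω h1
    by_contra h2
    refine h1 ?_
    have h2' : ‖postNoise e K Z Λ n ω‖ < √((1 + ε) * ∑' i, meanVar κ l n i) := not_le.1 h2
    change μ₀ ∈ Metric.ball _ _
    rw [mem_ball_iff_norm, hω]
    exact (norm_sub_le _ _).trans_lt (add_lt_add_right h2' _)
  have h2 : F (√((1 - ε) * ∑' i, meanVar κ l n i) - ‖postBias K Λ n μ₀‖) < 1 - γ := by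
    refine lt_of_le_of_lt (le_trans (measureReal_mono_ae ?_)
      (measure_postNoise_lt_le hD hZ hM hε hpos hδ)) hδγ'
    filter_upwards [hae] with ω hω h1
    have h1' : μ₀ ∈ Metric.ball _ _ := h1
    rw [mem_ball_iff_norm, hω] at h1'
    change _ < _
    have h3 := norm_sub_norm_le (postNoise e K Z Λ n ω) (postBias K Λ n μ₀)
    rw [norm_sub_rev] at h3
    linarith
  exact ⟨le_sInf_quantile hmono h2 (by positivity) h1, sInf_quantile_le (by positivity) h1⟩

end Bounds

/-! ### Continuity of the coverage along a line of truths -/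

section Continuity

variable {H₁ H₂ Ω : Type*} [NormedAddCommGroup H₁] [InnerProductSpace ℝ H₁] [CompleteSpace H₁]
  [SecondCountableTopology H₁] [MeasurableSpace H₁] [BorelSpace H₁]
  [NormedAddCommGroup H₂] [InnerProductSpace ℝ H₂] [CompleteSpace H₂]
  {e : HilbertBasis ℕ ℝ H₁} {K : H₁ →L[ℝ] H₂} {κ : ℕ → ℝ} {Λ : H₁ →L[ℝ] H₁} {l : ℕ → ℝ} {n : ℕ}
  [MeasurableSpace Ω] {P : Measure Ω} [IsProbabilityMeasure P] {Z : H₂ → Ω → ℝ} {γ : ℝ}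

omit [CompleteSpace H₂] in
/-- Shifting one of the normal variables, a weighted sum of squares has no atoms: conditionally on
the other variables it is a nonconstant polynomial in a normal variable. -/
theorem IsIsoGaussian.measure_add_sq_eq_zero (hZ : IsIsoGaussian Z P) {f : ℕ → H₂}
    (hf : Orthonormal ℝ f) (t : ℕ → ℝ) (j : ℕ) {σ : ℝ} (hσ : σ ≠ 0) (c ρ : ℝ) :
    P {ω | ∑' i, (if i = j then 0 else t i * Z (f i) ω ^ 2) + (c - σ * Z (f j) ω) ^ 2 = ρ} = 0 := by
  classical
  let g : ℕ → H₂ := fun i => if i = j then 0 else f i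
  have hind : IndepFun (fun ω (i : ℕ) => Z (g i) ω) (fun ω (_ : Unit) => Z (f j) ω) P := by
    refine IsGaussianProcess.indepFun_of_covariance_eq_zero (X := fun i => Z (g i))
      (Y := fun _ : Unit => Z (f j)) ?_ (fun i => (hZ.measurable _).aemeasurable)
      (fun _ => (hZ.measurable _).aemeasurable) (fun i _ => ?_)
    · have : (Sum.elim (fun i => Z (g i)) fun _ : Unit => Z (f j)) =
          Z ∘ Sum.elim g fun _ : Unit => f j := by
        ext s ω
        cases s <;> rfl
      rw [this]
      exact hZ.gaussian.comp_right _
    · rw [hZ.cov]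
      by_cases hij : i = j
      · simp [g, hij]
      · simp only [g, if_neg hij]
        exact hf.2 hij
  have hφ : Measurable fun x : ℕ → ℝ => ∑' i, if i = j then 0 else t i * x i ^ 2 := by
    refine Measurable.tsum fun i => ?_
    split_ifs <;> fun_prop
  have hind' := hind.comp hφ (measurable_pi_apply ())
  have hm1 : Measurable fun ω => ∑' i, if i = j then 0 else t i * Z (g i) ω ^ 2 :=
    hφ.comp (measurable_pi_lambda _ fun i => hZ.measurable _)
  have hprod := (indepFun_iff_map_prod_eq_prod_map_map hm1.aemeasurable
    (hZ.measurable (f j)).aemeasurable).1 hind'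
  have hlaw : P.map (Z (f j)) = gaussianReal 0 1 := by
    have := (hZ.hasLaw (f j)).map_eq
    rwa [hf.1 j, one_pow, Real.toNNReal_one] at this
  have hset : MeasurableSet {p : ℝ × ℝ | p.1 + (c - σ * p.2) ^ 2 = ρ} :=
    measurableSet_eq_fun (by fun_prop) (by fun_prop)
  have heq : {ω | ∑' i, (if i = j then 0 else t i * Z (f i) ω ^ 2) + (c - σ * Z (f j) ω) ^ 2 = ρ} =
      (fun ω => (∑' i, (if i = j then 0 else t i * Z (g i) ω ^ 2), Z (f j) ω)) ⁻¹'
        {p : ℝ × ℝ | p.1 + (c - σ * p.2) ^ 2 = ρ} := by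
    ext ω
    have : ∀ i, (if i = j then 0 else t i * Z (f i) ω ^ 2) =
        (if i = j then 0 else t i * Z (g i) ω ^ 2) := fun i => by
      by_cases hij : i = j
      · simp [hij]
      · simp [g, hij]
    rw [Set.mem_ofPred_eq]
    simp only [this]
    rfl
  rw [heq, ← Measure.map_apply (hm1.prodMk (hZ.measurable _)) hset, hprod,
    Measure.measure_prod_null hset, hlaw]
  refine ae_of_all _ fun v => ?_
  have := nullSingletonClass_gaussianReal (μ := 0) (v := 1) one_ne_zero
  refine measure_mono_null (t := {(c - √(ρ - v)) / σ, (c + √(ρ - v)) / σ}) (fun x hx => ?_)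
    ((Set.toFinite _).measure_zero _)
  have hx' : v + (c - σ * x) ^ 2 = ρ := hx
  have h1 : |c - σ * x| = √(ρ - v) := by
    rw [← Real.sqrt_sq_eq_abs]
    congr 1
    linarith
  rcases abs_eq (Real.sqrt_nonneg _) |>.1 h1 with h2 | h2
  · left
    rw [eq_div_iff hσ]
    linarith
  · right
    rw [Set.mem_singleton_iff, eq_div_iff hσ]
    linarith

omit [SecondCountableTopology H₁] [MeasurableSpace H₁] [BorelSpace H₁] in
theorem norm_sq_postBias_basis_sub (hD : IsDiagonalModel e K κ Λ l n) (hZ : IsIsoGaussian Z P)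
    (j : ℕ) : ∀ᵐ ω ∂P, ∀ θ : ℝ, ‖postBias K Λ n (θ • e j) - postNoise e K Z Λ n ω‖ ^ 2 =
      ∑' i, (if i = j then 0 else meanVar κ l n i * Z (leftSingular e K κ i) ω ^ 2) +
        (θ * (1 + n * l j * κ j ^ 2)⁻¹ -
          √(meanVar κ l n j) * Z (leftSingular e K κ j) ω) ^ 2 := by
  filter_upwards [ae_inner_postNoise hZ hD.1 hD.2 hD.3 hD.4 hD.5 hD.6] with ω hω θ
  have h1 := e.hasSum_sq (postBias K Λ n (θ • e j) - postNoise e K Z Λ n ω)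
  rw [← h1.tsum_eq, h1.summable.tsum_eq_add_tsum_ite j, add_comm]
  congr 1
  · refine tsum_congr fun i => ?_
    by_cases hij : i = j
    · simp [hij]
    · rw [if_neg hij, if_neg hij, inner_sub_right, hω, postBias_smul, real_inner_smul_right,
        inner_postBias hD.1 hD.2 hD.3 hD.4 hD.6, orthonormal_iff_ite.1 e.orthonormal i j,
        if_neg hij, zero_div, mul_zero, zero_sub, neg_sq, mul_pow, Real.sq_sqrt (meanVar_nonneg i)]
  · rw [inner_sub_right, hω, postBias_smul, real_inner_smul_right,
      inner_postBias hD.1 hD.2 hD.3 hD.4 hD.6, orthonormal_iff_ite.1 e.orthonormal j j,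
      if_pos rfl, one_div]

/-- The coverage is continuous along the line spanned by `eⱼ`: the credible radius is deterministic,
and the distance of the truth to the posterior mean has no atoms. -/
theorem continuous_coverage_smul (hD : IsDiagonalModel e K κ Λ l n) (hZ : IsIsoGaussian Z P)
    {j : ℕ} (hl : 0 < l j) : Continuous fun θ : ℝ => coverage e K Z P Λ γ n (θ • e j) := by
  obtain ⟨r, hr0, hr⟩ : ∃ r, 0 ≤ r ∧ ∀ y, credibleRadius e K Λ γ n y = r :=
    ⟨credibleRadius e K Λ γ n 0, credibleRadius_nonneg _, fun y => by
      rw [credibleRadius_eq hD hZ, credibleRadius_eq hD hZ]⟩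
  have hcov : ∀ θ : ℝ, coverage e K Z P Λ γ n (θ • e j) =
      P.real {ω | ‖postBias K Λ n (θ • e j) - postNoise e K Z Λ n ω‖ < r} := fun θ => by
    refine measureReal_congr ?_
    filter_upwards [ae_sub_postMean hZ hD.1 hD.2 hD.3 hD.4 hD.5 hD.6] with ω hω
    refine propext ?_
    change θ • e j ∈ Metric.ball _ _ ↔ ‖_‖ < r
    rw [mem_ball_iff_norm, hω, hr]
  simp only [hcov]
  have hmeas : ∀ θ : ℝ,
      MeasurableSet {ω | ‖postBias K Λ n (θ • e j) - postNoise e K Z Λ n ω‖ < r} := fun θ =>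
    measurableSet_lt ((measurable_postNoise hZ).const_sub _).norm measurable_const
  rw [continuous_iff_continuousAt]
  intro θ
  refine (ENNReal.tendsto_toReal (measure_ne_top _ _)).comp
    (tendsto_measure_of_ae_tendsto_indicator_of_isFiniteMeasure _ (hmeas θ) hmeas ?_)
  have hσ : √(meanVar κ l n j) ≠ 0 := by
    have h1 := hD.2 j
    have h2 : (0 : ℝ) < n := Nat.cast_pos.2 hD.6
    have h3 : 0 < meanVar κ l n j := by unfold meanVar; positivity
    exact (Real.sqrt_pos.2 h3).ne'
  have hnull := hZ.measure_add_sq_eq_zero (orthonormal_leftSingular hD.1 hD.2) (meanVar κ l n) j hσ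
    (θ * (1 + n * l j * κ j ^ 2)⁻¹) (r ^ 2)
  filter_upwards [norm_sq_postBias_basis_sub hD hZ j, measure_eq_zero_iff_ae_notMem.1 hnull]
    with ω h1 h2
  have h3 : ‖postBias K Λ n (θ • e j) - postNoise e K Z Λ n ω‖ ≠ r := by
    intro h
    refine h2 ?_
    rw [← h1 θ, h]
  have hcont : Continuous fun θ : ℝ => ‖postBias K Λ n (θ • e j) - postNoise e K Z Λ n ω‖ := by
    simp only [postBias_smul]
    fun_prop
  rcases lt_or_gt_of_ne h3 with h4 | h4
  · filter_upwards [hcont.continuousAt.eventually_lt continuousAt_const h4] with θ' h5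
    exact ⟨fun _ => h4, fun _ => h5⟩
  · filter_upwards [continuousAt_const.eventually_lt hcont.continuousAt h4] with θ' h5
    exact ⟨fun h => absurd h (not_lt.2 h5.le), fun h => absurd h (not_lt.2 h4.le)⟩

end Continuity

/-! ### Polynomially decaying eigenvalues -/

section Polynomial

/-- The eigenvalues `lᵢ = τ² i^{-1-2α}` and `κᵢ ≍ i^{-p}` at a positive sample size `n`. The number
`N ≥ 1` with `N^{1+2α+2p} = n τ²` is the index at which `n lᵢ κᵢ²` passes through the order of
magnitude `1`. The natural number `i` stands for the index `i + 1`. -/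
structure IsPolynomialModel (α p C τ N : ℝ) (κ l : ℕ → ℝ) (n : ℕ) : Prop where
  α_pos : 0 < α
  p_nonneg : 0 ≤ p
  one_le_C : 1 ≤ C
  τ_pos : 0 < τ
  one_le_N : 1 ≤ N
  n_pos : 0 < n
  N_rpow : N ^ (1 + 2 * α + 2 * p) = n * τ ^ 2
  prior : ∀ i : ℕ, l i = τ ^ 2 * ((i : ℝ) + 1) ^ (-1 - 2 * α)
  singular : ∀ i : ℕ, C⁻¹ * ((i : ℝ) + 1) ^ (-p) ≤ κ i ∧ κ i ≤ C * ((i : ℝ) + 1) ^ (-p)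

variable {α p C τ N : ℝ} {κ l : ℕ → ℝ} {n : ℕ}

theorem summable_add_one_rpow {s : ℝ} (hs : s < -1) : Summable fun i : ℕ => ((i : ℝ) + 1) ^ s := by
  have h := (summable_nat_add_iff 1).2 (Real.summable_nat_rpow.2 hs)
  simpa using h

/-- The tail sums of `i^{-1-2α}` are at most `m^{-2α} / (2α)`: the summands are bounded by the
increments of `-i^{-2α} / (2α)`. -/
theorem tsum_rpow_tail_le (hα : 0 < α) {m : ℕ} (hm : 0 < m) :
    ∑' i : ℕ, (((i + m : ℕ) : ℝ) + 1) ^ (-1 - 2 * α) ≤ (m : ℝ) ^ (-(2 * α)) / (2 * α) := by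
  have hstep : ∀ k : ℕ, 0 < k →
      ((k : ℝ) + 1) ^ (-1 - 2 * α) ≤
        (k : ℝ) ^ (-(2 * α)) / (2 * α) - ((k : ℝ) + 1) ^ (-(2 * α)) / (2 * α) := by
    intro k hk
    have hk' : (0 : ℝ) < k := Nat.cast_pos.2 hk
    have h1 : (0 : ℝ) < (k : ℝ) + 1 := by positivity
    have h2 : ((k : ℝ) + 1) ^ (-1 - 2 * α) = ((k : ℝ) + 1) ^ (-(2 * α)) * ((k : ℝ) + 1)⁻¹ := by
      rw [← Real.rpow_neg_one, ← Real.rpow_add h1]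
      congr 1
      ring
    have h3 : (k : ℝ) ^ (-(2 * α)) =
        ((k : ℝ) + 1) ^ (-(2 * α)) * ((k : ℝ) / (k + 1)) ^ (-(2 * α)) := by
      rw [← Real.mul_rpow h1.le (by positivity)]
      congr 1
      field_simp
    have h4 : 1 + 2 * α * ((k : ℝ) + 1)⁻¹ ≤ ((k : ℝ) / (k + 1)) ^ (-(2 * α)) := by
      rw [Real.rpow_def_of_pos (by positivity)]
      have h5 : Real.log ((k : ℝ) / (k + 1)) ≤ -((k : ℝ) + 1)⁻¹ := by
        refine (Real.log_le_sub_one_of_pos (by positivity)).trans (le_of_eq ?_)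
        field_simp
        ring
      have h6 := Real.add_one_le_exp (Real.log ((k : ℝ) / (k + 1)) * -(2 * α))
      nlinarith
    have h7 : (0 : ℝ) < ((k : ℝ) + 1) ^ (-(2 * α)) := Real.rpow_pos_of_pos h1 _
    rw [h2, h3, ← sub_div, le_div_iff₀ (by positivity)]
    nlinarith [mul_le_mul_of_nonneg_left h4 h7.le]
  have hsum : Summable fun i : ℕ => (((i + m : ℕ) : ℝ) + 1) ^ (-1 - 2 * α) :=
    (summable_nat_add_iff m).2 (summable_add_one_rpow (by linarith))
  refine hsum.tsum_le_of_sum_range_le fun k => ?_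
  have h1 : ∑ i ∈ Finset.range k, (((i + m : ℕ) : ℝ) + 1) ^ (-1 - 2 * α) ≤
      ∑ i ∈ Finset.range k, (((i + m : ℕ) : ℝ) ^ (-(2 * α)) / (2 * α) -
        ((i + 1 + m : ℕ) : ℝ) ^ (-(2 * α)) / (2 * α)) := by
    refine Finset.sum_le_sum fun i _ => ?_
    have hcast : ((i + 1 + m : ℕ) : ℝ) = ((i + m : ℕ) : ℝ) + 1 := by
      push_cast
      ring
    rw [hcast]
    exact hstep (i + m) (by omega)
  refine h1.trans ?_
  rw [Finset.sum_range_sub' fun i : ℕ => ((i + m : ℕ) : ℝ) ^ (-(2 * α)) / (2 * α), zero_add]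
  have : (0 : ℝ) ≤ ((k + m : ℕ) : ℝ) ^ (-(2 * α)) / (2 * α) := by positivity
  linarith

namespace IsPolynomialModel

theorem prior_pos (h : IsPolynomialModel α p C τ N κ l n) (i : ℕ) : 0 < l i := by
  have := h.τ_pos
  rw [h.prior]
  positivity

theorem summable_prior (h : IsPolynomialModel α p C τ N κ l n) : Summable l := by
  have h1 := (summable_add_one_rpow (s := -1 - 2 * α) (by linarith [h.α_pos])).mul_left (τ ^ 2)
  exact h1.congr fun i => (h.prior i).symm

theorem singular_pos (h : IsPolynomialModel α p C τ N κ l n) (i : ℕ) : 0 < κ i := by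
  have := h.one_le_C
  exact lt_of_lt_of_le (by positivity) (h.singular i).1

theorem N_pos (h : IsPolynomialModel α p C τ N κ l n) : 0 < N := one_pos.trans_le h.one_le_N

theorem ratio_eq (h : IsPolynomialModel α p C τ N κ l n) (i : ℕ) :
    n * l i * (((i : ℝ) + 1) ^ (-p)) ^ 2 = (N / ((i : ℝ) + 1)) ^ (1 + 2 * α + 2 * p) := by
  have hx : (0 : ℝ) < (i : ℝ) + 1 := by positivity
  have hsq : (((i : ℝ) + 1) ^ (-p)) ^ 2 = ((i : ℝ) + 1) ^ (-p * (2 : ℕ)) := by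
    rw [← Real.rpow_natCast, ← Real.rpow_mul hx.le]
  rw [h.prior, Real.div_rpow h.N_pos.le hx.le, h.N_rpow, hsq, div_eq_mul_inv,
    ← Real.rpow_neg hx.le]
  have : ((i : ℝ) + 1) ^ (-(1 + 2 * α + 2 * p)) =
      ((i : ℝ) + 1) ^ (-1 - 2 * α) * ((i : ℝ) + 1) ^ (-p * (2 : ℕ)) := by
    rw [← Real.rpow_add hx]
    congr 1
    push_cast
    ring
  rw [this]
  ring

theorem le_ratio (h : IsPolynomialModel α p C τ N κ l n) (i : ℕ) :
    (C ^ 2)⁻¹ * (N / ((i : ℝ) + 1)) ^ (1 + 2 * α + 2 * p) ≤ n * l i * κ i ^ 2 := by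
  have hC := h.one_le_C
  have hl := h.prior_pos i
  rw [← h.ratio_eq]
  calc (C ^ 2)⁻¹ * (n * l i * (((i : ℝ) + 1) ^ (-p)) ^ 2)
      = n * l i * (C⁻¹ * ((i : ℝ) + 1) ^ (-p)) ^ 2 := by
        rw [mul_pow, inv_pow]
        ring
    _ ≤ n * l i * κ i ^ 2 := by
        refine mul_le_mul_of_nonneg_left ?_ (by positivity)
        exact pow_le_pow_left₀ (by positivity) (h.singular i).1 2

theorem ratio_le (h : IsPolynomialModel α p C τ N κ l n) (i : ℕ) :
    n * l i * κ i ^ 2 ≤ C ^ 2 * (N / ((i : ℝ) + 1)) ^ (1 + 2 * α + 2 * p) := by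
  have hl := h.prior_pos i
  rw [← h.ratio_eq]
  calc n * l i * κ i ^ 2 ≤ n * l i * (C * ((i : ℝ) + 1) ^ (-p)) ^ 2 := by
        refine mul_le_mul_of_nonneg_left ?_ (by positivity)
        exact pow_le_pow_left₀ (h.singular_pos i).le (h.singular i).2 2
    _ = C ^ 2 * (n * l i * (((i : ℝ) + 1) ^ (-p)) ^ 2) := by ring

/-- The factor `(1 + n lᵢ κᵢ²)⁻¹` by which the `i`th coordinate is biased. -/
theorem inv_one_add_le (h : IsPolynomialModel α p C τ N κ l n) (i : ℕ) :
    (1 + n * l i * κ i ^ 2)⁻¹ ≤ C ^ 2 * (((i : ℝ) + 1) / N) ^ (1 + 2 * α + 2 * p) := by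
  have hC := h.one_le_C
  have hN := h.N_pos
  have h1 := h.le_ratio i
  have h2 : 0 < (C ^ 2)⁻¹ * (N / ((i : ℝ) + 1)) ^ (1 + 2 * α + 2 * p) := by positivity
  calc (1 + n * l i * κ i ^ 2)⁻¹
      ≤ ((C ^ 2)⁻¹ * (N / ((i : ℝ) + 1)) ^ (1 + 2 * α + 2 * p))⁻¹ :=
        inv_anti₀ h2 (by linarith)
    _ = C ^ 2 * (((i : ℝ) + 1) / N) ^ (1 + 2 * α + 2 * p) := by
        rw [mul_inv, inv_inv, ← Real.inv_rpow (by positivity), inv_div]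

theorem inv_one_add_le_one (h : IsPolynomialModel α p C τ N κ l n) (i : ℕ) :
    (1 + n * l i * κ i ^ 2)⁻¹ ≤ 1 := by
  have hl := h.prior_pos i
  have : 0 ≤ n * l i * κ i ^ 2 := by positivity
  exact inv_le_one_of_one_le₀ (by linarith)

theorem postVar_le_div (h : IsPolynomialModel α p C τ N κ l n) (i : ℕ) :
    postVar κ l n i ≤ C ^ 2 * (τ ^ 2 * N ^ (-(2 * α))) / N := by
  have hC := h.one_le_C
  have hτ := h.τ_pos
  have hN := h.N_pos
  have hα := h.α_pos
  have hp := h.p_nonneg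
  have hx : (0 : ℝ) < (i : ℝ) + 1 := by positivity
  have h1 : C ^ 2 * (τ ^ 2 * N ^ (-(2 * α))) / N = C ^ 2 * (τ ^ 2 * N ^ (-1 - 2 * α)) := by
    rw [show -1 - 2 * α = -(2 * α) + -1 by ring, Real.rpow_add hN, Real.rpow_neg_one]
    ring
  rw [h1]
  rcases le_or_gt N ((i : ℝ) + 1) with hle | hlt
  · refine (postVar_le (fun i => (h.prior_pos i).le) i).trans ?_
    rw [h.prior]
    have h2 : ((i : ℝ) + 1) ^ (-1 - 2 * α) ≤ N ^ (-1 - 2 * α) :=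
      Real.rpow_le_rpow_of_nonpos hN hle (by linarith)
    have h3 : τ ^ 2 * ((i : ℝ) + 1) ^ (-1 - 2 * α) ≤ τ ^ 2 * N ^ (-1 - 2 * α) :=
      mul_le_mul_of_nonneg_left h2 (by positivity)
    have h4 : 0 ≤ τ ^ 2 * N ^ (-1 - 2 * α) := by positivity
    nlinarith [one_le_pow₀ hC (n := 2)]
  · rw [postVar, div_eq_mul_inv]
    calc l i * (1 + n * l i * κ i ^ 2)⁻¹
        ≤ l i * (C ^ 2 * (((i : ℝ) + 1) / N) ^ (1 + 2 * α + 2 * p)) :=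
          mul_le_mul_of_nonneg_left (h.inv_one_add_le i) (h.prior_pos i).le
      _ = C ^ 2 * (τ ^ 2 * (((i : ℝ) + 1) ^ (2 * p) * N ^ (-(1 + 2 * α + 2 * p)))) := by
          have h2 : ((i : ℝ) + 1) ^ (2 * p) =
              ((i : ℝ) + 1) ^ (-1 - 2 * α) * ((i : ℝ) + 1) ^ (1 + 2 * α + 2 * p) := by
            rw [← Real.rpow_add hx]
            congr 1
            ring
          rw [h.prior, Real.div_rpow hx.le hN.le, Real.rpow_neg hN.le, h2]
          ring
      _ ≤ C ^ 2 * (τ ^ 2 * (N ^ (2 * p) * N ^ (-(1 + 2 * α + 2 * p)))) := by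
          gcongr
      _ = C ^ 2 * (τ ^ 2 * N ^ (-1 - 2 * α)) := by
          rw [← Real.rpow_add hN]
          congr 3
          ring

theorem ceil_le (h : IsPolynomialModel α p C τ N κ l n) : (⌈N⌉₊ : ℝ) ≤ 2 * N := by
  have h1 := (Nat.ceil_lt_add_one h.N_pos.le).le
  linarith [h.one_le_N]

theorem tsum_postVar_le (h : IsPolynomialModel α p C τ N κ l n) :
    ∑' i, postVar κ l n i ≤ (2 * C ^ 2 + (2 * α)⁻¹) * (τ ^ 2 * N ^ (-(2 * α))) := by
  have hC := h.one_le_C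
  have hτ := h.τ_pos
  have hN := h.N_pos
  have hα := h.α_pos
  have hl := fun i => (h.prior_pos i).le
  have hs := summable_postVar (κ := κ) (n := n) hl h.summable_prior
  have hm : 0 < ⌈N⌉₊ := Nat.ceil_pos.2 hN
  rw [← hs.sum_add_tsum_nat_add ⌈N⌉₊, add_mul]
  refine add_le_add ?_ ?_
  · calc ∑ i ∈ Finset.range ⌈N⌉₊, postVar κ l n i
        ≤ ∑ i ∈ Finset.range ⌈N⌉₊, C ^ 2 * (τ ^ 2 * N ^ (-(2 * α))) / N :=
          Finset.sum_le_sum fun i _ => h.postVar_le_div i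
      _ = ⌈N⌉₊ * (C ^ 2 * (τ ^ 2 * N ^ (-(2 * α))) / N) := by
          rw [Finset.sum_const, Finset.card_range, nsmul_eq_mul]
      _ ≤ 2 * N * (C ^ 2 * (τ ^ 2 * N ^ (-(2 * α))) / N) := by
          have := h.ceil_le
          gcongr
      _ = 2 * C ^ 2 * (τ ^ 2 * N ^ (-(2 * α))) := by
          field_simp
  · have h1 : ∑' i, postVar κ l n (i + ⌈N⌉₊) ≤
        ∑' i : ℕ, τ ^ 2 * (((i + ⌈N⌉₊ : ℕ) : ℝ) + 1) ^ (-1 - 2 * α) := by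
      refine Summable.tsum_le_tsum (fun i => ?_) ((summable_nat_add_iff _).2 hs) ?_
      · rw [← h.prior]
        exact postVar_le hl _
      · exact ((summable_nat_add_iff ⌈N⌉₊).2 (summable_add_one_rpow (by linarith))).mul_left _
    refine h1.trans ?_
    rw [tsum_mul_left]
    have h2 := tsum_rpow_tail_le hα hm
    have h3 : (⌈N⌉₊ : ℝ) ^ (-(2 * α)) ≤ N ^ (-(2 * α)) :=
      Real.rpow_le_rpow_of_nonpos hN (Nat.le_ceil N) (by linarith)
    calc τ ^ 2 * ∑' i : ℕ, (((i + ⌈N⌉₊ : ℕ) : ℝ) + 1) ^ (-1 - 2 * α)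
        ≤ τ ^ 2 * ((⌈N⌉₊ : ℝ) ^ (-(2 * α)) / (2 * α)) := by gcongr
      _ ≤ τ ^ 2 * (N ^ (-(2 * α)) / (2 * α)) := by gcongr
      _ = (2 * α)⁻¹ * (τ ^ 2 * N ^ (-(2 * α))) := by ring

/-- On the block `N ≤ i < 2N` (up to rounding) the indices are comparable with `N`. -/
theorem block_bounds (h : IsPolynomialModel α p C τ N κ l n) {i : ℕ} (h1 : ⌈N⌉₊ ≤ i)
    (h2 : i < 2 * ⌈N⌉₊) : N ≤ (i : ℝ) + 1 ∧ (i : ℝ) + 1 ≤ 4 * N := by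
  have h3 : (⌈N⌉₊ : ℝ) ≤ i := Nat.cast_le.2 h1
  have h4 : (i : ℝ) + 1 ≤ 2 * ⌈N⌉₊ := by exact_mod_cast h2
  have h5 := Nat.le_ceil N
  have h6 := h.ceil_le
  constructor <;> linarith

theorem ratio_le_of_le (h : IsPolynomialModel α p C τ N κ l n) {i : ℕ}
    (hi : N ≤ (i : ℝ) + 1) : n * l i * κ i ^ 2 ≤ C ^ 2 := by
  have hN := h.N_pos
  have hα := h.α_pos
  have hp := h.p_nonneg
  refine (h.ratio_le i).trans (mul_le_of_le_one_right (by positivity) ?_)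
  refine Real.rpow_le_one (by positivity) ?_ (by linarith)
  rw [div_le_one (by positivity)]
  exact hi

/-- Of a series of nonnegative terms that are at least `k i^s` for `i` of the order `N`, the terms
of that order alone contribute a multiple of `k N^{1+s}`. -/
theorem block_le_tsum (h : IsPolynomialModel α p C τ N κ l n) {b : ℕ → ℝ} (hb : ∀ i, 0 ≤ b i)
    (hsum : Summable b) {k s : ℝ} (hk : 0 ≤ k) (hs : s ≤ 0)
    (hle : ∀ i : ℕ, N ≤ (i : ℝ) + 1 → (i : ℝ) + 1 ≤ 4 * N → k * ((i : ℝ) + 1) ^ s ≤ b i) :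
    k * (4 : ℝ) ^ s * N ^ (1 + s) ≤ ∑' i, b i := by
  have hN := h.N_pos
  calc k * (4 : ℝ) ^ s * N ^ (1 + s) = N * (k * (4 * N) ^ s) := by
        rw [Real.mul_rpow (by norm_num) hN.le, Real.rpow_add hN, Real.rpow_one]
        ring
    _ ≤ ⌈N⌉₊ * (k * (4 * N) ^ s) := by
        have := Nat.le_ceil N
        gcongr
    _ = ∑ i ∈ Finset.Ico ⌈N⌉₊ (2 * ⌈N⌉₊), k * (4 * N) ^ s := by
        rw [Finset.sum_const, Nat.card_Ico, nsmul_eq_mul, two_mul, Nat.add_sub_cancel]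
    _ ≤ ∑ i ∈ Finset.Ico ⌈N⌉₊ (2 * ⌈N⌉₊), b i := by
        refine Finset.sum_le_sum fun i hi => ?_
        obtain ⟨h1, h2⟩ := Finset.mem_Ico.1 hi
        obtain ⟨h3, h4⟩ := h.block_bounds h1 h2
        refine le_trans ?_ (hle i h3 h4)
        exact mul_le_mul_of_nonneg_left (Real.rpow_le_rpow_of_nonpos (by positivity) h4 hs) hk
    _ ≤ ∑' i, b i := hsum.sum_le_tsum _ fun i _ => hb i

end IsPolynomialModel

end Polynomial

namespace IsPolynomialModel

variable {α p C τ N : ℝ} {κ l : ℕ → ℝ} {n : ℕ}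

theorem block_const_pos (hC : 1 ≤ C) :
    0 < (C ^ 2)⁻¹ * (4 : ℝ) ^ (-(1 + 2 * α + 2 * p)) / (1 + C ^ 2) ^ 2 *
      (4 : ℝ) ^ (-1 - 2 * α) := by
  positivity

theorem block_prior_le_tsum (h : IsPolynomialModel α p C τ N κ l n) {b : ℕ → ℝ} (hb : ∀ i, 0 ≤ b i)
    (hsum : Summable b) {k : ℝ} (hk : 0 ≤ k)
    (hle : ∀ i : ℕ, N ≤ (i : ℝ) + 1 → (i : ℝ) + 1 ≤ 4 * N → k * l i ≤ b i) :
    k * (4 : ℝ) ^ (-1 - 2 * α) * (τ ^ 2 * N ^ (-(2 * α))) ≤ ∑' i, b i := by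
  have hα := h.α_pos
  have h1 := h.block_le_tsum hb hsum (k := k * τ ^ 2) (s := -1 - 2 * α) (by positivity)
    (by linarith) fun i h1 h2 => by
      rw [mul_assoc, ← h.prior]
      exact hle i h1 h2
  rw [show 1 + (-1 - 2 * α) = -(2 * α) by ring] at h1
  linarith

theorem le_ratio_of_le (h : IsPolynomialModel α p C τ N κ l n) {i : ℕ}
    (hi : (i : ℝ) + 1 ≤ 4 * N) :
    (C ^ 2)⁻¹ * (4 : ℝ) ^ (-(1 + 2 * α + 2 * p)) ≤ n * l i * κ i ^ 2 := by
  have hC := h.one_le_C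
  have hN := h.N_pos
  have hα := h.α_pos
  have hp := h.p_nonneg
  refine le_trans ?_ (h.le_ratio i)
  refine mul_le_mul_of_nonneg_left ?_ (by positivity)
  rw [Real.rpow_neg (by norm_num), ← Real.inv_rpow (by norm_num)]
  refine Real.rpow_le_rpow (by norm_num) ?_ (by linarith)
  rw [le_div_iff₀ (by positivity)]
  linarith

theorem le_tsum_meanVar (h : IsPolynomialModel α p C τ N κ l n) :
    (C ^ 2)⁻¹ * (4 : ℝ) ^ (-(1 + 2 * α + 2 * p)) / (1 + C ^ 2) ^ 2 * (4 : ℝ) ^ (-1 - 2 * α) *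
      (τ ^ 2 * N ^ (-(2 * α))) ≤ ∑' i, meanVar κ l n i := by
  have hC := h.one_le_C
  have hl := fun i => (h.prior_pos i).le
  refine h.block_prior_le_tsum meanVar_nonneg (summable_meanVar hl h.summable_prior)
    (by positivity) fun i h1 h2 => ?_
  have h3 := h.ratio_le_of_le h1
  have h4 := h.le_ratio_of_le h2
  have hw := one_add_pos (κ := κ) (n := n) hl i
  have hli := hl i
  calc (C ^ 2)⁻¹ * (4 : ℝ) ^ (-(1 + 2 * α + 2 * p)) / (1 + C ^ 2) ^ 2 * l i
      ≤ n * l i * κ i ^ 2 / (1 + n * l i * κ i ^ 2) ^ 2 * l i := by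
        gcongr
    _ = meanVar κ l n i := by
        rw [meanVar]
        ring

theorem le_tsum_postVar_sub (h : IsPolynomialModel α p C τ N κ l n) :
    (C ^ 2)⁻¹ * (4 : ℝ) ^ (-(1 + 2 * α + 2 * p)) / (1 + C ^ 2) ^ 2 * (4 : ℝ) ^ (-1 - 2 * α) *
      (τ ^ 2 * N ^ (-(2 * α))) ≤ ∑' i, postVar κ l n i - ∑' i, meanVar κ l n i := by
  have hC := h.one_le_C
  have hα := h.α_pos
  have hp := h.p_nonneg
  have hl := fun i => (h.prior_pos i).le
  have hs := summable_postVar (κ := κ) (n := n) hl h.summable_prior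
  have ht := summable_meanVar (κ := κ) (n := n) hl h.summable_prior
  rw [← hs.tsum_sub ht]
  refine h.block_prior_le_tsum (fun i => sub_nonneg.2 (meanVar_le_postVar hl i)) (hs.sub ht)
    (by positivity) fun i h1 h2 => ?_
  have h3 := h.ratio_le_of_le h1
  have hw := one_add_pos (κ := κ) (n := n) hl i
  have hli := hl i
  have h5 : (C ^ 2)⁻¹ * (4 : ℝ) ^ (-(1 + 2 * α + 2 * p)) ≤ 1 := by
    refine mul_le_one₀ (inv_le_one_of_one_le₀ (one_le_pow₀ hC)) (by positivity) ?_
    exact Real.rpow_le_one_of_one_le_of_nonpos (by norm_num) (by linarith)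
  rw [postVar_sub_meanVar hl]
  calc (C ^ 2)⁻¹ * (4 : ℝ) ^ (-(1 + 2 * α + 2 * p)) / (1 + C ^ 2) ^ 2 * l i
      ≤ 1 / (1 + n * l i * κ i ^ 2) ^ 2 * l i := by
        gcongr
    _ = postVar κ l n i / (1 + n * l i * κ i ^ 2) := by
        rw [postVar]
        field_simp

/-- The squared bias factor in terms of the Sobolev weight `i^{2β}`. The exponent of `N` cannot
exceed `2 (1 + 2α + 2p)`, whatever the smoothness `β` (saturation). -/
theorem inv_one_add_sq_le (h : IsPolynomialModel α p C τ N κ l n) {β β' : ℝ} (hβ' : 0 ≤ β')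
    (h1 : β' ≤ β) (h2 : β' ≤ 1 + 2 * α + 2 * p) (i : ℕ) :
    (1 + n * l i * κ i ^ 2)⁻¹ ^ 2 ≤ C ^ 4 * N ^ (-(2 * β')) * ((i : ℝ) + 1) ^ (2 * β) := by
  have hC := h.one_le_C
  have hN := h.N_pos
  have hx : (1 : ℝ) ≤ (i : ℝ) + 1 := by linarith [Nat.cast_nonneg (α := ℝ) i]
  have hx0 : (0 : ℝ) < (i : ℝ) + 1 := by positivity
  have hl := fun i => (h.prior_pos i).le
  have hw := one_add_pos (κ := κ) (n := n) hl i
  have hbase : (1 + n * l i * κ i ^ 2)⁻¹ ≤ C ^ 2 * (((i : ℝ) + 1) / N) ^ β' := by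
    rcases le_or_gt N ((i : ℝ) + 1) with hle | hlt
    · refine (h.inv_one_add_le_one i).trans ?_
      refine one_le_mul_of_one_le_of_one_le (one_le_pow₀ hC) ?_
      exact Real.one_le_rpow ((one_le_div hN).2 hle) hβ'
    · refine (h.inv_one_add_le i).trans ?_
      refine mul_le_mul_of_nonneg_left ?_ (by positivity)
      exact Real.rpow_le_rpow_of_exponent_ge (by positivity) ((div_le_one hN).2 hlt.le) h2
  calc (1 + n * l i * κ i ^ 2)⁻¹ ^ 2 ≤ (C ^ 2 * (((i : ℝ) + 1) / N) ^ β') ^ 2 :=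
        pow_le_pow_left₀ (by positivity) hbase 2
    _ = C ^ 4 * N ^ (-(2 * β')) * ((i : ℝ) + 1) ^ (2 * β') := by
        rw [mul_pow, ← Real.rpow_natCast _ 2, ← Real.rpow_natCast (_ ^ β') 2,
          ← Real.rpow_mul (by positivity), Real.div_rpow hx0.le hN.le, Real.rpow_neg hN.le]
        push_cast
        rw [mul_comm β' 2, Real.rpow_two]
        ring
    _ ≤ C ^ 4 * N ^ (-(2 * β')) * ((i : ℝ) + 1) ^ (2 * β) := by
        refine mul_le_mul_of_nonneg_left ?_ (by positivity)
        exact Real.rpow_le_rpow_of_exponent_le hx (by linarith)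

/-- A coordinate along which a truth of unit Sobolev norm has a bias of maximal order: the
coordinate `N` in general, and the first coordinate in the saturated case. -/
theorem exists_le_bias (h : IsPolynomialModel α p C τ N κ l n) {β β' : ℝ} (hβ : 0 < β)
    (hβ' : β' = min β (1 + 2 * α + 2 * p)) :
    ∃ j : ℕ, ((3 : ℝ) ^ (-β) * (1 + C ^ 2)⁻¹) ^ 2 * N ^ (-(2 * β')) ≤
      (((j : ℝ) + 1) ^ (-β) * (1 + n * l j * κ j ^ 2)⁻¹) ^ 2 := by
  have hC := h.one_le_C
  have hN := h.N_pos
  have hα := h.α_pos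
  have hp := h.p_nonneg
  have hl := fun i => (h.prior_pos i).le
  have hsq : ∀ s : ℝ, N ^ (-(2 * s)) = (N ^ (-s)) ^ 2 := fun s => by
    rw [← Real.rpow_natCast, ← Real.rpow_mul hN.le]
    congr 1
    push_cast
    ring
  rw [hsq, ← mul_pow]
  rcases le_total β (1 + 2 * α + 2 * p) with hle | hle
  · rw [min_eq_left hle] at hβ'
    subst hβ'
    refine ⟨⌈N⌉₊, pow_le_pow_left₀ (by positivity) ?_ 2⟩
    have hw := one_add_pos (κ := κ) (n := n) hl ⌈N⌉₊
    have h1 : (⌈N⌉₊ : ℝ) + 1 ≤ 3 * N := by linarith [h.ceil_le, h.one_le_N]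
    have h2 : N ≤ (⌈N⌉₊ : ℝ) + 1 := by linarith [Nat.le_ceil N]
    have h3 := h.ratio_le_of_le h2
    calc (3 : ℝ) ^ (-β') * (1 + C ^ 2)⁻¹ * N ^ (-β')
        = (3 * N) ^ (-β') * (1 + C ^ 2)⁻¹ := by
          rw [Real.mul_rpow (by norm_num) hN.le]
          ring
      _ ≤ ((⌈N⌉₊ : ℝ) + 1) ^ (-β') * (1 + n * l ⌈N⌉₊ * κ ⌈N⌉₊ ^ 2)⁻¹ := by
          refine mul_le_mul ?_ ?_ (by positivity) (by positivity)
          · exact Real.rpow_le_rpow_of_nonpos (by positivity) h1 (by linarith)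
          · exact inv_anti₀ hw (by linarith)
  · rw [min_eq_right hle] at hβ'
    refine ⟨0, pow_le_pow_left₀ (by positivity) ?_ 2⟩
    have hw := one_add_pos (κ := κ) (n := n) hl 0
    have h1 := h.ratio_le 0
    have h2 : 1 ≤ N ^ β' := Real.one_le_rpow h.one_le_N (by rw [hβ']; linarith)
    rw [Nat.cast_zero, zero_add, div_one, ← hβ'] at h1
    have h3 : 1 + n * l 0 * κ 0 ^ 2 ≤ (1 + C ^ 2) * N ^ β' := by nlinarith
    have h4 : (3 : ℝ) ^ (-β) ≤ 1 :=
      Real.rpow_le_one_of_one_le_of_nonpos (by norm_num) (by linarith)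
    calc (3 : ℝ) ^ (-β) * (1 + C ^ 2)⁻¹ * N ^ (-β')
        ≤ 1 * (1 + C ^ 2)⁻¹ * N ^ (-β') := by gcongr
      _ = ((1 + C ^ 2) * N ^ β')⁻¹ := by
          rw [one_mul, mul_inv, Real.rpow_neg hN.le]
      _ ≤ (1 + n * l 0 * κ 0 ^ 2)⁻¹ := inv_anti₀ hw h3
      _ = ((0 : ℕ) + 1 : ℝ) ^ (-β) * (1 + n * l 0 * κ 0 ^ 2)⁻¹ := by
          rw [Nat.cast_zero, zero_add, Real.one_rpow, one_mul]

end IsPolynomialModel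

/-! ### Sobolev norms -/

section SobolevNorm

variable {H : Type*} [NormedAddCommGroup H] [InnerProductSpace ℝ H] {e : HilbertBasis ℕ ℝ H}
  {β : ℝ} {μ : H}

theorem sobolevNorm_lt_top_iff :
    sobolevNorm e β μ < ∞ ↔ Summable fun i : ℕ => ⟪e i, μ⟫ ^ 2 * ((i : ℝ) + 1) ^ (2 * β) := by
  unfold sobolevNorm
  have hnn : ∀ i : ℕ, 0 ≤ ⟪e i, μ⟫ ^ 2 * ((i : ℝ) + 1) ^ (2 * β) := fun i => by positivity
  rw [ENNReal.rpow_lt_top_iff_of_pos (by norm_num), lt_top_iff_ne_top]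
  refine ⟨fun h => ?_, fun h => h.tsum_ofReal_ne_top⟩
  have := ENNReal.summable_toReal h
  simpa only [ENNReal.toReal_ofReal (hnn _)] using this

theorem tsum_le_of_sobolevNorm_le {R : ℝ≥0} (h : sobolevNorm e β μ ≤ R) :
    ∑' i : ℕ, ⟪e i, μ⟫ ^ 2 * ((i : ℝ) + 1) ^ (2 * β) ≤ (R : ℝ) ^ 2 := by
  have hnn : ∀ i : ℕ, 0 ≤ ⟪e i, μ⟫ ^ 2 * ((i : ℝ) + 1) ^ (2 * β) := fun i => by positivity
  have hs := sobolevNorm_lt_top_iff.1 (h.trans_lt ENNReal.coe_lt_top)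
  unfold sobolevNorm at h
  rw [← ENNReal.ofReal_tsum_of_nonneg hnn hs, one_div, ENNReal.rpow_inv_le_iff (by norm_num)] at h
  have h1 : ((R : ℝ≥0∞)) ^ (2 : ℝ) = ENNReal.ofReal ((R : ℝ) ^ 2) := by
    rw [ENNReal.rpow_two, ENNReal.ofReal_pow (NNReal.coe_nonneg R), ENNReal.ofReal_coe_nnreal]
  rw [h1, ENNReal.ofReal_le_ofReal_iff (by positivity)] at h
  exact h

theorem sobolevNorm_smul_basis (e : HilbertBasis ℕ ℝ H) (β θ : ℝ) (j : ℕ) :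
    sobolevNorm e β (θ • e j) = ENNReal.ofReal (|θ| * ((j : ℝ) + 1) ^ β) := by
  unfold sobolevNorm
  rw [tsum_eq_single j]
  · rw [real_inner_smul_right, orthonormal_iff_ite.1 e.orthonormal j j, if_pos rfl, mul_one,
      ENNReal.ofReal_rpow_of_nonneg (by positivity) (by norm_num),
      Real.mul_rpow (by positivity) (by positivity), ← Real.sqrt_eq_rpow, Real.sqrt_sq_eq_abs,
      ← Real.rpow_mul (by positivity)]
    congr 3
    ring
  · intro i hij
    rw [real_inner_smul_right, orthonormal_iff_ite.1 e.orthonormal i j, if_neg hij]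
    simp

end SobolevNorm

/-! ### Bias against spread -/

section SqrtBounds

variable {c₀ C₀ V T U x : ℝ}

/-- The margin between the posterior spread `T` and the spread `U ≤ T - c₀ V` of the posterior mean
leaves room for a bias `x` of the order `√V`. -/
theorem exists_add_sqrt_le_sqrt (hc : 0 < c₀) (hC : 0 < C₀) :
    ∃ ε η : ℝ, 0 < ε ∧ ε < 1 ∧ 0 < η ∧ ∀ V T U x : ℝ, 0 ≤ V → 0 ≤ U → U ≤ T - c₀ * V →
      T ≤ C₀ * V → x ^ 2 ≤ η * V → x + √((1 + ε) * U) ≤ √((1 - ε) * T) := by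
  refine ⟨min (1 / 2) (c₀ / (8 * C₀)), c₀ / 2 / (1 + (min (1 / 2) (c₀ / (8 * C₀)))⁻¹),
    by positivity, (min_le_left _ _).trans_lt (by norm_num), by positivity, ?_⟩
  have h1 : min (1 / 2) (c₀ / (8 * C₀)) ≤ 1 / 2 := min_le_left _ _
  have h2 : min (1 / 2) (c₀ / (8 * C₀)) ≤ c₀ / (8 * C₀) := min_le_right _ _
  have h3 : 0 < min (1 / 2) (c₀ / (8 * C₀)) := by positivity
  generalize min (1 / 2) (c₀ / (8 * C₀)) = ε at h1 h2 h3
  intro V T U x hV hU hUT hT hx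
  rw [le_div_iff₀ (by positivity)] at h2
  set b := √((1 + ε) * U) with hb
  have hb2 : b ^ 2 = (1 + ε) * U := Real.sq_sqrt (by positivity)
  refine Real.le_sqrt_of_sq_le ?_
  -- Young's inequality with weight `ε`
  have h4 : (x + b) ^ 2 ≤ (1 + ε⁻¹) * x ^ 2 + (1 + ε) * b ^ 2 := by
    have h5 : 0 ≤ ε * (b - ε⁻¹ * x) ^ 2 := by positivity
    have h6 : ε * (b - ε⁻¹ * x) ^ 2 = ε * b ^ 2 - 2 * x * b + ε⁻¹ * x ^ 2 := by
      field_simp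
      ring
    linarith [h6 ▸ h5]
  have h7 : (1 + ε⁻¹) * x ^ 2 ≤ c₀ / 2 * V := by
    calc (1 + ε⁻¹) * x ^ 2 ≤ (1 + ε⁻¹) * (c₀ / 2 / (1 + ε⁻¹) * V) := by gcongr
      _ = c₀ / 2 * V := by field_simp
  have h8 : (1 + ε) * b ^ 2 ≤ (1 + 3 * ε) * U := by
    rw [hb2, ← mul_assoc]
    exact mul_le_mul_of_nonneg_right (by nlinarith) hU
  have h9 : ε * (8 * C₀) * V ≤ c₀ * V := mul_le_mul_of_nonneg_right h2 hV
  have h10 : ε * T ≤ ε * (C₀ * V) := mul_le_mul_of_nonneg_left hT h3.le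
  have h11 : ε * U ≤ ε * T :=
    mul_le_mul_of_nonneg_left (by nlinarith [mul_nonneg hc.le hV]) h3.le
  nlinarith

theorem sqrt_add_sqrt_le (hT : T ≤ C₀ * V) (hU : U ≤ C₀ * V) (hx : 0 ≤ x)
    (h : 8 * C₀ * V ≤ x ^ 2) :
    √((1 + 1 / 2) * T) + √((1 + 1 / 2) * U) ≤ x := by
  have h1 : ∀ S, S ≤ C₀ * V → √((1 + 1 / 2) * S) ≤ x / 2 := fun S hS => by
    refine Real.sqrt_le_iff.2 ⟨by positivity, ?_⟩
    nlinarith [sq_nonneg x]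
  linarith [h1 T hT, h1 U hU]

end SqrtBounds

section PolynomialCoverage

variable {H₁ H₂ Ω : Type*} [NormedAddCommGroup H₁] [InnerProductSpace ℝ H₁] [CompleteSpace H₁]
  [SecondCountableTopology H₁] [MeasurableSpace H₁] [BorelSpace H₁]
  [NormedAddCommGroup H₂] [InnerProductSpace ℝ H₂] [CompleteSpace H₂]
  {e : HilbertBasis ℕ ℝ H₁} {K : H₁ →L[ℝ] H₂} {κ : ℕ → ℝ}
  [MeasurableSpace Ω] {P : Measure Ω} [IsProbabilityMeasure P] {Z : H₂ → Ω → ℝ} {α p C γ : ℝ}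

/-- The largest variance `C² V / N` is negligible with respect to a total variance `S` of the order
`V` once `N` is large. -/
theorem varSqNormal_mul_le {c₀ δ ε V N S : ℝ} (hδ : 0 < δ) (hε : 0 < ε) (hc : 0 < c₀) (hV : 0 ≤ V)
    (hN : 0 < N) (hNle : varSqNormal * C ^ 2 / (δ * ε ^ 2 * c₀) ≤ N) (hS : c₀ * V ≤ S) :
    varSqNormal * (C ^ 2 * V / N) ≤ δ * (ε ^ 2 * S) := by
  rw [div_le_iff₀ (by positivity)] at hNle
  calc varSqNormal * (C ^ 2 * V / N) = varSqNormal * C ^ 2 * (V / N) := by ring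
    _ ≤ N * (δ * ε ^ 2 * c₀) * (V / N) := by gcongr
    _ = δ * (ε ^ 2 * (c₀ * V)) := by field_simp
    _ ≤ δ * (ε ^ 2 * S) := by gcongr

/-- The order of magnitude `V = τ² N^{-2α}` of the posterior spread and of the spread of the
posterior mean, and of the difference of the two. -/
theorem IsPolynomialModel.exists_variance_bounds (hα : 0 < α) (hC : 1 ≤ C) (p : ℝ) :
    ∃ c₀ C₀ : ℝ, 0 < c₀ ∧ 0 < C₀ ∧ ∀ (τ N : ℝ) (κ l : ℕ → ℝ) (n : ℕ),
      IsPolynomialModel α p C τ N κ l n →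
        0 < τ ^ 2 * N ^ (-(2 * α)) ∧
        ∑' i, postVar κ l n i ≤ C₀ * (τ ^ 2 * N ^ (-(2 * α))) ∧
        c₀ * (τ ^ 2 * N ^ (-(2 * α))) ≤ ∑' i, meanVar κ l n i ∧
        ∑' i, meanVar κ l n i ≤ ∑' i, postVar κ l n i - c₀ * (τ ^ 2 * N ^ (-(2 * α))) := by
  refine ⟨_, _, block_const_pos (α := α) (p := p) hC, by positivity, fun τ N κ l n h =>
    ⟨?_, h.tsum_postVar_le, h.le_tsum_meanVar, by linarith [h.le_tsum_postVar_sub]⟩⟩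
  have := h.τ_pos
  have := h.N_pos
  positivity

theorem IsPolynomialModel.meanVar_le_div {τ N : ℝ} {l : ℕ → ℝ} {n : ℕ}
    (h : IsPolynomialModel α p C τ N κ l n) (i : ℕ) :
    meanVar κ l n i ≤ C ^ 2 * (τ ^ 2 * N ^ (-(2 * α))) / N :=
  (meanVar_le_postVar (fun i => (h.prior_pos i).le) i).trans (h.postVar_le_div i)

/-- A squared bias that is small relative to `V` leads to coverage near `1`. -/
theorem exists_one_sub_le_coverage (hZ : IsIsoGaussian Z P) (hα : 0 < α) (hC : 1 ≤ C)
    (hγ₀ : 0 < γ) (hγ₁ : γ < 1) (p : ℝ) (e : HilbertBasis ℕ ℝ H₁) (K : H₁ →L[ℝ] H₂) (κ : ℕ → ℝ) :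
    ∃ η : ℝ, 0 < η ∧ ∀ δ : ℝ, 0 < δ → ∃ N₀ : ℝ, ∀ (τ N : ℝ) (l : ℕ → ℝ) (Λ : H₁ →L[ℝ] H₁) (n : ℕ),
      IsPolynomialModel α p C τ N κ l n → IsDiagonalModel e K κ Λ l n → N₀ ≤ N → ∀ μ₀ : H₁,
      ‖postBias K Λ n μ₀‖ ^ 2 ≤ η * (τ ^ 2 * N ^ (-(2 * α))) →
        1 - δ ≤ coverage e K Z P Λ γ n μ₀ := by
  obtain ⟨c₀, C₀, hc₀, hC₀, hV⟩ := IsPolynomialModel.exists_variance_bounds hα hC p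
  obtain ⟨ε, η, hε, hε', hη, hroot⟩ := exists_add_sqrt_le_sqrt hc₀ hC₀
  refine ⟨η, hη, fun δ hδ => ?_⟩
  -- the concentration bound is used at `δ` for the posterior mean, and at a level below
  -- `min γ (1 - γ)` for the credible radius
  set δ₁ := min γ ((1 - γ) / 2) with hδ₁
  have hδ₁0 : 0 < δ₁ := lt_min hγ₀ (by linarith)
  refine ⟨max (varSqNormal * C ^ 2 / (δ * ε ^ 2 * c₀)) (varSqNormal * C ^ 2 / (δ₁ * ε ^ 2 * c₀)),
    fun τ N l Λ n h hD hN μ₀ hμ₀ => ?_⟩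
  obtain ⟨hV0, hT, hU, hUT⟩ := hV τ N κ l n h
  set V := τ ^ 2 * N ^ (-(2 * α))
  have hU0 : 0 < ∑' i, meanVar κ l n i := lt_of_lt_of_le (by positivity) hU
  have hcV : 0 < c₀ * V := by positivity
  have hT' : c₀ * V ≤ ∑' i, postVar κ l n i := by linarith
  refine one_sub_le_coverage hD hZ h.meanVar_le_div hε hU0
    (varSqNormal_mul_le hδ hε hc₀ hV0.le h.N_pos ((le_max_left _ _).trans hN) hU) fun y => ?_
  have hr := (credibleRadius_bounds (γ := γ) hD hZ h.postVar_le_div hε hε' (hcV.trans_le hT')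
    (varSqNormal_mul_le hδ₁0 hε hc₀ hV0.le h.N_pos ((le_max_right _ _).trans hN) hT')
    (min_le_left _ _) ((min_le_right _ _).trans_lt (by linarith)) y).1
  exact (hroot V _ _ _ hV0.le hU0.le hUT hT hμ₀).trans hr

/-- A squared bias that is large relative to `V` leads to coverage near `0`. -/
theorem exists_coverage_le (hZ : IsIsoGaussian Z P) (hα : 0 < α) (hC : 1 ≤ C)
    (hγ₀ : 0 < γ) (hγ₁ : γ < 1) (p : ℝ) (e : HilbertBasis ℕ ℝ H₁) (K : H₁ →L[ℝ] H₂) (κ : ℕ → ℝ) :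
    ∃ M : ℝ, 0 < M ∧ ∀ δ : ℝ, 0 < δ → ∃ N₀ : ℝ, ∀ (τ N : ℝ) (l : ℕ → ℝ) (Λ : H₁ →L[ℝ] H₁) (n : ℕ),
      IsPolynomialModel α p C τ N κ l n → IsDiagonalModel e K κ Λ l n → N₀ ≤ N → ∀ μ₀ : H₁,
      M * (τ ^ 2 * N ^ (-(2 * α))) ≤ ‖postBias K Λ n μ₀‖ ^ 2 →
        coverage e K Z P Λ γ n μ₀ ≤ δ := by
  obtain ⟨c₀, C₀, hc₀, hC₀, hV⟩ := IsPolynomialModel.exists_variance_bounds hα hC p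
  refine ⟨8 * C₀, by positivity, fun δ hδ => ?_⟩
  have hε : (0 : ℝ) < 1 / 2 := by norm_num
  set δ₁ := min γ ((1 - γ) / 2) with hδ₁
  have hδ₁0 : 0 < δ₁ := lt_min hγ₀ (by linarith)
  refine ⟨max (varSqNormal * C ^ 2 / (δ * (1 / 2) ^ 2 * c₀))
    (varSqNormal * C ^ 2 / (δ₁ * (1 / 2) ^ 2 * c₀)), fun τ N l Λ n h hD hN μ₀ hμ₀ => ?_⟩
  obtain ⟨hV0, hT, hU, hUT⟩ := hV τ N κ l n h
  set V := τ ^ 2 * N ^ (-(2 * α))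
  have hU0 : 0 < ∑' i, meanVar κ l n i := lt_of_lt_of_le (by positivity) hU
  have hcV : 0 < c₀ * V := by positivity
  have hT' : c₀ * V ≤ ∑' i, postVar κ l n i := by linarith
  refine coverage_le hD hZ h.meanVar_le_div hε hU0
    (varSqNormal_mul_le hδ hε hc₀ hV0.le h.N_pos ((le_max_left _ _).trans hN) hU) fun y => ?_
  have hr := (credibleRadius_bounds (γ := γ) hD hZ h.postVar_le_div hε (by norm_num)
    (hcV.trans_le hT')
    (varSqNormal_mul_le hδ₁0 hε hc₀ hV0.le h.N_pos ((le_max_right _ _).trans hN) hT')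
    (min_le_left _ _) ((min_le_right _ _).trans_lt (by linarith)) y).2
  have h1 := sqrt_add_sqrt_le (U := ∑' i, meanVar κ l n i) hT (by linarith) (norm_nonneg _) hμ₀
  linarith

/-- If the squared bias is small relative to `V`, then the radii of the credible ball and of the
confidence ball are both of the order `√V`. -/
theorem exists_confidenceRadius_bounds (hZ : IsIsoGaussian Z P) (hα : 0 < α) (hC : 1 ≤ C)
    (hγ₀ : 0 < γ) (hγ₁ : γ < 1) (p : ℝ) (e : HilbertBasis ℕ ℝ H₁) (K : H₁ →L[ℝ] H₂) (κ : ℕ → ℝ) :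
    ∃ η c₁ c₂ N₀ : ℝ, 0 < η ∧ 0 < c₁ ∧ 0 < c₂ ∧
      ∀ (τ N : ℝ) (l : ℕ → ℝ) (Λ : H₁ →L[ℝ] H₁) (n : ℕ),
      IsPolynomialModel α p C τ N κ l n → IsDiagonalModel e K κ Λ l n → N₀ ≤ N → ∀ μ₀ : H₁,
      ‖postBias K Λ n μ₀‖ ^ 2 ≤ η * (τ ^ 2 * N ^ (-(2 * α))) → ∀ y : H₂ → ℝ,
        0 < credibleRadius e K Λ γ n y ∧
        c₁ * credibleRadius e K Λ γ n y ≤ confidenceRadius e K Z P Λ γ n μ₀ ∧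
        confidenceRadius e K Z P Λ γ n μ₀ ≤ c₂ * credibleRadius e K Λ γ n y := by
  obtain ⟨c₀, C₀, hc₀, hC₀, hV⟩ := IsPolynomialModel.exists_variance_bounds hα hC p
  have hε : (0 : ℝ) < 1 / 2 := by norm_num
  set δ₁ := min γ ((1 - γ) / 2) with hδ₁
  have hδ₁0 : 0 < δ₁ := lt_min hγ₀ (by linarith)
  have hδ₁' : δ₁ < 1 - γ := (min_le_right _ _).trans_lt (by linarith)
  refine ⟨c₀ / 8, √(c₀ / (12 * C₀)), 3, varSqNormal * C ^ 2 / (δ₁ * (1 / 2) ^ 2 * c₀),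
    by positivity, by positivity, by norm_num, fun τ N l Λ n h hD hN μ₀ hμ₀ y => ?_⟩
  obtain ⟨hV0, hT, hU, hUT⟩ := hV τ N κ l n h
  set V := τ ^ 2 * N ^ (-(2 * α))
  have hcV : 0 < c₀ * V := by positivity
  have hU0 : 0 < ∑' i, meanVar κ l n i := lt_of_lt_of_le hcV hU
  have hT' : c₀ * V ≤ ∑' i, postVar κ l n i := by linarith
  obtain ⟨hr1, hr2⟩ := credibleRadius_bounds (γ := γ) hD hZ h.postVar_le_div hε (by norm_num)
    (hcV.trans_le hT') (varSqNormal_mul_le hδ₁0 hε hc₀ hV0.le h.N_pos hN hT')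
    (min_le_left _ _) hδ₁' y
  obtain ⟨hc1, hc2⟩ := confidenceRadius_bounds (γ := γ) hD hZ h.meanVar_le_div hε hU0
    (varSqNormal_mul_le hδ₁0 hε hc₀ hV0.le h.N_pos hN hU) (min_le_left _ _) hδ₁' μ₀
  set T := ∑' i, postVar κ l n i
  set U := ∑' i, meanVar κ l n i
  set r := credibleRadius e K Λ γ n y
  have hT0 : 0 < T := hcV.trans_le hT'
  have hbias : ∀ S, c₀ * V ≤ S → ‖postBias K Λ n μ₀‖ ≤ √((1 - 1 / 2) * S) / 2 := fun S hS => by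
    have h1 : √((1 - 1 / 2) * S) / 2 = √(S / 8) := by
      rw [show (1 - 1 / 2) * S = 2 ^ 2 * (S / 8) by ring, Real.sqrt_mul (by norm_num),
        Real.sqrt_sq (by norm_num)]
      ring
    rw [h1]
    exact Real.le_sqrt_of_sq_le (by linarith)
  have hrpos : 0 < r := lt_of_lt_of_le (by positivity) hr1
  refine ⟨hrpos, ?_, ?_⟩
  · have h1 : √(c₀ / (12 * C₀)) * √((1 + 1 / 2) * T) ≤ √((1 - 1 / 2) * U) / 2 := by
      rw [← Real.sqrt_mul (by positivity)]
      refine Real.sqrt_le_iff.2 ⟨by positivity, ?_⟩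
      rw [div_pow, Real.sq_sqrt (by positivity)]
      calc c₀ / (12 * C₀) * ((1 + 1 / 2) * T)
          ≤ c₀ / (12 * C₀) * ((1 + 1 / 2) * (C₀ * V)) := by gcongr
        _ = c₀ * V / 8 := by
            field_simp
            ring
        _ ≤ (1 - 1 / 2) * U / 2 ^ 2 := by linarith
    have h2 : √(c₀ / (12 * C₀)) * r ≤ √(c₀ / (12 * C₀)) * √((1 + 1 / 2) * T) := by gcongr
    linarith [hbias U hU]
  · have h1 : √((1 + 1 / 2) * U) ≤ 2 * √((1 - 1 / 2) * T) := by
      refine Real.sqrt_le_iff.2 ⟨by positivity, ?_⟩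
      rw [mul_pow, Real.sq_sqrt (by positivity)]
      linarith
    linarith [hbias T hT']

end PolynomialCoverage

/-! ### The order of the bias over Sobolev balls -/

section BiasOrder

variable {H₁ H₂ : Type*} [NormedAddCommGroup H₁] [InnerProductSpace ℝ H₁] [CompleteSpace H₁]
  [NormedAddCommGroup H₂] [InnerProductSpace ℝ H₂] [CompleteSpace H₂]
  {e : HilbertBasis ℕ ℝ H₁} {K : H₁ →L[ℝ] H₂} {κ l : ℕ → ℝ} {Λ : H₁ →L[ℝ] H₁}
  {α β β' p C τ N : ℝ} {n : ℕ}

omit [CompleteSpace H₁] in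
theorem IsPolynomialModel.bias_summand_le (h : IsPolynomialModel α p C τ N κ l n) (hβ' : 0 ≤ β')
    (h1 : β' ≤ β) (h2 : β' ≤ 1 + 2 * α + 2 * p) (μ₀ : H₁) (i : ℕ) :
    ⟪e i, μ₀⟫ ^ 2 / (1 + n * l i * κ i ^ 2) ^ 2 ≤
      C ^ 4 * N ^ (-(2 * β')) * (⟪e i, μ₀⟫ ^ 2 * ((i : ℝ) + 1) ^ (2 * β)) := by
  rw [div_eq_mul_inv, ← inv_pow]
  calc ⟪e i, μ₀⟫ ^ 2 * (1 + n * l i * κ i ^ 2)⁻¹ ^ 2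
      ≤ ⟪e i, μ₀⟫ ^ 2 * (C ^ 4 * N ^ (-(2 * β')) * ((i : ℝ) + 1) ^ (2 * β)) :=
        mul_le_mul_of_nonneg_left (h.inv_one_add_sq_le hβ' h1 h2 i) (sq_nonneg _)
    _ = _ := by ring

theorem IsDiagonalModel.hasSum_postBias (hD : IsDiagonalModel e K κ Λ l n) (μ₀ : H₁) :
    HasSum (fun i => ⟪e i, μ₀⟫ ^ 2 / (1 + n * l i * κ i ^ 2) ^ 2) (‖postBias K Λ n μ₀‖ ^ 2) :=
  _root_.hasSum_postBias hD.1 hD.2 hD.3 hD.4 hD.6 μ₀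

theorem norm_sq_postBias_le (h : IsPolynomialModel α p C τ N κ l n)
    (hD : IsDiagonalModel e K κ Λ l n) (hβ' : 0 ≤ β') (h1 : β' ≤ β) (h2 : β' ≤ 1 + 2 * α + 2 * p)
    {μ₀ : H₁} {R : ℝ≥0} (hR : sobolevNorm e β μ₀ ≤ R) :
    ‖postBias K Λ n μ₀‖ ^ 2 ≤ C ^ 4 * R ^ 2 * N ^ (-(2 * β')) := by
  have hN := h.N_pos
  have hC := h.one_le_C
  have hs := sobolevNorm_lt_top_iff.1 (hR.trans_lt ENNReal.coe_lt_top)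
  refine (hasSum_le (h.bias_summand_le hβ' h1 h2 μ₀) (hD.hasSum_postBias μ₀)
    (hs.hasSum.mul_left _)).trans ?_
  have h3 := tsum_le_of_sobolevNorm_le hR
  calc C ^ 4 * N ^ (-(2 * β')) * ∑' i : ℕ, ⟪e i, μ₀⟫ ^ 2 * ((i : ℝ) + 1) ^ (2 * β)
      ≤ C ^ 4 * N ^ (-(2 * β')) * (R : ℝ) ^ 2 := by gcongr
    _ = _ := by ring

/-- The Sobolev ball of radius `R` contains a segment `[0, θ₀ eⱼ]` along which the bias increases
to the maximal order. -/
theorem exists_le_norm_sq_postBias (h : IsPolynomialModel α p C τ N κ l n)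
    (hD : IsDiagonalModel e K κ Λ l n) (hβ : 0 < β) (hβ' : β' = min β (1 + 2 * α + 2 * p))
    (R : ℝ≥0) :
    ∃ (j : ℕ) (θ₀ : ℝ), 0 ≤ θ₀ ∧ (∀ θ ∈ Set.Icc 0 θ₀, sobolevNorm e β (θ • e j) ≤ R) ∧
      R ^ 2 * (((3 : ℝ) ^ (-β) * (1 + C ^ 2)⁻¹) ^ 2 * N ^ (-(2 * β'))) ≤
        ‖postBias K Λ n (θ₀ • e j)‖ ^ 2 := by
  obtain ⟨j, hj⟩ := h.exists_le_bias hβ hβ'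
  have hx : (0 : ℝ) < (j : ℝ) + 1 := by positivity
  refine ⟨j, R * ((j : ℝ) + 1) ^ (-β), by positivity, fun θ hθ => ?_, ?_⟩
  · rw [sobolevNorm_smul_basis, abs_of_nonneg hθ.1, ← ENNReal.ofReal_coe_nnreal]
    refine ENNReal.ofReal_le_ofReal ?_
    calc θ * ((j : ℝ) + 1) ^ β ≤ R * ((j : ℝ) + 1) ^ (-β) * ((j : ℝ) + 1) ^ β := by
          gcongr
          exact hθ.2
      _ = R := by
          rw [mul_assoc, ← Real.rpow_add hx, neg_add_cancel, Real.rpow_zero, mul_one]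
  · rw [postBias_smul, postBias_basis hD.1 hD.2 hD.3 hD.4 hD.6, smul_smul, norm_smul,
      e.orthonormal.1 j, mul_one, Real.norm_eq_abs, sq_abs, mul_assoc, mul_pow (R : ℝ)]
    gcongr

end BiasOrder

/-! ### Asymptotics of the coverage -/

section Asymptotics

variable {H₁ H₂ Ω : Type*} [NormedAddCommGroup H₁] [InnerProductSpace ℝ H₁] [CompleteSpace H₁]
  [NormedAddCommGroup H₂] [InnerProductSpace ℝ H₂] [CompleteSpace H₂]
  {e : HilbertBasis ℕ ℝ H₁} {K : H₁ →L[ℝ] H₂} {κ : ℕ → ℝ} {l : ℕ → ℕ → ℝ} {Λ : ℕ → H₁ →L[ℝ] H₁}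
  {α β β' p C γ : ℝ} {τ N : ℕ → ℝ}

/-- A sequence of polynomial models, with the sample size as index, for which the transition index
`N` tends to infinity. -/
structure IsModelSequence (e : HilbertBasis ℕ ℝ H₁) (K : H₁ →L[ℝ] H₂) (κ : ℕ → ℝ)
    (Λ : ℕ → H₁ →L[ℝ] H₁) (l : ℕ → ℕ → ℝ) (α p C : ℝ) (τ N : ℕ → ℝ) : Prop where
  polynomial : ∀ᶠ n in atTop, IsPolynomialModel α p C (τ n) (N n) κ (l n) n
  diagonal : ∀ᶠ n in atTop, IsDiagonalModel e K κ (Λ n) (l n) n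
  tendsto : Tendsto N atTop atTop

theorem isModelSequence (hK : ∀ i, K.adjoint (K (e i)) = (κ i ^ 2) • e i)
    (hα : 0 < α) (hp : 0 ≤ p) (hC : 1 ≤ C)
    (hκ : ∀ i : ℕ, C⁻¹ * ((i : ℝ) + 1) ^ (-p) ≤ κ i ∧ κ i ≤ C * ((i : ℝ) + 1) ^ (-p))
    (hτ : ∀ n, 0 < τ n) (hnτ : Tendsto (fun n : ℕ => (n : ℝ) * τ n ^ 2) atTop atTop)
    (hΛ : ∀ n i, Λ n (e i) = (τ n ^ 2 * ((i : ℝ) + 1) ^ (-1 - 2 * α)) • e i) :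
    IsModelSequence e K κ Λ (fun n i => τ n ^ 2 * ((i : ℝ) + 1) ^ (-1 - 2 * α)) α p C τ
      (fun n => ((n : ℝ) * τ n ^ 2) ^ (1 + 2 * α + 2 * p)⁻¹) := by
  have hD : 0 < 1 + 2 * α + 2 * p := by linarith
  have hpoly : ∀ᶠ n : ℕ in atTop, IsPolynomialModel α p C (τ n)
      (((n : ℝ) * τ n ^ 2) ^ (1 + 2 * α + 2 * p)⁻¹) κ
      (fun i => τ n ^ 2 * ((i : ℝ) + 1) ^ (-1 - 2 * α)) n := by
    filter_upwards [hnτ.eventually_ge_atTop 1, eventually_gt_atTop 0] with n hn hn0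
    exact ⟨hα, hp, hC, hτ n, Real.one_le_rpow hn (by positivity), hn0,
      Real.rpow_inv_rpow (by linarith) hD.ne', fun i => rfl, hκ⟩
  refine ⟨hpoly, ?_, (tendsto_rpow_atTop (by positivity)).comp hnτ⟩
  filter_upwards [hpoly] with n h
  exact ⟨hK, h.singular_pos, hΛ n, fun i => (h.prior_pos i).le, h.summable_prior, h.n_pos⟩

/-- The ratio of the spread `V = τ² N^{-2α}` to the squared bias `N^{-2β'}` is a positive power of
the ratio of `τ` to the critical rate `a`. -/
theorem spread_mul_eq (hα : 0 < α) (hp : 0 ≤ p) (hβ' : 0 < β') {t : ℝ} (ht : 0 < t) {n : ℕ}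
    (hn : 0 < n) :
    t ^ 2 * (((n : ℝ) * t ^ 2) ^ (1 + 2 * α + 2 * p)⁻¹) ^ (-(2 * α)) *
        (((n : ℝ) * t ^ 2) ^ (1 + 2 * α + 2 * p)⁻¹) ^ (2 * β') =
      (t / (n : ℝ) ^ ((α - β') / (1 + 2 * β' + 2 * p))) ^
        (2 * (1 + 2 * β' + 2 * p) / (1 + 2 * α + 2 * p)) := by
  have hn' : (0 : ℝ) < n := Nat.cast_pos.2 hn
  have hD : 1 + 2 * α + 2 * p ≠ 0 := by positivity
  have hE : 1 + 2 * β' + 2 * p ≠ 0 := by positivity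
  have hnt : 0 < (n : ℝ) * t ^ 2 := by positivity
  rw [mul_assoc, ← Real.rpow_add (by positivity), ← Real.rpow_mul hnt.le,
    Real.mul_rpow hn'.le (by positivity), Real.div_rpow ht.le (by positivity),
    ← Real.rpow_mul hn'.le, ← Real.rpow_natCast t 2, ← Real.rpow_mul ht.le, mul_left_comm,
    ← Real.rpow_add ht, div_eq_inv_mul, ← Real.rpow_neg hn'.le]
  congr 2
  · field_simp
    ring
  · push_cast
    field_simp
    ring

namespace IsModelSequence

/-- If the spread dominates the worst squared bias, then it dominates the squared bias uniformly
over Sobolev balls. -/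
theorem eventually_postBias_le (hS : IsModelSequence e K κ Λ l α p C τ N) (hβ' : 0 ≤ β')
    (h1 : β' ≤ β) (h2 : β' ≤ 1 + 2 * α + 2 * p)
    (hQ : Tendsto (fun n => τ n ^ 2 * N n ^ (-(2 * α)) * N n ^ (2 * β')) atTop atTop)
    {η : ℝ} (hη : 0 < η) (R : ℝ≥0) :
    ∀ᶠ n in atTop, ∀ μ₀ : H₁, sobolevNorm e β μ₀ ≤ R →
      ‖postBias K (Λ n) n μ₀‖ ^ 2 ≤ η * (τ n ^ 2 * N n ^ (-(2 * α))) := by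
  filter_upwards [hS.polynomial, hS.diagonal,
    hQ.eventually_ge_atTop (C ^ 4 * R ^ 2 / η)] with n h hD hQn μ₀ hμ₀
  have hN := h.N_pos
  refine (norm_sq_postBias_le h hD hβ' h1 h2 hμ₀).trans ?_
  rw [div_le_iff₀ hη] at hQn
  rw [Real.rpow_neg hN.le (2 * β'), ← div_eq_mul_inv, div_le_iff₀ (by positivity)]
  linarith

/-- For a fixed truth the squared bias is of smaller order than `N^{-2β}`, by dominated
convergence: the `i`th coordinate is asymptotically of the smaller order `N^{-2(1+2α+2p)}`. -/
theorem tendsto_postBias (hS : IsModelSequence e K κ Λ l α p C τ N) (hβ : 0 ≤ β)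
    (h2 : β < 1 + 2 * α + 2 * p) {μ₀ : H₁} (hμ₀ : sobolevNorm e β μ₀ < ∞) :
    Tendsto (fun n => N n ^ (2 * β) * ‖postBias K (Λ n) n μ₀‖ ^ 2) atTop (𝓝 0) := by
  have hs := sobolevNorm_lt_top_iff.1 hμ₀
  have hlim : Tendsto (fun n => ∑' i : ℕ, N n ^ (2 * β) *
      (⟪e i, μ₀⟫ ^ 2 / (1 + n * l n i * κ i ^ 2) ^ 2)) atTop (𝓝 (∑' _ : ℕ, (0 : ℝ))) := by
    refine tendsto_tsum_of_dominated_convergence (hs.mul_left (C ^ 4)) (fun i => ?_) ?_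
    · have hlim : Tendsto (fun n => C ^ 4 * (⟪e i, μ₀⟫ ^ 2 * ((i : ℝ) + 1) ^
          (2 * (1 + 2 * α + 2 * p))) * N n ^ (-(2 * (1 + 2 * α + 2 * p) - 2 * β)))
          atTop (𝓝 0) := by
        have := ((tendsto_rpow_neg_atTop (y := 2 * (1 + 2 * α + 2 * p) - 2 * β)
          (by linarith)).comp hS.tendsto).const_mul
          (C ^ 4 * (⟪e i, μ₀⟫ ^ 2 * ((i : ℝ) + 1) ^ (2 * (1 + 2 * α + 2 * p))))
        rwa [mul_zero] at this
      refine squeeze_zero' ?_ ?_ hlim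
      · filter_upwards [hS.polynomial] with n h
        have := h.N_pos
        positivity
      · filter_upwards [hS.polynomial] with n h
        have hN := h.N_pos
        refine (mul_le_mul_of_nonneg_left (h.bias_summand_le (e := e)
          (β := 1 + 2 * α + 2 * p) (hβ.trans h2.le) le_rfl le_rfl μ₀ i)
          (by positivity : 0 ≤ N n ^ (2 * β))).trans (le_of_eq ?_)
        rw [neg_sub, sub_eq_add_neg, Real.rpow_add hN]
        ring
    · filter_upwards [hS.polynomial] with n h i
      have hN := h.N_pos
      rw [Real.norm_of_nonneg (by positivity)]
      refine (mul_le_mul_of_nonneg_left (h.bias_summand_le (e := e) hβ le_rfl h2.le μ₀ i)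
        (by positivity : 0 ≤ N n ^ (2 * β))).trans (le_of_eq ?_)
      rw [Real.rpow_neg hN.le]
      field_simp
  rw [tsum_zero] at hlim
  refine hlim.congr' ?_
  filter_upwards [hS.diagonal] with n hD
  rw [tsum_mul_left, (hD.hasSum_postBias μ₀).tsum_eq]

theorem eventually_postBias_le_of_lt_top (hS : IsModelSequence e K κ Λ l α p C τ N) (hβ : 0 ≤ β)
    (h2 : β < 1 + 2 * α + 2 * p) {k : ℝ} (hk : 0 < k)
    (hQ : ∀ᶠ n in atTop, k ≤ τ n ^ 2 * N n ^ (-(2 * α)) * N n ^ (2 * β)) {η : ℝ} (hη : 0 < η)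
    {μ₀ : H₁} (hμ₀ : sobolevNorm e β μ₀ < ∞) :
    ∀ᶠ n in atTop, ‖postBias K (Λ n) n μ₀‖ ^ 2 ≤ η * (τ n ^ 2 * N n ^ (-(2 * α))) := by
  filter_upwards [hS.polynomial, hQ, (hS.tendsto_postBias hβ h2 hμ₀).eventually_le_const
    (mul_pos hη hk)] with n h hQn hn
  have hN := h.N_pos
  have h3 : N n ^ (2 * β) * ‖postBias K (Λ n) n μ₀‖ ^ 2 ≤
      N n ^ (2 * β) * (η * (τ n ^ 2 * N n ^ (-(2 * α)))) := by nlinarith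
  exact le_of_mul_le_mul_left h3 (by positivity)

/-- If the worst squared bias is at least of the order of the spread, then a suitable Sobolev ball
contains segments along which the squared bias grows beyond any given multiple of the spread. -/
theorem exists_eventually_le_postBias (hS : IsModelSequence e K κ Λ l α p C τ N) (hβ : 0 < β)
    (hβ' : β' = min β (1 + 2 * α + 2 * p)) (hC : 1 ≤ C) {k : ℝ}
    (hQ : ∀ᶠ n in atTop, τ n ^ 2 * N n ^ (-(2 * α)) * N n ^ (2 * β') ≤ k) {M : ℝ} (hM : 0 < M) :
    ∃ R : ℝ≥0, ∀ᶠ n in atTop, ∃ (j : ℕ) (θ₀ : ℝ), 0 ≤ θ₀ ∧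
      (∀ θ ∈ Set.Icc 0 θ₀, sobolevNorm e β (θ • e j) ≤ R) ∧
      M * (τ n ^ 2 * N n ^ (-(2 * α))) ≤ ‖postBias K (Λ n) n (θ₀ • e j)‖ ^ 2 := by
  set b := ((3 : ℝ) ^ (-β) * (1 + C ^ 2)⁻¹) ^ 2 with hb
  have hb0 : 0 < b := by positivity
  obtain ⟨R, hR⟩ : ∃ R : ℝ≥0, (R : ℝ) = √(M * k / b) :=
    ⟨_, Real.coe_toNNReal _ (Real.sqrt_nonneg _)⟩
  refine ⟨R, ?_⟩
  filter_upwards [hS.polynomial, hS.diagonal, hQ] with n h hD hQn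
  have hN := h.N_pos
  have hk : 0 ≤ k := by
    refine le_trans ?_ hQn
    positivity
  obtain ⟨j, θ₀, hθ₀, h1, h2⟩ := exists_le_norm_sq_postBias h hD hβ hβ' R
  refine ⟨j, θ₀, hθ₀, h1, le_trans ?_ h2⟩
  rw [← hb, hR, Real.sq_sqrt (by positivity), Real.rpow_neg hN.le (2 * β')]
  have h3 : M * k / b * (b * (N n ^ (2 * β'))⁻¹) = M * k / N n ^ (2 * β') := by field_simp
  rw [h3, le_div_iff₀ (by positivity)]
  nlinarith

/-- For `τ = 1` and `β < α`, a fixed truth of smoothness slightly larger than `β` has a squared bias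
that dominates the spread. -/
theorem exists_fixed_le_postBias (hS : IsModelSequence e K κ Λ l α p C τ N) (hβ : 0 < β)
    (hβα : β < α) (hC : 1 ≤ C) (hτ : ∀ n, τ n = 1) :
    ∃ μ₀ : H₁, sobolevNorm e β μ₀ < ∞ ∧ ∀ M : ℝ,
      ∀ᶠ n in atTop, M * (τ n ^ 2 * N n ^ (-(2 * α))) ≤ ‖postBias K (Λ n) n μ₀‖ ^ 2 := by
  -- the exponent of the squared coefficients, for the smoothness `(α + β) / 2`
  set s := -1 - (α + β) with hs
  have hsq : ∀ i : ℕ, (((i : ℝ) + 1) ^ (s / 2)) ^ 2 = ((i : ℝ) + 1) ^ s := fun i => by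
    rw [← Real.rpow_natCast, ← Real.rpow_mul (by positivity)]
    congr 1
    push_cast
    ring
  have hsum : Summable fun i : ℕ => (((i : ℝ) + 1) ^ (s / 2)) ^ 2 := by
    simp only [hsq]
    exact summable_add_one_rpow (by linarith)
  refine ⟨∑' i : ℕ, ((i : ℝ) + 1) ^ (s / 2) • e i, ?_, fun M => ?_⟩
  · rw [sobolevNorm_lt_top_iff]
    simp only [e.inner_tsum_smul hsum, hsq]
    refine (summable_add_one_rpow (s := s + 2 * β) (by linarith)).congr fun i => ?_
    rw [Real.rpow_add (by positivity)]
  · have hlim := ((tendsto_rpow_atTop (sub_pos.2 hβα)).comp hS.tendsto).const_mul_atTop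
      (by positivity : 0 < ((1 + C ^ 2) ^ 2)⁻¹ * (4 : ℝ) ^ s)
    filter_upwards [hS.polynomial, hS.diagonal, hlim.eventually_ge_atTop M] with n h hD hn
    have hN := h.N_pos
    have h1 := hD.hasSum_postBias (∑' i : ℕ, ((i : ℝ) + 1) ^ (s / 2) • e i)
    simp only [e.inner_tsum_smul hsum, hsq] at h1
    rw [← h1.tsum_eq, hτ, one_pow, one_mul]
    refine le_trans ?_ (h.block_le_tsum (fun i => by positivity) h1.summable
      (k := ((1 + C ^ 2) ^ 2)⁻¹) (s := s) (by positivity) (by linarith) fun i hi _ => ?_)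
    · have h2 : N n ^ (1 + s) = N n ^ (α - β) * N n ^ (-(2 * α)) := by
        rw [← Real.rpow_add hN]
        congr 1
        linarith
      rw [h2, ← mul_assoc]
      exact mul_le_mul_of_nonneg_right hn (by positivity)
    · rw [← div_eq_inv_mul]
      have h3 := h.ratio_le_of_le hi
      have h4 := one_add_pos (κ := κ) (n := n) (fun i => (h.prior_pos i).le) i
      gcongr

end IsModelSequence

end Asymptotics

section CoverageLimits

variable {H₁ H₂ Ω : Type*} [NormedAddCommGroup H₁] [InnerProductSpace ℝ H₁] [CompleteSpace H₁]
  [SecondCountableTopology H₁] [MeasurableSpace H₁] [BorelSpace H₁]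
  [NormedAddCommGroup H₂] [InnerProductSpace ℝ H₂] [CompleteSpace H₂]
  {e : HilbertBasis ℕ ℝ H₁} {K : H₁ →L[ℝ] H₂} {κ : ℕ → ℝ} {l : ℕ → ℕ → ℝ} {Λ : ℕ → H₁ →L[ℝ] H₁}
  [MeasurableSpace Ω] {P : Measure Ω} [IsProbabilityMeasure P] {Z : H₂ → Ω → ℝ}
  {α β β' p C γ : ℝ} {τ N : ℕ → ℝ}

/-- Truths that are available for all large `n` within one Sobolev ball form a bounded sequence;
the truth `0` fills the remaining places. -/
theorem exists_seq_of_eventually {H : Type*} [NormedAddCommGroup H] [InnerProductSpace ℝ H]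
    {e : HilbertBasis ℕ ℝ H} {q : ℕ → H → Prop} {R : ℝ≥0}
    (h : ∀ᶠ n in atTop, ∃ μ : H, sobolevNorm e β μ ≤ R ∧ q n μ) :
    ∃ μ₀ : ℕ → H, (⨆ n, sobolevNorm e β (μ₀ n)) < ∞ ∧ ∀ᶠ n in atTop, q n (μ₀ n) := by
  classical
  refine ⟨fun n => if hn : ∃ μ : H, sobolevNorm e β μ ≤ R ∧ q n μ then hn.choose else 0,
    (iSup_le fun n => ?_).trans_lt (ENNReal.coe_lt_top (r := R)), ?_⟩
  · dsimp only
    split_ifs with hn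
    · exact hn.choose_spec.1
    · have h0 : sobolevNorm e β (0 : H) = 0 := by simpa using sobolevNorm_smul_basis e β 0 0
      rw [h0]
      exact zero_le
  · filter_upwards [h] with n hn
    rw [dif_pos hn]
    exact hn.choose_spec.2

namespace IsModelSequence

theorem eventually_one_sub_le_coverage (hS : IsModelSequence e K κ Λ l α p C τ N)
    (hZ : IsIsoGaussian Z P) (hα : 0 < α) (hC : 1 ≤ C) (hγ₀ : 0 < γ) (hγ₁ : γ < 1) :
    ∃ η : ℝ, 0 < η ∧ ∀ δ : ℝ, 0 < δ → ∀ᶠ n in atTop, ∀ μ₀ : H₁,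
      ‖postBias K (Λ n) n μ₀‖ ^ 2 ≤ η * (τ n ^ 2 * N n ^ (-(2 * α))) →
        1 - δ ≤ coverage e K Z P (Λ n) γ n μ₀ := by
  obtain ⟨η, hη, h⟩ := exists_one_sub_le_coverage hZ hα hC hγ₀ hγ₁ p e K κ
  refine ⟨η, hη, fun δ hδ => ?_⟩
  obtain ⟨N₀, h⟩ := h δ hδ
  filter_upwards [hS.polynomial, hS.diagonal, hS.tendsto.eventually_ge_atTop N₀] with n h1 h2 h3
  exact h _ _ _ _ _ h1 h2 h3

theorem eventually_coverage_le (hS : IsModelSequence e K κ Λ l α p C τ N)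
    (hZ : IsIsoGaussian Z P) (hα : 0 < α) (hC : 1 ≤ C) (hγ₀ : 0 < γ) (hγ₁ : γ < 1) :
    ∃ M : ℝ, 0 < M ∧ ∀ δ : ℝ, 0 < δ → ∀ᶠ n in atTop, ∀ μ₀ : H₁,
      M * (τ n ^ 2 * N n ^ (-(2 * α))) ≤ ‖postBias K (Λ n) n μ₀‖ ^ 2 →
        coverage e K Z P (Λ n) γ n μ₀ ≤ δ := by
  obtain ⟨M, hM, h⟩ := exists_coverage_le hZ hα hC hγ₀ hγ₁ p e K κ
  refine ⟨M, hM, fun δ hδ => ?_⟩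
  obtain ⟨N₀, h⟩ := h δ hδ
  filter_upwards [hS.polynomial, hS.diagonal, hS.tendsto.eventually_ge_atTop N₀] with n h1 h2 h3
  exact h _ _ _ _ _ h1 h2 h3

theorem eventually_confidenceRadius_bounds (hS : IsModelSequence e K κ Λ l α p C τ N)
    (hZ : IsIsoGaussian Z P) (hα : 0 < α) (hC : 1 ≤ C) (hγ₀ : 0 < γ) (hγ₁ : γ < 1) :
    ∃ η c₁ c₂ : ℝ, 0 < η ∧ 0 < c₁ ∧ 0 < c₂ ∧ ∀ᶠ n in atTop, ∀ μ₀ : H₁,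
      ‖postBias K (Λ n) n μ₀‖ ^ 2 ≤ η * (τ n ^ 2 * N n ^ (-(2 * α))) → ∀ y : H₂ → ℝ,
        0 < credibleRadius e K (Λ n) γ n y ∧
        c₁ * credibleRadius e K (Λ n) γ n y ≤ confidenceRadius e K Z P (Λ n) γ n μ₀ ∧
        confidenceRadius e K Z P (Λ n) γ n μ₀ ≤ c₂ * credibleRadius e K (Λ n) γ n y := by
  obtain ⟨η, c₁, c₂, N₀, hη, hc₁, hc₂, h⟩ :=
    exists_confidenceRadius_bounds hZ hα hC hγ₀ hγ₁ p e K κ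
  refine ⟨η, c₁, c₂, hη, hc₁, hc₂, ?_⟩
  filter_upwards [hS.polynomial, hS.diagonal, hS.tendsto.eventually_ge_atTop N₀] with n h1 h2 h3
  exact h _ _ _ _ _ h1 h2 h3

/-- If the worst squared bias is at least of the order of the spread, then every limit
`c ∈ [0, 1)` of the coverage is attained. Along a segment from the truth `0`, with coverage near
`1`, to a truth of large bias, with coverage near `0`, the coverage is continuous, so that a
positive `c` is even attained exactly for all large `n`. -/
theorem exists_seq_tendsto_coverage (hS : IsModelSequence e K κ Λ l α p C τ N)
    (hZ : IsIsoGaussian Z P) (hα : 0 < α) (hC : 1 ≤ C) (hγ₀ : 0 < γ) (hγ₁ : γ < 1)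
    (hβ : 0 < β) (hβ' : β' = min β (1 + 2 * α + 2 * p)) {k : ℝ}
    (hQ : ∀ᶠ n in atTop, τ n ^ 2 * N n ^ (-(2 * α)) * N n ^ (2 * β') ≤ k)
    {c : ℝ} (hc₀ : 0 ≤ c) (hc₁ : c < 1) :
    ∃ μ₀ : ℕ → H₁, (⨆ n, sobolevNorm e β (μ₀ n)) < ∞ ∧
      Tendsto (fun n => coverage e K Z P (Λ n) γ n (μ₀ n)) atTop (𝓝 c) := by
  obtain ⟨M, hM, hlow⟩ := hS.eventually_coverage_le hZ hα hC hγ₀ hγ₁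
  obtain ⟨η, hη, hhigh⟩ := hS.eventually_one_sub_le_coverage hZ hα hC hγ₀ hγ₁
  obtain ⟨R, hR⟩ := hS.exists_eventually_le_postBias hβ hβ' hC hQ hM
  rcases hc₀.eq_or_lt with rfl | hc₀
  · have hev : ∀ᶠ n in atTop, ∃ μ : H₁, sobolevNorm e β μ ≤ R ∧
        M * (τ n ^ 2 * N n ^ (-(2 * α))) ≤ ‖postBias K (Λ n) n μ‖ ^ 2 := by
      filter_upwards [hR] with n hn
      obtain ⟨j, θ₀, hθ₀, h1, h2⟩ := hn
      exact ⟨θ₀ • e j, h1 _ (Set.right_mem_Icc.2 hθ₀), h2⟩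
    obtain ⟨μ₀, hbdd, hμ₀⟩ := exists_seq_of_eventually hev
    refine ⟨μ₀, hbdd, tendsto_order.2 ⟨fun a ha => ?_, fun a ha => ?_⟩⟩
    · exact Eventually.of_forall fun n => ha.trans_le measureReal_nonneg
    · filter_upwards [hμ₀, hlow (a / 2) (by positivity)] with n h1 h2
      linarith [h2 _ h1]
  · have hev : ∀ᶠ n in atTop, ∃ μ : H₁, sobolevNorm e β μ ≤ R ∧
        coverage e K Z P (Λ n) γ n μ = c := by
      filter_upwards [hS.polynomial, hS.diagonal, hR, hlow c hc₀, hhigh (1 - c) (by linarith)]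
        with n h hD hn hl hh
      obtain ⟨j, θ₀, hθ₀, h1, h2⟩ := hn
      have hcont := continuous_coverage_smul (P := P) (Z := Z) (γ := γ) hD hZ (h.prior_pos j)
      have h0 : c ≤ coverage e K Z P (Λ n) γ n ((0 : ℝ) • e j) := by
        have := hh ((0 : ℝ) • e j) (by
          have := h.N_pos
          rw [postBias_smul, zero_smul, norm_zero, zero_pow two_ne_zero]
          positivity)
        linarith
      obtain ⟨θ, hθ, hθc⟩ := intermediate_value_Icc' hθ₀ hcont.continuousOn ⟨hl _ h2, h0⟩
      exact ⟨θ • e j, h1 θ hθ, hθc⟩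
    obtain ⟨μ₀, hbdd, hμ₀⟩ := exists_seq_of_eventually hev
    exact ⟨μ₀, hbdd, tendsto_const_nhds.congr' (hμ₀.mono fun n hn => hn.symm)⟩

end IsModelSequence

omit [SecondCountableTopology H₁] [BorelSpace H₁] in
theorem tendsto_coverage_one {μ₀ : ℕ → H₁}
    (h : ∀ δ : ℝ, 0 < δ → ∀ᶠ n in atTop, 1 - δ ≤ coverage e K Z P (Λ n) γ n (μ₀ n)) :
    Tendsto (fun n => coverage e K Z P (Λ n) γ n (μ₀ n)) atTop (𝓝 1) := by
  refine tendsto_order.2 ⟨fun a ha => ?_, fun a ha => ?_⟩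
  · filter_upwards [h ((1 - a) / 2) (by linarith)] with n hn
    linarith
  · exact Eventually.of_forall fun n => measureReal_le_one.trans_lt ha

end CoverageLimits

/-! ### The critical rate -/

section Rate

variable {τ a : ℕ → ℝ} {q : ℝ}

theorem tendsto_div_rpow_atTop (hq : 0 < q) (hτ : ∀ n, 0 < τ n) (ha : ∀ᶠ n in atTop, 0 < a n)
    (h : a =o[atTop] τ) : Tendsto (fun n => (τ n / a n) ^ q) atTop atTop := by
  refine (tendsto_rpow_atTop hq).comp ?_
  have h1 : Tendsto (fun n => a n / τ n) atTop (𝓝[>] 0) := by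
    refine tendsto_nhdsWithin_iff.2 ⟨h.tendsto_div_nhds_zero, ?_⟩
    filter_upwards [ha] with n hn
    exact div_pos hn (hτ n)
  exact h1.inv_tendsto_nhdsGT_zero.congr fun n => inv_div _ _

theorem eventually_div_rpow_le (hq : 0 < q) (hτ : ∀ n, 0 < τ n) (ha : ∀ᶠ n in atTop, 0 < a n)
    (h : τ =O[atTop] a) : ∃ k : ℝ, 0 < k ∧ ∀ᶠ n in atTop, (τ n / a n) ^ q ≤ k := by
  obtain ⟨c, hc, h⟩ := h.exists_pos
  refine ⟨c ^ q, by positivity, ?_⟩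
  filter_upwards [ha, h.bound] with n hn h1
  rw [Real.norm_of_nonneg (hτ n).le, Real.norm_of_nonneg hn.le] at h1
  have := hτ n
  exact Real.rpow_le_rpow (by positivity) ((div_le_iff₀ hn).2 h1) hq.le

theorem eventually_le_div_rpow (hq : 0 < q) (hτ : ∀ n, 0 < τ n) (ha : ∀ᶠ n in atTop, 0 < a n)
    (h : a =O[atTop] τ) : ∃ k : ℝ, 0 < k ∧ ∀ᶠ n in atTop, k ≤ (τ n / a n) ^ q := by
  obtain ⟨c, hc, h⟩ := h.exists_pos
  refine ⟨c⁻¹ ^ q, by positivity, ?_⟩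
  filter_upwards [ha, h.bound] with n hn h1
  rw [Real.norm_of_nonneg (hτ n).le, Real.norm_of_nonneg hn.le] at h1
  refine Real.rpow_le_rpow (by positivity) ?_ hq.le
  rw [le_div_iff₀ hn, inv_mul_le_iff₀ hc]
  exact h1

theorem isLittleO_rpow_one {s : ℝ} (hs : s < 0) :
    (fun n : ℕ => (n : ℝ) ^ s) =o[atTop] (fun _ => (1 : ℝ)) := by
  rw [isLittleO_one_iff]
  have := (tendsto_rpow_neg_atTop (neg_pos.2 hs)).comp tendsto_natCast_atTop_atTop
  rw [neg_neg] at this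
  exact this

theorem isLittleO_one_rpow {s : ℝ} (hs : 0 < s) :
    (fun _ : ℕ => (1 : ℝ)) =o[atTop] (fun n : ℕ => (n : ℝ) ^ s) := by
  rw [isLittleO_const_left]
  right
  exact tendsto_norm_atTop_atTop.comp ((tendsto_rpow_atTop hs).comp tendsto_natCast_atTop_atTop)

end Rate

/-! ### Posterior distribution and credibility -/

theorem theorem4p2 {H₁ H₂ Ω : Type*}
    [NormedAddCommGroup H₁] [InnerProductSpace ℝ H₁] [CompleteSpace H₁]
    [SecondCountableTopology H₁] [MeasurableSpace H₁] [BorelSpace H₁]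
    [NormedAddCommGroup H₂] [InnerProductSpace ℝ H₂] [CompleteSpace H₂]
    [MeasurableSpace Ω] (P : Measure Ω) [IsProbabilityMeasure P]
    (Z : H₂ → Ω → ℝ) (hZ : IsIsoGaussian Z P)
    (K : H₁ →L[ℝ] H₂) (e : HilbertBasis ℕ ℝ H₁) (κ : ℕ → ℝ)
    (hK : ∀ i, K.adjoint (K (e i)) = (κ i ^ 2) • e i)
    (α β p C γ : ℝ) (hα : 0 < α) (hβ : 0 < β) (hp : 0 ≤ p) (hC : 1 ≤ C)
    (hγ₀ : 0 < γ) (hγ₁ : γ < 1)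
    (hκ : ∀ i : ℕ, C⁻¹ * ((i : ℝ) + 1) ^ (-p) ≤ κ i ∧ κ i ≤ C * ((i : ℝ) + 1) ^ (-p))
    (τ : ℕ → ℝ) (hτ : ∀ n, 0 < τ n)
    (hnτ : Tendsto (fun n : ℕ => (n : ℝ) * τ n ^ 2) atTop atTop)
    (Λ : ℕ → H₁ →L[ℝ] H₁)
    (hΛ : ∀ n i, Λ n (e i) = (τ n ^ 2 * ((i : ℝ) + 1) ^ (-1 - 2 * α)) • e i)
    (β' : ℝ) (hβ' : β' = min β (1 + 2 * α + 2 * p))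
    (a : ℕ → ℝ) (ha : ∀ n : ℕ, a n = (n : ℝ) ^ ((α - β') / (1 + 2 * β' + 2 * p))) :
    -- `N(A Y, S_n)` is the posterior distribution for the prior `N(0, Λ n)`
    (∀ n : ℕ, 0 < n →
      postLaw e K (Λ n) n =ᵐ[likelihood K Z P n ∘ₘ gaussianMeasure 0 (Λ n)]
        posterior (likelihood K Z P n) (gaussianMeasure 0 (Λ n))) ∧
    -- case (i)
    (a =o[atTop] τ →
      (∀ ε : ℝ, 0 < ε → ∀ᶠ n in atTop, ∀ μ₀ : H₁, sobolevNorm e β μ₀ ≤ 1 →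
        1 - ε ≤ coverage e K Z P (Λ n) γ n μ₀) ∧
      (∀ R : ℝ≥0, ∃ c₁ c₂ : ℝ, 0 < c₁ ∧ 0 < c₂ ∧
        ∀ᶠ n in atTop, ∀ μ₀ : H₁, sobolevNorm e β μ₀ ≤ R → ∀ y : H₂ → ℝ,
          0 < credibleRadius e K (Λ n) γ n y ∧
          c₁ * credibleRadius e K (Λ n) γ n y ≤ confidenceRadius e K Z P (Λ n) γ n μ₀ ∧
          confidenceRadius e K Z P (Λ n) γ n μ₀ ≤ c₂ * credibleRadius e K (Λ n) γ n y)) ∧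
    -- case (ii), fixed truth
    (β < 1 + 2 * α + 2 * p → τ =Θ[atTop] a →
      ∀ μ₀ : H₁, sobolevNorm e β μ₀ < ∞ →
        Tendsto (fun n => coverage e K Z P (Λ n) γ n μ₀) atTop (𝓝 1)) ∧
    -- case (ii), sequences of truths
    (τ =Θ[atTop] a →
      ∀ c : ℝ, 0 ≤ c → c < 1 →
        ∃ μ₀ : ℕ → H₁, (⨆ n, sobolevNorm e β (μ₀ n)) < ∞ ∧
          Tendsto (fun n => coverage e K Z P (Λ n) γ n (μ₀ n)) atTop (𝓝 c)) ∧
    -- case (iii)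
    (τ =o[atTop] a →
      ∃ μ₀ : ℕ → H₁, (⨆ n, sobolevNorm e β (μ₀ n)) < ∞ ∧
        Tendsto (fun n => coverage e K Z P (Λ n) γ n (μ₀ n)) atTop (𝓝 0)) ∧
    -- no scaling
    ((∀ n, τ n = 1) →
      (α < β → a =o[atTop] τ) ∧
      (α = β → β < 1 + 2 * α + 2 * p ∧ τ =Θ[atTop] a) ∧
      (β < α → τ =o[atTop] a ∧
        ∃ μ₀ : H₁, sobolevNorm e β μ₀ < ∞ ∧
          Tendsto (fun n => coverage e K Z P (Λ n) γ n μ₀) atTop (𝓝 0))) := by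
  have hD : 0 < 1 + 2 * α + 2 * p := by linarith
  have hβ'0 : 0 < β' := hβ' ▸ lt_min hβ hD
  have hβ'1 : β' ≤ β := hβ' ▸ min_le_left _ _
  have hβ'2 : β' ≤ 1 + 2 * α + 2 * p := hβ' ▸ min_le_right _ _
  have hE : 0 < 1 + 2 * β' + 2 * p := by linarith
  have hS := isModelSequence hK hα hp hC hκ hτ hnτ hΛ
  set N : ℕ → ℝ := fun n => ((n : ℝ) * τ n ^ 2) ^ (1 + 2 * α + 2 * p)⁻¹ with hNdef
  set q := 2 * (1 + 2 * β' + 2 * p) / (1 + 2 * α + 2 * p) with hqdef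
  have hq : 0 < q := by positivity
  have ha0 : ∀ᶠ n in atTop, 0 < a n := by
    filter_upwards [eventually_gt_atTop 0] with n hn
    rw [ha]
    positivity
  have hQ : ∀ᶠ n in atTop,
      (τ n / a n) ^ q = τ n ^ 2 * N n ^ (-(2 * α)) * N n ^ (2 * β') := by
    filter_upwards [eventually_gt_atTop 0] with n hn
    rw [ha, hNdef, spread_mul_eq hα hp hβ'0 (hτ n) hn]
  have hQle : τ =O[atTop] a →
      ∃ k : ℝ, ∀ᶠ n in atTop, τ n ^ 2 * N n ^ (-(2 * α)) * N n ^ (2 * β') ≤ k := fun h => by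
    obtain ⟨k, -, hk⟩ := eventually_div_rpow_le hq hτ ha0 h
    refine ⟨k, ?_⟩
    filter_upwards [hQ, hk] with n h1 h2
    exact h1 ▸ h2
  obtain ⟨η, hη, hhigh⟩ := hS.eventually_one_sub_le_coverage hZ hα hC hγ₀ hγ₁
  refine ⟨fun n hn => ?_, fun h => ⟨fun ε hε => ?_, fun R => ?_⟩, fun hβD h μ₀ hμ₀ => ?_,
    fun h c hc₀ hc₁ => ?_, fun h => ?_, fun hτ1 => ⟨fun hαβ => ?_, fun hαβ => ?_, fun hαβ => ?_⟩⟩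
  · have hl : ∀ i : ℕ, 0 ≤ τ n ^ 2 * ((i : ℝ) + 1) ^ (-1 - 2 * α) := fun i => by positivity
    have hsum : Summable fun i : ℕ => τ n ^ 2 * ((i : ℝ) + 1) ^ (-1 - 2 * α) :=
      (summable_add_one_rpow (by linarith)).mul_left _
    have hκ0 : ∀ i, 0 < κ i := fun i => lt_of_lt_of_le (by positivity) (hκ i).1
    have hlaw := hZ.isGaussianLaw_tsum e (orthonormal_leftSingular hK hκ0) hl hsum (hΛ n)
    rw [← hlaw.gaussianMeasure_eq] at hlaw
    exact postLaw_ae_eq_posterior hZ hlaw (hΛ n) hl hn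
      (summable_adjoint_postMap hK hκ0 (hΛ n) hl hsum hn)
  · have hlim := (tendsto_div_rpow_atTop hq hτ ha0 h).congr' hQ
    filter_upwards [hhigh ε hε, hS.eventually_postBias_le hβ'0.le hβ'1 hβ'2 hlim hη 1]
      with n h1 h2 μ₀ hμ₀
    exact h1 μ₀ (h2 μ₀ (by simpa using hμ₀))
  · have hlim := (tendsto_div_rpow_atTop hq hτ ha0 h).congr' hQ
    obtain ⟨η', c₁, c₂, hη', hc₁, hc₂, hrad⟩ :=
      hS.eventually_confidenceRadius_bounds hZ hα hC hγ₀ hγ₁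
    refine ⟨c₁, c₂, hc₁, hc₂, ?_⟩
    filter_upwards [hrad, hS.eventually_postBias_le hβ'0.le hβ'1 hβ'2 hlim hη' R]
      with n h1 h2 μ₀ hμ₀
    exact h1 μ₀ (h2 μ₀ hμ₀)
  · have hββ' : β' = β := hβ'.trans (min_eq_left hβD.le)
    obtain ⟨k, hk, hkle⟩ := eventually_le_div_rpow hq hτ ha0 h.2
    have hQge : ∀ᶠ n in atTop, k ≤ τ n ^ 2 * N n ^ (-(2 * α)) * N n ^ (2 * β) := by
      filter_upwards [hQ, hkle] with n h1 h2
      rw [← hββ', ← h1]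
      exact h2
    refine tendsto_coverage_one fun δ hδ => ?_
    filter_upwards [hhigh δ hδ, hS.eventually_postBias_le_of_lt_top hβ.le hβD hk hQge hη hμ₀]
      with n h1 h2
    exact h1 μ₀ h2
  · obtain ⟨k, hk⟩ := hQle h.1
    exact hS.exists_seq_tendsto_coverage hZ hα hC hγ₀ hγ₁ hβ hβ' hk hc₀ hc₁
  · obtain ⟨k, hk⟩ := hQle h.isBigO
    exact hS.exists_seq_tendsto_coverage hZ hα hC hγ₀ hγ₁ hβ hβ' hk le_rfl one_pos
  · have hneg : (α - β') / (1 + 2 * β' + 2 * p) < 0 := by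
      refine div_neg_of_neg_of_pos (sub_neg.2 ?_) hE
      rw [hβ']
      exact lt_min hαβ (by linarith)
    rw [funext ha, funext hτ1]
    exact isLittleO_rpow_one hneg
  · have hββ' : β' = β := hβ'.trans (min_eq_left (by linarith))
    refine ⟨by linarith, ?_⟩
    have ha1 : a = τ := by
      funext n
      rw [ha, hτ1, hββ', hαβ, sub_self, zero_div, Real.rpow_zero]
    rw [ha1]
  · have hpos : 0 < (α - β') / (1 + 2 * β' + 2 * p) := div_pos (by linarith) hE
    refine ⟨?_, ?_⟩
    · rw [funext ha, funext hτ1]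
      exact isLittleO_one_rpow hpos
    · obtain ⟨M, -, hlow⟩ := hS.eventually_coverage_le hZ hα hC hγ₀ hγ₁
      obtain ⟨μ₀, hμ₀, hbias⟩ := hS.exists_fixed_le_postBias hβ hαβ hC hτ1
      refine ⟨μ₀, hμ₀, tendsto_order.2 ⟨fun b hb => ?_, fun b hb => ?_⟩⟩
      · exact Eventually.of_forall fun n => hb.trans_le measureReal_nonneg
      · filter_upwards [hbias M, hlow (b / 2) (by positivity)] with n h1 h2
        linarith [h2 μ₀ h1]
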